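/- Let $\mathfrak H=\ell^2(\mathbb N_0,L^2(\mathbb R))$, whose elements are the sequences $U=\{u_n\}_{n\ge 0}$, $u_n\in L^2(\mathbb R)$, with $\sum_n\|u_n\|^2<\infty$. Let $\mathcal W(\mathbb R)$ be the space of continuous functions $u$ on $\mathbb R$ whose restrictions to $(-\infty,0)$ and $(0,\infty)$ belong to the Sobolev space $H^2$, and put $(Lu)(x)=-u''(x)+\tfrac12u(x)$ for $x\ne0$. For $\alpha\ge0$ let $\mathbf A_\alpha$ be the operator in $\mathfrak H$ acting by $\mathbf A_\alpha\{u_n\}=\{(L+n)u_n\}$, whose domain consists of all $\{u_n\}\in\mathfrak H$ such that $u_n\in\mathcal W(\mathbb R)$ for all $n$, $\sum_n\|(L+n)u_n\|^2<\infty$, and $$u_n'(0+)-u_n'(0-)=\frac{\alpha}{\sqrt2}\bigl(\sqrt{n+1}\,u_{n+1}(0)+\sqrt n\,u_{n-1}(0)\bigr),\qquad n\in\mathbb N_0$$ (the last term being $0$ for $n=0$). (Under the expansion $U(x,q)=\sum_n u_n(x)\chi_n(q)$ in normalized Hermite functions, this is the operator $-U''_{xx}+\frac12(-U''_{qq}+q^2U)$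 in $L^2(\mathbb R^2)$ with the transmission condition $U'_x(0+,q)-U'_x(0-,q)=\alpha q\,U(0,q)$.) Let $\sigma_p(\mathbf A_\alpha)$ be the set of eigenvalues of $\mathbf A_\alpha$. **Theorem.** 1. For every $\alpha\ge0$ the operator $\mathbf A_\alpha$ has no eigenvalues $E\ge 1/2$, and $\sigma_p(\mathbf A_\alpha)=\emptyset$ for $\alpha\ge\sqrt2$. 2. Let $0<\alpha<\sqrt2$. Then $\mathbf A_\alpha$ is positive definite, i.e. there is $c>0$ (depending on $\alpha$) such that $(\mathbf A_\alpha U,U)$ is real and $(\mathbf A_\alpha U,U)\ge c\|U\|^2$ for all $U$ in the domain. Its point spectrum is non-empty and finite; every eigenvalue is real, smaller than $1/2$, and of finite multiplicity. The number $N(1/2;\mathbf A_\alpha)$ of eigenvalues of $\mathbf A_\alpha$ below $1/2$, counted with multiplicities, satisfies $$N(1/2;\mathbf A_\alpha)\sim\frac1{4\sqrt{2(\mu(\alpha)-1)}}\quad\text{as }\alpha\nearrow\sqrt2,\qquad \mu(\alpha)=\frac{\sqrt2}{\alpha},$$ that is, the quotient of the two sides tends to $1$. -/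

import Mathlib

open MeasureTheory Set Filter Topology Asymptotics
open scoped ContDiff

namespace Smilansky

/-! ### Sobolev spaces on open subsets of the line -/

/-- `v` is the weak (distributional) derivative of `u` on the open set `Ω ⊆ ℝ`. The test functions
vanish outside `Ω`, so the integrals are really integrals over `Ω`. -/
def HasWeakDeriv (Ω : Set ℝ) (u v : ℝ → ℂ) : Prop :=
  LocallyIntegrableOn u Ω volume ∧ LocallyIntegrableOn v Ω volume ∧
    ∀ φ : ℝ → ℝ, ContDiff ℝ ∞ φ → HasCompactSupport φ → tsupport φ ⊆ Ω →
      ∫ x, deriv φ x • u x = -∫ x, φ x • v x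

/-- `u` belongs to the Sobolev space `H²(Ω)` and its second weak derivative on `Ω` is `w`. -/
def IsH2With (Ω : Set ℝ) (u w : ℝ → ℂ) : Prop :=
  MemLp u 2 (volume.restrict Ω) ∧ MemLp w 2 (volume.restrict Ω) ∧
    ∃ v : ℝ → ℂ, MemLp v 2 (volume.restrict Ω) ∧ HasWeakDeriv Ω u v ∧ HasWeakDeriv Ω v w

/-- The Sobolev space `H²(Ω)`. -/
def MemH2 (Ω : Set ℝ) (u : ℝ → ℂ) : Prop := ∃ w, IsH2With Ω u w

/-- The space `𝒲(ℝ)` of continuous functions on the line whose restrictions to the two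
open half-lines belong to `H²`. -/
def MemW (u : ℝ → ℂ) : Prop := Continuous u ∧ MemH2 (Iio 0) u ∧ MemH2 (Ioi 0) u

/-! ### The operators -/

/-- The Hilbert space `ℓ²(ℕ₀, L²(ℝ))`. -/
abbrev H : Type := lp (fun _ : ℕ => Lp ℂ 2 (volume : Measure ℝ)) 2

/-- The matching conditions
`uₙ'(0+) - uₙ'(0-) = (α/√2) (√(n+1) uₙ₊₁(0) + √n uₙ₋₁(0))` for all `n`.
A function of `𝒲(ℝ)` is continuously differentiable up to `0` from either side, and `uₙ'(0±)` are
its one-sided derivatives at `0`. For `n = 0` the last summand is `0`. -/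
def Matching (α : ℝ) (u : ℕ → ℝ → ℂ) : Prop :=
  ∀ n : ℕ, ∃ a b : ℂ, HasDerivWithinAt (u n) a (Ici 0) 0 ∧ HasDerivWithinAt (u n) b (Iic 0) 0 ∧
    a - b = ((α / √2 : ℝ) : ℂ) *
      (((√((n : ℝ) + 1) : ℝ) : ℂ) * u (n + 1) 0 + ((√(n : ℝ) : ℝ) : ℂ) * u (n - 1) 0)

/-- `w = (L + n) u`, where `(L u)(x) = -u''(x) + u(x)/2` for `x ≠ 0`; here `u''` is the
second weak derivative on the two open half-lines. -/
def IsLPlus (n : ℕ) (u w : ℝ → ℂ) : Prop :=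
  ∃ h : ℝ → ℂ, IsH2With (Iio 0) u h ∧ IsH2With (Ioi 0) u h ∧
    w =ᵐ[volume] fun x => -h x + ((n : ℂ) + 1 / 2) * u x

/-- `U = {uₙ}` lies in the domain `𝒟_α` (all `uₙ` are in `𝒲(ℝ)`, the matching conditions hold, and
`∑ ‖(L + n) uₙ‖² < ∞`) and `F = {(L + n) uₙ}`. The summability is expressed by `F` being an
element of `ℓ²(ℕ₀, L²(ℝ))`. -/
def ActsAs (α : ℝ) (U F : H) : Prop :=
  ∃ u : ℕ → ℝ → ℂ, (∀ n, MemW (u n)) ∧ (∀ n, U n =ᵐ[volume] u n) ∧ Matching α u ∧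
    ∀ n, IsLPlus n (u n) (F n)

theorem HasWeakDeriv.integrable_smul {Ω : Set ℝ} {u : ℝ → ℂ}
    (hu : LocallyIntegrableOn u Ω volume) {φ : ℝ → ℝ} (hφ : Continuous φ)
    (hc : HasCompactSupport φ) (hs : tsupport φ ⊆ Ω) : Integrable (fun x => φ x • u x) := by
  have h1 : IntegrableOn u (tsupport φ) := hu.integrableOn_compact_subset hs hc
  have h2 : IntegrableOn (fun x => φ x • u x) (tsupport φ) :=
    h1.continuousOn_smul hφ.continuousOn hc
  refine (integrableOn_iff_integrable_of_support_subset ?_).1 h2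
  intro x hx
  apply subset_tsupport
  intro h0
  exact hx (by simp [h0])

theorem HasWeakDeriv.add {Ω : Set ℝ} {u v u' v' : ℝ → ℂ}
    (h : HasWeakDeriv Ω u v) (h' : HasWeakDeriv Ω u' v') :
    HasWeakDeriv Ω (u + u') (v + v') := by
  refine ⟨h.1.add h'.1, h.2.1.add h'.2.1, fun φ hφ hc hs => ?_⟩
  have hd : Continuous (deriv φ) := hφ.continuous_deriv (by simp)
  have hs' : tsupport (deriv φ) ⊆ Ω := (closure_minimal support_deriv_subset
    (isClosed_tsupport φ)).trans hs
  simp only [Pi.add_apply, smul_add]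
  rw [integral_add (integrable_smul h.1 hd hc.deriv hs') (integrable_smul h'.1 hd hc.deriv hs'),
    integral_add (integrable_smul h.2.1 hφ.continuous hc hs)
      (integrable_smul h'.2.1 hφ.continuous hc hs), h.2.2 φ hφ hc hs, h'.2.2 φ hφ hc hs]
  ring

theorem HasWeakDeriv.const_smul {Ω : Set ℝ} {u v : ℝ → ℂ} (c : ℂ)
    (h : HasWeakDeriv Ω u v) : HasWeakDeriv Ω (c • u) (c • v) := by
  refine ⟨h.1.smul c, h.2.1.smul c, fun φ hφ hc hs => ?_⟩
  simp only [Pi.smul_apply, smul_comm _ c]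
  rw [integral_smul, integral_smul, h.2.2 φ hφ hc hs, smul_neg]

theorem HasWeakDeriv.ae_eq_zero {Ω : Set ℝ} (hΩ : IsOpen Ω) {u v : ℝ → ℂ}
    (h : HasWeakDeriv Ω u v) (hu : ∀ᵐ x, x ∈ Ω → u x = 0) : ∀ᵐ x, x ∈ Ω → v x = 0 := by
  refine hΩ.ae_eq_zero_of_integral_contDiff_smul_eq_zero h.2.1 fun φ hφ hc hs => ?_
  have hs' : tsupport (deriv φ) ⊆ Ω := (closure_minimal support_deriv_subset
    (isClosed_tsupport φ)).trans hs
  have h0 : ∫ x, deriv φ x • u x = 0 := by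
    apply integral_eq_zero_of_ae
    filter_upwards [hu] with x hx
    by_cases hxΩ : x ∈ Ω
    · simp [hx hxΩ]
    · simp [image_eq_zero_of_notMem_tsupport fun h => hxΩ (hs' h)]
  have := h.2.2 φ hφ hc hs
  rw [h0] at this
  exact neg_eq_zero.1 this.symm

theorem IsH2With.add {Ω : Set ℝ} {u w u' w' : ℝ → ℂ} (h : IsH2With Ω u w)
    (h' : IsH2With Ω u' w') : IsH2With Ω (u + u') (w + w') := by
  obtain ⟨h1, h2, v, h3, h4, h5⟩ := h
  obtain ⟨h1', h2', v', h3', h4', h5'⟩ := h'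
  exact ⟨h1.add h1', h2.add h2', v + v', h3.add h3', h4.add h4', h5.add h5'⟩

theorem IsH2With.const_smul {Ω : Set ℝ} {u w : ℝ → ℂ} (c : ℂ) (h : IsH2With Ω u w) :
    IsH2With Ω (c • u) (c • w) := by
  obtain ⟨h1, h2, v, h3, h4, h5⟩ := h
  exact ⟨h1.const_smul c, h2.const_smul c, c • v, h3.const_smul c, h4.const_smul c,
    h5.const_smul c⟩

theorem IsH2With.zero (Ω : Set ℝ) : IsH2With Ω 0 0 := by
  have h : HasWeakDeriv Ω 0 0 :=
    ⟨locallyIntegrableOn_zero, locallyIntegrableOn_zero, fun φ _ _ _ => by simp⟩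
  exact ⟨MemLp.zero, MemLp.zero, 0, MemLp.zero, h, h⟩

theorem MemW.add {u u' : ℝ → ℂ} (h : MemW u) (h' : MemW u') : MemW (u + u') := by
  obtain ⟨h1, ⟨w, h2⟩, ⟨z, h3⟩⟩ := h
  obtain ⟨h1', ⟨w', h2'⟩, ⟨z', h3'⟩⟩ := h'
  exact ⟨h1.add h1', ⟨_, h2.add h2'⟩, ⟨_, h3.add h3'⟩⟩

theorem MemW.const_smul {u : ℝ → ℂ} (c : ℂ) (h : MemW u) : MemW (c • u) := by
  obtain ⟨h1, ⟨w, h2⟩, ⟨z, h3⟩⟩ := h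
  exact ⟨h1.const_smul c, ⟨_, h2.const_smul c⟩, ⟨_, h3.const_smul c⟩⟩

theorem ActsAs.add {α : ℝ} {U F U' F' : H} (h : ActsAs α U F) (h' : ActsAs α U' F') :
    ActsAs α (U + U') (F + F') := by
  obtain ⟨u, h1, h2, h3, h4⟩ := h
  obtain ⟨u', h1', h2', h3', h4'⟩ := h'
  refine ⟨u + u', fun n => (h1 n).add (h1' n), fun n => ?_, fun n => ?_, fun n => ?_⟩
  · rw [lp.coeFn_add, Pi.add_apply]
    exact (Lp.coeFn_add _ _).trans ((h2 n).add (h2' n))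
  · obtain ⟨a, b, ha, hb, hab⟩ := h3 n
    obtain ⟨a', b', ha', hb', hab'⟩ := h3' n
    refine ⟨a + a', b + b', ha.add ha', hb.add hb', ?_⟩
    simp only [Pi.add_apply]
    linear_combination hab + hab'
  · obtain ⟨k, hk1, hk2, hk3⟩ := h4 n
    obtain ⟨k', hk1', hk2', hk3'⟩ := h4' n
    refine ⟨k + k', hk1.add hk1', hk2.add hk2', ?_⟩
    rw [lp.coeFn_add, Pi.add_apply]
    filter_upwards [Lp.coeFn_add (F n) (F' n), hk3, hk3'] with x e1 e2 e3
    rw [e1, Pi.add_apply, e2, e3]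
    simp only [Pi.add_apply]
    ring

theorem ActsAs.const_smul {α : ℝ} (c : ℂ) {U F : H} (h : ActsAs α U F) :
    ActsAs α (c • U) (c • F) := by
  obtain ⟨u, h1, h2, h3, h4⟩ := h
  refine ⟨c • u, fun n => (h1 n).const_smul c, fun n => ?_, fun n => ?_, fun n => ?_⟩
  · rw [lp.coeFn_smul, Pi.smul_apply]
    exact (Lp.coeFn_smul _ _).trans ((h2 n).const_smul c)
  · obtain ⟨a, b, ha, hb, hab⟩ := h3 n
    refine ⟨c • a, c • b, ha.const_smul c, hb.const_smul c, ?_⟩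
    simp only [Pi.smul_apply, smul_eq_mul]
    linear_combination c * hab
  · obtain ⟨k, hk1, hk2, hk3⟩ := h4 n
    refine ⟨c • k, hk1.const_smul c, hk2.const_smul c, ?_⟩
    rw [lp.coeFn_smul, Pi.smul_apply]
    filter_upwards [Lp.coeFn_smul c (F n), hk3] with x e1 e2
    rw [e1, Pi.smul_apply, e2]
    simp only [Pi.smul_apply, smul_eq_mul]
    ring

theorem ActsAs.zero (α : ℝ) : ActsAs α 0 0 := by
  refine ⟨0, fun n => ⟨continuous_const, ⟨0, IsH2With.zero _⟩, ⟨0, IsH2With.zero _⟩⟩, fun n => ?_,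
    fun n => ⟨0, 0, hasDerivWithinAt_const _ _ _, hasDerivWithinAt_const _ _ _, by simp⟩,
    fun n => ⟨0, IsH2With.zero _, IsH2With.zero _, ?_⟩⟩
  · exact Lp.coeFn_zero _ _ _
  · filter_upwards [Lp.coeFn_zero ℂ 2 (volume : Measure ℝ)] with x hx
    simp

/-- The graph of the operator `A_α`. -/
def graph (α : ℝ) : Submodule ℂ (H × H) where
  carrier := {p | ActsAs α p.1 p.2}
  add_mem' h h' := ActsAs.add h h'
  zero_mem' := ActsAs.zero α
  smul_mem' c _ h := ActsAs.const_smul c h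

/-- The operator `A_α` in `ℓ²(ℕ₀, L²(ℝ))`, with domain `𝒟_α`, acting by
`{uₙ} ↦ {(L + n) uₙ}`. By `mem_graph_iff` below its graph is the relation `ActsAs α`. -/
noncomputable def A (α : ℝ) : H →ₗ.[ℂ] H := (graph α).toLinearPMap

theorem mem_graph_iff (α : ℝ) (U F : H) : (U, F) ∈ (A α).graph ↔ ActsAs α U F := by
  have key : ∀ x ∈ graph α, x.1 = 0 → x.2 = 0 := by
    rintro ⟨U, F⟩ ⟨u, -, h2, -, h4⟩ hU
    dsimp only at hU h2 h4 ⊢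
    subst hU
    apply lp.ext
    funext n
    have hu : ∀ᵐ x, u n x = 0 := by
      filter_upwards [h2 n, Lp.coeFn_zero ℂ 2 (volume : Measure ℝ)] with x e1 e2
      rw [← e1]
      exact e2
    have hz : ∀ (Ω : Set ℝ) (k : ℝ → ℂ), IsOpen Ω → IsH2With Ω (u n) k →
        ∀ᵐ x, x ∈ Ω → k x = 0 := by
      rintro Ω k hΩ ⟨-, -, v, -, hv, hk⟩
      exact hk.ae_eq_zero hΩ (hv.ae_eq_zero hΩ (hu.mono fun x hx _ => hx))
    obtain ⟨k, hk1, hk2, hk3⟩ := h4 n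
    apply Lp.ext
    have h0 : ∀ᵐ x : ℝ, x ≠ 0 := by simp [ae_iff]
    filter_upwards [hk3, hz _ k isOpen_Iio hk1, hz _ k isOpen_Ioi hk2, hu, h0,
      Lp.coeFn_zero ℂ 2 (volume : Measure ℝ)] with x e1 e2 e3 e4 e5 e6
    have hkx : k x = 0 := by
      rcases lt_or_gt_of_ne e5 with h | h
      · exact e2 h
      · exact e3 h
    rw [e1, e4, hkx]
    simp
  rw [A, Submodule.toLinearPMap_graph_eq _ key]
  rfl

/-! ### Spectral notions for unbounded operators -/

/-- The eigenspace `{U ∈ Dom T | T U = E U}`. -/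
noncomputable def eigenspace (T : H →ₗ.[ℂ] H) (E : ℂ) : Submodule ℂ H :=
  T.graph.comap (LinearMap.prod LinearMap.id (E • LinearMap.id))

theorem mem_eigenspace_iff (T : H →ₗ.[ℂ] H) (E : ℂ) (U : H) :
    U ∈ eigenspace T E ↔ ∃ h : U ∈ T.domain, T ⟨U, h⟩ = E • U := by
  simp only [eigenspace, Submodule.mem_comap, LinearPMap.mem_graph_iff]
  constructor
  · rintro ⟨⟨y, hy⟩, h1, h2⟩
    obtain rfl : y = U := h1
    exact ⟨hy, h2⟩
  · rintro ⟨h, h2⟩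
    exact ⟨⟨U, h⟩, rfl, h2⟩

/-- The point spectrum: the set of all eigenvalues. -/
def pointSpectrum (T : H →ₗ.[ℂ] H) : Set ℂ := {E | ∃ U ∈ eigenspace T E, U ≠ 0}

/-- `T` is positive definite: for some `c > 0`, the number `(T U, U)` is real and at least
`c ‖U‖²` for all `U` in the domain. -/
def IsPositiveDefinite (T : H →ₗ.[ℂ] H) : Prop :=
  ∃ c : ℝ, 0 < c ∧ ∀ U : T.domain,
    (inner ℂ (T U) (U : H)).im = 0 ∧ c * ‖(U : H)‖ ^ 2 ≤ (inner ℂ (T U) (U : H)).re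

/-- `N(b; T)`: the number of eigenvalues `E < b` of `T`, counted with multiplicities. (It is
meaningful when there are finitely many such eigenvalues, with finite multiplicities.) -/
noncomputable def eigenvalueCount (b : ℝ) (T : H →ₗ.[ℂ] H) : ℕ :=
  ∑ᶠ E : Iio b, Module.finrank ℂ (eigenspace T ((E : ℝ) : ℂ))

end Smilansky

namespace Smilansky

/-! ### Absolutely continuous functions -/

/-! Everything reduces to a three-term recurrence. The operator is symmetric, so an eigenvalue E is
real, and on each half-line an eigenvector satisfies u_n'' = (n + 1/2 - E) u_n. If E ≥ n + 1/2, the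
only L² solution is 0; otherwise u_n = C_n e^{-κ_n|x|} with κ_n = √(n + 1/2 - E), and the matching
condition reads -2κ_n C_n = (α/√2)(√(n+1) C_{n+1} + √n C_{n-1}). For α > 0 the number C_0 determines
all C_n: eigenvalues are simple, and E ≥ 1/2 is impossible because then u_0 = 0. For α = 0 the
condition itself gives C_n = 0. For α > 0 and E < 1/2 put C_n = (-1)^n C_0 P_n and μ = √2/α; then
2μκ_n P_n = √(n+1) P_{n+1} + √n P_{n-1}, P_0 = 1, and E is an eigenvalue iff ∑ P_n²/√(n+1) < ∞
(`mem_pointSpectrum_iff`).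

If μ ≤ 1, such sums diverge. For most parameters a Turán determinant of the rescaled solution stays
too large; in the remaining case, μ = 1 and E ≤ 0, the solution does not decrease in absolute value
(`not_summable_eigenSol`).

If μ > 1, the number N of eigenvalues below 1/2 is bounded from both sides. Among functions with
prescribed value at 0 the exponential minimizes the energy, so lower bounds for (A_α U, U) follow
from lower bounds for the Jacobi form of the traces C_n (`ActsAs.le_re_inner`). This gives positive
definiteness, and it gives N ≤ k as soon as the Jacobi form at E = 1/2 is nonnegative on a subspace
cut out by k linear conditions (`card_eigenvalues_le`). From below, oscillation theory is used: as E
grows from 0, where P has no sign change, the number of sign changes can increase only at an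
eigenvalue, and by one, so N is at least the number of sign changes at any E < 1/2
(`exists_summable_eigenSol`).

Both bounds are made explicit by comparison with a solvable model. After conjugation with the weight
(n + 1/2)^{1/4} the matrix at E = 1/2 has off-diagonal entries n + 1 + O(1/n) and diagonal entries
2μ(n + 1/4) + O(1/n). The Jacobi matrix with entries n + 1 and 2μn + β has, for β = μ -
(2m+1)√(μ²-1), a Meixner solution with exactly m sign changes: it is a polynomial in n of degree at
most m times a geometric factor, and a discrete Rolle argument produces m alternations. Picone's
inequality makes the form nonnegative under one condition per sign change; cutting the solution at
its sign changes makes the form nonpositive on an m-dimensional space. The value β = μ/2 required by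
the comparison gives m ≈ μ/(4√(μ²-1)), hence N ~ 1/(4√(2(μ-1))). The O(1/n) errors are absorbed by
discarding the first M indices, at the cost of M in each bound; M is fixed while μ → 1, so it does
not affect the limit. -/

theorem absolutelyContinuousOnInterval_integral {f : ℝ → ℂ} {a b : ℝ}
    (h : IntervalIntegrable f volume a b) :
    AbsolutelyContinuousOnInterval (fun x => ∫ t in a..x, f t) a b := by
  -- Increments of the primitive of f are dominated by those of the primitive of ‖f‖.
  have hG := h.norm.absolutelyContinuousOnInterval_intervalIntegral (c := a) (by simp)
  unfold AbsolutelyContinuousOnInterval at hG ⊢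
  refine squeeze_zero' (Eventually.of_forall fun _ => Finset.sum_nonneg fun _ _ => dist_nonneg)
    ?_ hG
  have : ∀ᶠ E : ℕ × (ℕ → ℝ × ℝ) in AbsolutelyContinuousOnInterval.totalLengthFilter ⊓
      𝓟 (AbsolutelyContinuousOnInterval.disjWithin a b),
      E ∈ AbsolutelyContinuousOnInterval.disjWithin a b :=
    eventually_inf_principal.mpr (by simp)
  filter_upwards [this] with E hE
  refine Finset.sum_le_sum fun i hi => ?_
  have hm := hE.1 i hi
  have hsub : ∀ x ∈ uIcc a b, IntervalIntegrable f volume a x := fun x hx =>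
    h.mono_set (uIcc_subset_uIcc_left hx)
  rw [dist_eq_norm, Real.dist_eq,
    intervalIntegral.integral_interval_sub_left (hsub _ hm.1) (hsub _ hm.2),
    intervalIntegral.integral_interval_sub_left (hsub _ hm.1).norm (hsub _ hm.2).norm]
  exact intervalIntegral.norm_integral_le_abs_integral_norm

/-- Integration by parts for merely integrable derivatives: the product minus the primitive of the
formal derivative is absolutely continuous with derivative zero almost everywhere, hence constant.
-/
theorem integral_deriv_mul_of_primitive {p p' q q' : ℝ → ℂ} {a b : ℝ} (hab : a ≤ b)
    (hp' : IntervalIntegrable p' volume a b) (hq' : IntervalIntegrable q' volume a b)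
    (hp : ∀ x ∈ Icc a b, p x = p a + ∫ t in a..x, p' t)
    (hq : ∀ x ∈ Icc a b, q x = q a + ∫ t in a..x, q' t) :
    IntervalIntegrable (fun x => p' x * q x + p x * q' x) volume a b ∧
    ∫ x in a..b, (p' x * q x + p x * q' x) = p b * q b - p a * q a := by
  set P : ℝ → ℂ := fun x => p a + ∫ t in a..x, p' t with hP
  set Q : ℝ → ℂ := fun x => q a + ∫ t in a..x, q' t with hQ
  have hcst : ∀ c : ℂ, AbsolutelyContinuousOnInterval (fun _ : ℝ => c) a b := fun c =>
    (LipschitzWith.const c).lipschitzOnWith.absolutelyContinuousOnInterval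
  have hPac : AbsolutelyContinuousOnInterval P a b :=
    (hcst (p a)).add (absolutelyContinuousOnInterval_integral hp')
  have hQac : AbsolutelyContinuousOnInterval Q a b :=
    (hcst (q a)).add (absolutelyContinuousOnInterval_integral hq')
  have hint : IntervalIntegrable (fun x => p' x * Q x + P x * q' x) volume a b :=
    (hp'.mul_continuousOn hQac.continuousOn).add (hq'.continuousOn_mul hPac.continuousOn)
  have hcongr : EqOn (fun x => p' x * Q x + P x * q' x)
      (fun x => p' x * q x + p x * q' x) (uIcc a b) := by
    intro x hx
    rw [uIcc_of_le hab] at hx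
    simp only [hP, hQ, ← hp x hx, ← hq x hx]
  refine ⟨hint.congr (hcongr.mono uIoc_subset_uIcc), ?_⟩
  rw [← intervalIntegral.integral_congr hcongr]
  have hac : AbsolutelyContinuousOnInterval
      (P • Q - fun x => ∫ t in a..x, (p' t * Q t + P t * q' t)) a b :=
    (hPac.smul hQac).sub (absolutelyContinuousOnInterval_integral hint)
  obtain ⟨C, hC⟩ := hac.const_of_ae_hasDerivAt_zero (by
    filter_upwards [hp'.ae_hasDerivAt_integral, hq'.ae_hasDerivAt_integral,
      hint.ae_hasDerivAt_integral] with x h1 h2 h3 hx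
    have e1 : HasDerivAt P (p' x) x := (h1 hx a (by simp)).const_add _
    have e2 : HasDerivAt Q (q' x) x := (h2 hx a (by simp)).const_add _
    have e3 := h3 hx a (by simp)
    have := (e1.mul e2).sub e3
    rwa [sub_self] at this)
  have h1 := hC a (by simp)
  have h2 := hC b (by simp)
  have ea : P a = p a := (hp a (by simp [hab])).symm
  have eb : P b = p b := (hp b (by simp [hab])).symm
  have ea' : Q a = q a := (hq a (by simp [hab])).symm
  have eb' : Q b = q b := (hq b (by simp [hab])).symm
  simp only [Pi.sub_apply, smul_eq_mul, intervalIntegral.integral_same, Pi.mul_apply] at h1 h2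
  rw [ea, ea'] at h1
  rw [eb, eb'] at h2
  linear_combination h1 - h2

/-! ### Primitives in `L²` of the half-line -/

/-- `p` is, on `[0, ∞)`, a primitive of `p'`, and both functions are in `L²(0, ∞)`. -/
structure HalfLinePrimitive (p p' : ℝ → ℂ) : Prop where
  memLp : MemLp p 2 (volume.restrict (Ioi 0))
  memLp' : MemLp p' 2 (volume.restrict (Ioi 0))
  eq : ∀ x, 0 ≤ x → p x = p 0 + ∫ t in (0 : ℝ)..x, p' t

theorem intervalIntegrable_of_memLp {f : ℝ → ℂ} (hf : MemLp f 2 (volume.restrict (Ioi 0)))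
    {a b : ℝ} (ha : 0 ≤ a) (hb : 0 ≤ b) : IntervalIntegrable f volume a b := by
  rw [intervalIntegrable_iff]
  have h1 : uIoc a b ⊆ Ioi 0 := fun x hx => lt_of_le_of_lt (le_min ha hb) hx.1
  have h2 : MemLp f 2 (volume.restrict (uIoc a b)) := hf.mono_measure (Measure.restrict_mono h1 le_rfl)
  have : IsFiniteMeasure (volume.restrict (uIoc a b)) :=
    ⟨by simp [uIoc]⟩
  exact h2.integrable (by norm_num)

theorem integrableOn_conj_mul {f g : ℝ → ℂ} {s : Set ℝ} (hf : MemLp f 2 (volume.restrict s))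
    (hg : MemLp g 2 (volume.restrict s)) :
    IntegrableOn (fun x => (starRingEnd ℂ) (f x) * g x) s volume :=
  (hf.star).integrable_mul hg

theorem HalfLinePrimitive.eq_from {p p' : ℝ → ℂ} (h : HalfLinePrimitive p p') {a x : ℝ}
    (ha : 0 ≤ a) (hx : 0 ≤ x) : p x = p a + ∫ t in a..x, p' t := by
  rw [h.eq x hx, h.eq a ha, add_assoc, intervalIntegral.integral_add_adjacent_intervals
    (intervalIntegrable_of_memLp h.memLp' le_rfl ha) (intervalIntegrable_of_memLp h.memLp' ha hx)]

/-- Integration by parts on [a, ∞) without boundary term at infinity: p̄q has a limit there because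
its derivative is integrable, and the limit is 0 because p̄q is itself integrable. -/
theorem HalfLinePrimitive.integral_Ioi {p p' q q' : ℝ → ℂ} (hp : HalfLinePrimitive p p')
    (hq : HalfLinePrimitive q q') {a : ℝ} (ha : 0 ≤ a) :
    ∫ x in Ioi a, ((starRingEnd ℂ) (p' x) * q x + (starRingEnd ℂ) (p x) * q' x) =
      -((starRingEnd ℂ) (p a) * q a) := by
  have hsub : Ioi a ⊆ Ioi (0 : ℝ) := Ioi_subset_Ioi ha
  have hI0 : IntegrableOn (fun x => (starRingEnd ℂ) (p' x) * q x + (starRingEnd ℂ) (p x) * q' x)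
      (Ioi a) := ((integrableOn_conj_mul hp.memLp' hq.memLp).mono_set hsub).add
        ((integrableOn_conj_mul hp.memLp hq.memLp').mono_set hsub)
  have hI1 : IntegrableOn (fun x => (starRingEnd ℂ) (p x) * q x) (Ioi a) :=
    (integrableOn_conj_mul hp.memLp hq.memLp).mono_set hsub
  have hft : ∀ b, a ≤ b → ∫ x in a..b, ((starRingEnd ℂ) (p' x) * q x +
      (starRingEnd ℂ) (p x) * q' x) = (starRingEnd ℂ) (p b) * q b - (starRingEnd ℂ) (p a) * q a := by
    intro b hab
    refine (integral_deriv_mul_of_primitive hab ?_ ?_ ?_ ?_).2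
    · exact intervalIntegrable_of_memLp hp.memLp'.star ha (ha.trans hab)
    · exact intervalIntegrable_of_memLp hq.memLp' ha (ha.trans hab)
    · intro x hx
      rw [hp.eq_from ha (ha.trans hx.1), map_add]
      congr 1
      rw [intervalIntegral.integral_of_le hx.1, intervalIntegral.integral_of_le hx.1,
        ← integral_conj]
    · intro x hx
      exact hq.eq_from ha (ha.trans hx.1)
  have hlim := intervalIntegral_tendsto_integral_Ioi a hI0 tendsto_id
  have hlim2 : Tendsto (fun b => (starRingEnd ℂ) (p b) * q b) atTop
      (𝓝 ((∫ x in Ioi a, ((starRingEnd ℂ) (p' x) * q x + (starRingEnd ℂ) (p x) * q' x)) +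
        (starRingEnd ℂ) (p a) * q a)) := by
    refine (hlim.add_const ((starRingEnd ℂ) (p a) * q a)).congr' ?_
    filter_upwards [eventually_ge_atTop a] with b hb
    simp only [id]
    rw [hft b hb]
    ring
  have h0 : (∫ x in Ioi a, ((starRingEnd ℂ) (p' x) * q x + (starRingEnd ℂ) (p x) * q' x)) +
        (starRingEnd ℂ) (p a) * q a = 0 := by
    by_contra hne
    set L := (∫ x in Ioi a, ((starRingEnd ℂ) (p' x) * q x + (starRingEnd ℂ) (p x) * q' x)) +
        (starRingEnd ℂ) (p a) * q a with hL
    have hpos : 0 < ‖L‖ := norm_pos_iff.2 hne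
    have hev : ∀ᶠ b in atTop, ‖L‖ / 2 < ‖(starRingEnd ℂ) (p b) * q b‖ :=
      hlim2.norm.eventually (lt_mem_nhds (by linarith))
    obtain ⟨B, hB⟩ := eventually_atTop.1 hev
    have hI2 : IntegrableOn (fun _ : ℝ => ‖L‖ / 2) (Ioi (max a B)) := by
      refine Integrable.mono (hI1.mono_set (Ioi_subset_Ioi (le_max_left a B)))
        aestronglyMeasurable_const ?_
      rw [ae_restrict_iff' measurableSet_Ioi]
      refine Eventually.of_forall fun x hx => ?_
      rw [Real.norm_of_nonneg (by positivity)]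
      exact (hB x (le_of_lt (lt_of_le_of_lt (le_max_right a B) hx))).le
    rw [integrableOn_const_iff] at hI2
    rcases hI2 with h | h
    · rw [enorm_eq_zero] at h
      linarith
    · simp at h
  exact eq_neg_of_add_eq_zero_left h0

/-! ### Weak derivatives on the half-line -/

theorem exists_Icc_of_tsupport {φ : ℝ → ℝ} (hc : HasCompactSupport φ) (hs : tsupport φ ⊆ Ioi 0) :
    ∃ a b, 0 < a ∧ a < b ∧ tsupport φ ⊆ Ioo a b := by
  rcases (tsupport φ).eq_empty_or_nonempty with he | hne
  · exact ⟨1, 2, by norm_num, by norm_num, by simp [he]⟩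
  obtain ⟨a, ha⟩ := hc.isCompact.exists_isLeast hne
  obtain ⟨b, hb⟩ := hc.isCompact.exists_isGreatest hne
  have ha0 : 0 < a := hs ha.1
  have hab : a ≤ b := ha.2 hb.1
  exact ⟨a / 2, b + 1, by positivity, by linarith, fun x hx =>
    ⟨by linarith [ha.2 hx], by linarith [hb.2 hx]⟩⟩

theorem integral_eq_intervalIntegral {E : Type*} [NormedAddCommGroup E] [NormedSpace ℝ E]
    {f : ℝ → E} {a b : ℝ} (hab : a ≤ b)
    (h : ∀ x, x ∉ Ioo a b → f x = 0) : ∫ x, f x = ∫ x in a..b, f x := by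
  rw [intervalIntegral.integral_of_le hab]
  refine (setIntegral_eq_integral_of_forall_compl_eq_zero fun x hx => h x fun h' => hx ?_).symm
  exact Ioo_subset_Ioc_self h'

theorem tsupport_deriv_subset' {φ : ℝ → ℝ} : tsupport (deriv φ) ⊆ tsupport φ :=
  closure_minimal support_deriv_subset (isClosed_tsupport φ)

theorem hasWeakDeriv_primitive {v : ℝ → ℂ} (hv : MemLp v 2 (volume.restrict (Ioi 0))) :
    HasWeakDeriv (Ioi 0) (fun x => ∫ t in (0 : ℝ)..x, v t) v := by
  have hcont : ContinuousOn (fun x => ∫ t in (0 : ℝ)..x, v t) (Ioi 0) := by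
    intro x hx
    have hx0 : (0 : ℝ) < x := hx
    have h1 := (absolutelyContinuousOnInterval_integral (intervalIntegrable_of_memLp hv le_rfl
      (show (0 : ℝ) ≤ x + 1 by linarith))).continuousOn
    rw [uIcc_of_le (by linarith)] at h1
    exact (h1.continuousAt (Icc_mem_nhds hx (by linarith))).continuousWithinAt
  refine ⟨hcont.locallyIntegrableOn measurableSet_Ioi, ?_, ?_⟩
  · exact locallyIntegrableOn_of_locallyIntegrable_restrict (hv.locallyIntegrable (by norm_num))
  · intro φ hφ hc hs
    obtain ⟨a, b, ha, hab, hsub⟩ := exists_Icc_of_tsupport hc hs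
    have hb0 : ∀ x, x ∉ Ioo a b → φ x = 0 := fun x hx =>
      image_eq_zero_of_notMem_tsupport fun h => hx (hsub h)
    have hb0' : ∀ x, x ∉ Ioo a b → deriv φ x = 0 := fun x hx =>
      image_eq_zero_of_notMem_tsupport fun h => hx (hsub (tsupport_deriv_subset' h))
    have hva : IntervalIntegrable v volume a b :=
      intervalIntegrable_of_memLp hv ha.le (ha.trans hab).le
    have hdc : Continuous (deriv φ) := hφ.continuous_deriv (by simp)
    have hd' : IntervalIntegrable (fun x => ((deriv φ x : ℝ) : ℂ)) volume a b :=
      (Complex.continuous_ofReal.comp hdc).intervalIntegrable _ _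
    have hV : ∀ x ∈ Icc a b, ∫ t in (0 : ℝ)..x, v t =
        (∫ t in (0 : ℝ)..a, v t) + ∫ t in a..x, v t := fun x hx =>
      (intervalIntegral.integral_add_adjacent_intervals
        (intervalIntegrable_of_memLp hv le_rfl ha.le)
        (intervalIntegrable_of_memLp hv ha.le (ha.le.trans hx.1))).symm
    rw [integral_eq_intervalIntegral hab.le (fun x hx => by simp [hb0' x hx]),
      integral_eq_intervalIntegral hab.le (fun x hx => by simp [hb0 x hx])]
    have h := (integral_deriv_mul_of_primitive (p := fun x => (φ x : ℂ))
      (p' := fun x => ((deriv φ x : ℝ) : ℂ)) (q := fun x => ∫ t in (0 : ℝ)..x, v t) (q' := v) hab.le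
      hd' hva ?_ hV).2
    · rw [intervalIntegral.integral_add] at h
      · simp only [Complex.real_smul]
        rw [eq_neg_iff_add_eq_zero, h, hb0 a (by simp), hb0 b (by simp)]
        simp
      · refine hd'.mul_continuousOn (hcont.mono ?_)
        rw [uIcc_of_le hab.le]
        exact fun x hx => ha.trans_le hx.1
      · exact hva.continuousOn_mul (Complex.continuous_ofReal.comp hφ.continuous).continuousOn
    · intro x hx
      have h1 : ∫ t in a..x, deriv φ t = φ x - φ a :=
        intervalIntegral.integral_deriv_eq_sub (fun t _ => hφ.differentiable (by simp) t)
          (hdc.intervalIntegrable _ _)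
      rw [intervalIntegral.integral_ofReal, h1]
      push_cast
      ring

/-- The du Bois-Reymond lemma. A test function minus a multiple of a fixed bump has mean zero, hence
is the derivative of a test function, so u pairs with every test function like the constant given by
its pairing with the bump. -/
theorem HasWeakDeriv.ae_eq_const {u : ℝ → ℂ} (h : HasWeakDeriv (Ioi 0) u 0) :
    ∃ c, ∀ᵐ x, x ∈ Ioi (0 : ℝ) → u x = c := by
  let bump : ContDiffBump (2 : ℝ) := ⟨1 / 2, 1, by norm_num, by norm_num⟩
  set ψ : ℝ → ℝ := bump.normed volume with hψ
  have hψ1 : ∫ x, ψ x = 1 := bump.integral_normed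
  have hψc : HasCompactSupport ψ := bump.hasCompactSupport_normed
  have hψd : ContDiff ℝ ∞ ψ := bump.contDiff_normed
  have hψs : tsupport ψ ⊆ Ioi 0 := by
    rw [hψ, bump.tsupport_normed_eq, Real.closedBall_eq_Icc]
    intro x hx
    have : (2 : ℝ) - 1 ≤ x := hx.1
    simp only [mem_Ioi]
    linarith
  set c : ℂ := ∫ x, ψ x • u x with hcdef
  refine ⟨c, ?_⟩
  have hloc : LocallyIntegrableOn (fun x => u x - c) (Ioi 0) volume :=
    h.1.sub (locallyIntegrableOn_const c)
  have key := isOpen_Ioi.ae_eq_zero_of_integral_contDiff_smul_eq_zero hloc ?_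
  · filter_upwards [key] with x hx hx0
    exact sub_eq_zero.1 (hx hx0)
  intro φ hφ hc hs
  set I : ℝ := ∫ x, φ x with hI
  have hφi : Integrable φ := hφ.continuous.integrable_of_hasCompactSupport hc
  have hψi : Integrable ψ := hψd.continuous.integrable_of_hasCompactSupport hψc
  set χ : ℝ → ℝ := fun x => φ x - I * ψ x with hχ
  have hχd : ContDiff ℝ ∞ χ := hφ.sub (contDiff_const.mul hψd)
  obtain ⟨a, b, ha, hab, hsub⟩ := exists_Icc_of_tsupport hc hs
  obtain ⟨a', b', ha', hab', hsub'⟩ := exists_Icc_of_tsupport hψc hψs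
  have hχ0 : ∀ x, x ∉ Ioo (min a a') (max b b') → χ x = 0 := by
    intro x hx
    have h1 : φ x = 0 := image_eq_zero_of_notMem_tsupport fun h' => hx
      ⟨(min_le_left _ _).trans_lt (hsub h').1, (hsub h').2.trans_le (le_max_left _ _)⟩
    have h2 : ψ x = 0 := image_eq_zero_of_notMem_tsupport fun h' => hx
      ⟨(min_le_right _ _).trans_lt (hsub' h').1, (hsub' h').2.trans_le (le_max_right _ _)⟩
    simp [hχ, h1, h2]
  set A := min a a' with hA
  set B := max b b' with hB
  have hA0 : 0 < A := lt_min ha ha'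
  have hAB : A < B := (min_le_left _ _).trans_lt (hab.trans_le (le_max_left _ _))
  have hχI : ∫ x in A..B, χ x = 0 := by
    rw [← integral_eq_intervalIntegral hAB.le hχ0, hχ, integral_sub hφi (hψi.const_mul _),
      integral_const_mul, hψ1]
    ring
  set X : ℝ → ℝ := fun x => ∫ t in A..x, χ t with hX
  have hXd : ∀ x, HasDerivAt X (χ x) x := fun x =>
    intervalIntegral.integral_hasDerivAt_right (hχd.continuous.intervalIntegrable _ _)
      (hχd.continuous.stronglyMeasurableAtFilter _ _) hχd.continuous.continuousAt
  have hXderiv : deriv X = χ := funext fun x => (hXd x).deriv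
  have hXc : ContDiff ℝ ∞ X := by
    rw [contDiff_infty_iff_deriv, hXderiv]
    exact ⟨fun x => (hXd x).differentiableAt, hχd⟩
  have hX0 : Function.support X ⊆ Icc A B := by
    intro x hx
    by_contra hn
    apply hx
    rcases lt_or_ge x A with hlt | hge
    · rw [hX]
      refine (intervalIntegral.integral_congr (g := fun _ => 0) fun t ht => ?_).trans (by simp)
      rw [uIcc_of_ge hlt.le] at ht
      exact hχ0 t fun h' => absurd h'.1 (not_lt.2 ht.2)
    · have hBx : B < x := by
        by_contra hB'
        exact hn ⟨hge, not_lt.1 hB'⟩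
      rw [hX]
      dsimp only
      rw [← intervalIntegral.integral_add_adjacent_intervals
        (hχd.continuous.intervalIntegrable A B) (hχd.continuous.intervalIntegrable B x), hχI,
        zero_add]
      refine (intervalIntegral.integral_congr (g := fun _ => 0) fun t ht => ?_).trans (by simp)
      rw [uIcc_of_le hBx.le] at ht
      exact hχ0 t fun h' => absurd h'.2 (not_lt.2 ht.1)
  have hXs : tsupport X ⊆ Icc A B := closure_minimal hX0 isClosed_Icc
  have hXcs : HasCompactSupport X := isCompact_Icc.of_isClosed_subset (isClosed_tsupport X) hXs
  have hz := h.2.2 X hXc hXcs (hXs.trans fun x hx => hA0.trans_le hx.1)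
  rw [hXderiv] at hz
  simp only [Pi.zero_apply, smul_zero, integral_zero, neg_zero] at hz
  have i1 := integrable_smul h.1 hφ.continuous hc hs
  have i2 := integrable_smul h.1 hψd.continuous hψc hψs
  have e1 : ∀ x, χ x • u x = φ x • u x - I • (ψ x • u x) := fun x => by
    simp only [hχ, sub_smul, mul_smul]
  simp only [e1] at hz
  have i3 : Integrable (fun x => I • (ψ x • u x)) := i2.smul I
  rw [integral_sub i1 i3, integral_smul, ← hcdef] at hz
  simp only [smul_sub]
  rw [integral_sub i1 (hφi.smul_const c), integral_smul_const, ← hI]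
  exact hz

theorem HasWeakDeriv.exists_primitive {u v : ℝ → ℂ} (h : HasWeakDeriv (Ioi 0) u v)
    (hv : MemLp v 2 (volume.restrict (Ioi 0))) :
    ∃ c, ∀ᵐ x, x ∈ Ioi (0 : ℝ) → u x = c + ∫ t in (0 : ℝ)..x, v t := by
  have h1 := h.add ((hasWeakDeriv_primitive hv).const_smul (-1))
  have h2 : v + (-1 : ℂ) • v = 0 := by simp
  rw [h2] at h1
  obtain ⟨c, hc⟩ := h1.ae_eq_const
  refine ⟨c, hc.mono fun x hx hx0 => ?_⟩
  have := hx hx0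
  simp only [Pi.add_apply, Pi.smul_apply, smul_eq_mul] at this
  linear_combination this

theorem continuousOn_primitive {v : ℝ → ℂ} (hv : MemLp v 2 (volume.restrict (Ioi 0))) :
    ContinuousOn (fun x => ∫ t in (0 : ℝ)..x, v t) (Ici 0) := by
  intro x hx
  have hx0 : (0 : ℝ) ≤ x := hx
  have h1 := (absolutelyContinuousOnInterval_integral (intervalIntegrable_of_memLp hv le_rfl
    (show (0 : ℝ) ≤ x + 1 by linarith))).continuousOn
  rw [uIcc_of_le (by linarith)] at h1
  refine (h1 x ⟨hx0, by linarith⟩).mono_of_mem_nhdsWithin ?_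
  rw [← Ici_inter_Iic]
  exact inter_mem_nhdsWithin _ (Iic_mem_nhds (by linarith))

/-- A continuous function of class `H²` on the right half-line is twice a primitive. -/
theorem IsH2With.exists_halfLinePrimitive {u w : ℝ → ℂ} (hu : ContinuousOn u (Ici 0))
    (h : IsH2With (Ioi 0) u w) :
    ∃ v, HalfLinePrimitive u v ∧ HalfLinePrimitive v w ∧ HasDerivWithinAt u (v 0) (Ici 0) 0 := by
  obtain ⟨h1, h2, v, h3, h4, h5⟩ := h
  obtain ⟨c, hc⟩ := h5.exists_primitive h2
  obtain ⟨c', hc'⟩ := h4.exists_primitive h3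
  set V : ℝ → ℂ := fun x => c + ∫ t in (0 : ℝ)..x, w t with hV
  have hVv : V =ᵐ[volume.restrict (Ioi 0)] v := by
    rw [EventuallyEq, ae_restrict_iff' measurableSet_Ioi]
    exact hc.mono fun x hx hx0 => (hx hx0).symm
  have hVL : MemLp V 2 (volume.restrict (Ioi 0)) := (memLp_congr_ae hVv).2 h3
  have hVc : ContinuousOn V (Ici 0) := continuousOn_const.add (continuousOn_primitive h2)
  have hint : ∀ x, 0 ≤ x → ∫ t in (0 : ℝ)..x, v t = ∫ t in (0 : ℝ)..x, V t := by
    intro x hx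
    refine intervalIntegral.integral_congr_ae ?_
    filter_upwards [hc] with t ht ht'
    rw [uIoc_of_le hx] at ht'
    exact ht ht'.1
  have huV : EqOn u (fun x => c' + ∫ t in (0 : ℝ)..x, V t) (Ici 0) := by
    have hae : u =ᵐ[volume.restrict (Ioi 0)] (fun x => c' + ∫ t in (0 : ℝ)..x, V t) := by
      rw [EventuallyEq, ae_restrict_iff' measurableSet_Ioi]
      exact hc'.mono fun x hx hx0 => by rw [hx hx0, hint x (le_of_lt hx0)]
    have hcc : ContinuousOn (fun x => c' + ∫ t in (0 : ℝ)..x, V t) (Ici 0) :=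
      continuousOn_const.add (continuousOn_primitive hVL)
    have h6 := Measure.eqOn_open_of_ae_eq hae isOpen_Ioi (hu.mono Ioi_subset_Ici_self)
      (hcc.mono Ioi_subset_Ici_self)
    exact h6.of_subset_closure hu hcc Ioi_subset_Ici_self (by rw [closure_Ioi])
  have hu0 : u 0 = c' := by
    have := huV (show (0 : ℝ) ∈ Ici 0 by simp)
    simpa using this
  refine ⟨V, ⟨h1, hVL, fun x hx => by rw [hu0]; exact huV hx⟩,
    ⟨hVL, h2, fun x _ => by simp [hV]⟩, ?_⟩
  have hder : HasDerivWithinAt (fun x => ∫ t in (0 : ℝ)..x, V t) (V 0) (Ici 0) 0 := by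
    refine intervalIntegral.integral_hasDerivWithinAt_right (t := Ioi 0)
      (intervalIntegrable_of_memLp hVL le_rfl le_rfl) ?_
      ((hVc 0 (by simp)).mono Ioi_subset_Ici_self)
    exact (hVc.mono Ioi_subset_Ici_self).stronglyMeasurableAtFilter_nhdsWithin
      measurableSet_Ioi 0
  exact (hder.const_add c').congr huV (huV (by simp))

/-! ### Energy identities on the half-line -/

/-- The squared norm in `L²(0, ∞)`. -/
noncomputable def halfNormSq (f : ℝ → ℂ) : ℝ := ∫ x in Ioi (0 : ℝ), ‖f x‖ ^ 2

theorem halfNormSq_nonneg (f : ℝ → ℂ) : 0 ≤ halfNormSq f :=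
  integral_nonneg fun _ => by positivity

theorem integrableOn_norm_sq {f : ℝ → ℂ} {s : Set ℝ} (hf : MemLp f 2 (volume.restrict s)) :
    IntegrableOn (fun x => ‖f x‖ ^ 2) s :=
  hf.integrable_norm_pow (by norm_num)

theorem HalfLinePrimitive.sub {p p' q q' : ℝ → ℂ} (hp : HalfLinePrimitive p p')
    (hq : HalfLinePrimitive q q') :
    HalfLinePrimitive (fun x => p x - q x) (fun x => p' x - q' x) := by
  refine ⟨hp.memLp.sub hq.memLp, hp.memLp'.sub hq.memLp', fun x hx => ?_⟩
  rw [intervalIntegral.integral_sub (intervalIntegrable_of_memLp hp.memLp' le_rfl hx)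
    (intervalIntegrable_of_memLp hq.memLp' le_rfl hx), hp.eq x hx, hq.eq x hx]
  ring

theorem HalfLinePrimitive.continuousOn {p p' : ℝ → ℂ} (hp : HalfLinePrimitive p p') :
    ContinuousOn p (Ici 0) :=
  (continuousOn_const.add (continuousOn_primitive hp.memLp')).congr fun x hx => hp.eq x hx

theorem HalfLinePrimitive.eq_zero_of_ae {p p' : ℝ → ℂ} (hp : HalfLinePrimitive p p')
    (h : p =ᵐ[volume.restrict (Ioi 0)] 0) : p 0 = 0 := by
  have h6 := Measure.eqOn_open_of_ae_eq h isOpen_Ioi (hp.continuousOn.mono Ioi_subset_Ici_self)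
    continuousOn_const
  exact h6.of_subset_closure hp.continuousOn continuousOn_const Ioi_subset_Ici_self
    (by rw [closure_Ioi]) (by simp)

theorem integral_exp_neg_two_mul {κ : ℝ} (hκ : 0 < κ) :
    IntegrableOn (fun x => Real.exp (-(2 * κ) * x)) (Ioi 0) ∧
    ∫ x in Ioi (0 : ℝ), Real.exp (-(2 * κ) * x) = 1 / (2 * κ) := by
  refine ⟨exp_neg_integrableOn_Ioi 0 (by positivity), ?_⟩
  rw [integral_exp_mul_Ioi (by linarith)]
  simp

theorem norm_sq_const_mul_exp (c : ℂ) (κ x : ℝ) :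
    ‖c * (Real.exp (-κ * x) : ℂ)‖ ^ 2 = ‖c‖ ^ 2 * Real.exp (-(2 * κ) * x) := by
  rw [norm_mul, mul_pow, Complex.norm_real, Real.norm_eq_abs, Real.abs_exp, ← Real.exp_nat_mul]
  congr 2
  push_cast
  ring

theorem halfNormSq_const_mul_exp {κ : ℝ} (hκ : 0 < κ) (c : ℂ) :
    halfNormSq (fun x => c * (Real.exp (-κ * x) : ℂ)) = ‖c‖ ^ 2 / (2 * κ) := by
  simp only [halfNormSq, norm_sq_const_mul_exp]
  rw [integral_const_mul, (integral_exp_neg_two_mul hκ).2]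
  ring

theorem memLp_const_mul_exp {κ : ℝ} (hκ : 0 < κ) (c : ℂ) :
    MemLp (fun x : ℝ => c * (Real.exp (-κ * x) : ℂ)) 2 (volume.restrict (Ioi 0)) := by
  rw [memLp_two_iff_integrable_sq_norm (by fun_prop)]
  simp only [norm_sq_const_mul_exp]
  exact (integral_exp_neg_two_mul hκ).1.const_mul _

theorem halfLinePrimitive_exp {κ : ℝ} (hκ : 0 < κ) (c : ℂ) :
    HalfLinePrimitive (fun x : ℝ => c * (Real.exp (-κ * x) : ℂ))
      (fun x : ℝ => (-κ * c) * (Real.exp (-κ * x) : ℂ)) := by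
  refine ⟨memLp_const_mul_exp hκ _, memLp_const_mul_exp hκ _, fun x _ => ?_⟩
  have hd : ∀ t : ℝ, HasDerivAt (fun x : ℝ => c * (Real.exp (-κ * x) : ℂ))
      ((-κ * c) * (Real.exp (-κ * t) : ℂ)) t := fun t => by
    have h1 : HasDerivAt (fun x : ℝ => Real.exp (-κ * x)) (Real.exp (-κ * t) * (-κ * 1)) t :=
      ((hasDerivAt_id t).const_mul (-κ)).exp
    have h2 := (h1.ofReal_comp).const_mul c
    refine h2.congr_deriv ?_
    rw [mul_one, Complex.ofReal_mul, Complex.ofReal_neg]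
    ring
  rw [intervalIntegral.integral_eq_sub_of_hasDerivAt (fun t _ => hd t)
    (Continuous.intervalIntegrable (by fun_prop) _ _)]
  ring

section Energy

variable {u v w : ℝ → ℂ}

theorem HalfLinePrimitive.green (hu : HalfLinePrimitive u v) (hv : HalfLinePrimitive v w) (ν : ℝ) :
    ∫ x in Ioi (0 : ℝ), (starRingEnd ℂ) (-w x + ν * u x) * u x =
      ((halfNormSq v + ν * halfNormSq u : ℝ) : ℂ) + (starRingEnd ℂ) (v 0) * u 0 := by
  have h := hv.integral_Ioi hu le_rfl
  have i1 := integrableOn_conj_mul hv.memLp' hu.memLp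
  have i2 := integrableOn_conj_mul hv.memLp hv.memLp
  have i3 := integrableOn_conj_mul hu.memLp hu.memLp
  have e : ∀ f : ℝ → ℂ, ∫ x in Ioi (0 : ℝ), (starRingEnd ℂ) (f x) * f x = (halfNormSq f : ℂ) := by
    intro f
    rw [halfNormSq, ← integral_complex_ofReal]
    simp only [Complex.conj_mul', Complex.ofReal_pow]
  rw [integral_add i1 i2, e] at h
  have : ∀ x, (starRingEnd ℂ) (-w x + ν * u x) * u x =
      -((starRingEnd ℂ) (w x) * u x) + ν * ((starRingEnd ℂ) (u x) * u x) := by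
    intro x
    simp only [map_add, map_neg, map_mul, Complex.conj_ofReal]
    ring
  simp only [this]
  have i4 : IntegrableOn (fun x => -((starRingEnd ℂ) (w x) * u x)) (Ioi 0) := i1.neg
  rw [integral_add i4 (i3.const_mul _), integral_neg, integral_const_mul, e]
  push_cast
  linear_combination -h

theorem HalfLinePrimitive.two_re_integral (hu : HalfLinePrimitive u v) {a : ℝ} (ha : 0 ≤ a) :
    ∫ x in Ioi a, 2 * ((starRingEnd ℂ) (v x) * u x).re = -‖u a‖ ^ 2 := by
  have h := hu.integral_Ioi hu ha
  have hI : IntegrableOn (fun x => (starRingEnd ℂ) (v x) * u x + (starRingEnd ℂ) (u x) * v x)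
    (Ioi a) := (((integrableOn_conj_mul hu.memLp' hu.memLp).add
    (integrableOn_conj_mul hu.memLp hu.memLp')).mono_set (Ioi_subset_Ioi ha))
  have h2 := congrArg Complex.re h
  have h3 := integral_re hI
  simp only [RCLike.re_eq_complex_re] at h3
  rw [← h3] at h2
  have e : ∀ x, 2 * ((starRingEnd ℂ) (v x) * u x).re = ((starRingEnd ℂ) (v x) * u x +
      (starRingEnd ℂ) (u x) * v x).re := by
    intro x
    simp only [Complex.add_re, Complex.mul_re, Complex.conj_re, Complex.conj_im]
    ring
  simp only [e]
  refine Eq.trans ?_ (h2.trans ?_)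
  · rfl
  · rw [Complex.neg_re, Complex.conj_mul', ← Complex.ofReal_pow, Complex.ofReal_re]

/-- Expand ∫ |u' + κu|² ≥ 0; the cross term integrates to -κ|u(0)|². Equality holds for e^{-κx},
which is why nothing is lost when the energy is replaced by the trace. -/
theorem HalfLinePrimitive.trace_le_energy (hu : HalfLinePrimitive u v) (κ : ℝ) :
    κ * ‖u 0‖ ^ 2 ≤ halfNormSq v + κ ^ 2 * halfNormSq u := by
  have h := hu.two_re_integral le_rfl
  have i1 := integrableOn_norm_sq hu.memLp'
  have i2 := integrableOn_norm_sq hu.memLp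
  have i3 : IntegrableOn (fun x => 2 * ((starRingEnd ℂ) (v x) * u x).re) (Ioi 0) :=
    ((integrableOn_conj_mul hu.memLp' hu.memLp).re).const_mul 2
  have e : ∀ x, ‖v x + κ * u x‖ ^ 2 = ‖v x‖ ^ 2 + κ ^ 2 * ‖u x‖ ^ 2 +
      κ * (2 * ((starRingEnd ℂ) (v x) * u x).re) := by
    intro x
    simp only [← Complex.normSq_eq_norm_sq, Complex.normSq_apply, Complex.add_re, Complex.add_im,
      Complex.mul_re, Complex.mul_im, Complex.conj_re, Complex.conj_im, Complex.ofReal_re,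
      Complex.ofReal_im]
    ring
  have h0 : 0 ≤ ∫ x in Ioi (0 : ℝ), ‖v x + κ * u x‖ ^ 2 := integral_nonneg fun _ => by positivity
  simp only [e] at h0
  have i4 : IntegrableOn (fun x => ‖v x‖ ^ 2 + κ ^ 2 * ‖u x‖ ^ 2) (Ioi 0) := i1.add (i2.const_mul _)
  rw [integral_add i4 (i3.const_mul _), integral_add i1 (i2.const_mul _),
    integral_const_mul, integral_const_mul, h] at h0
  simp only [halfNormSq]
  linarith

theorem HalfLinePrimitive.dirichlet_bound (hu : HalfLinePrimitive u v) (hv : HalfLinePrimitive v w)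
    (h0 : u 0 = 0) {κ : ℝ} (hκ : 0 < κ) :
    halfNormSq v + κ ^ 2 * halfNormSq u / 2 ≤
      halfNormSq (fun x => -w x + (κ ^ 2 : ℝ) * u x) / (2 * κ ^ 2) := by
  have h := hu.green hv (κ ^ 2)
  rw [h0, mul_zero, add_zero] at h
  have hf : MemLp (fun x => -w x + (κ ^ 2 : ℝ) * u x) 2 (volume.restrict (Ioi 0)) :=
    hv.memLp'.neg.add (hu.memLp.const_mul _)
  have hle : ‖∫ x in Ioi (0 : ℝ), (starRingEnd ℂ) (-w x + (κ ^ 2 : ℝ) * u x) * u x‖ ≤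
      ∫ x in Ioi (0 : ℝ), (‖-w x + (κ ^ 2 : ℝ) * u x‖ ^ 2 / (2 * κ ^ 2) +
        κ ^ 2 * ‖u x‖ ^ 2 / 2) := by
    refine norm_integral_le_of_norm_le (((integrableOn_norm_sq hf).div_const _).add
      (((integrableOn_norm_sq hu.memLp).const_mul _).div_const _)) (Eventually.of_forall fun x => ?_)
    rw [norm_mul, RCLike.norm_conj]
    set A := ‖-w x + (κ ^ 2 : ℝ) * u x‖
    set B := ‖u x‖
    have : A ^ 2 / (2 * κ ^ 2) + κ ^ 2 * B ^ 2 / 2 - A * B = (A / κ - κ * B) ^ 2 / 2 := by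
      field_simp
      ring
    have h2 : 0 ≤ (A / κ - κ * B) ^ 2 / 2 := by positivity
    linarith
  rw [h, Complex.norm_real, Real.norm_eq_abs, integral_add ((integrableOn_norm_sq hf).div_const _)
      (((integrableOn_norm_sq hu.memLp).const_mul _).div_const _), integral_div, integral_div,
      integral_const_mul] at hle
  have h3 := (le_abs_self _).trans hle
  simp only [halfNormSq] at h3 ⊢
  linarith

/-- Subtracting u(0)e^{-κx}, which -d²/dx² + κ² annihilates, leaves the right-hand side unchanged
and produces a function vanishing at 0, to which the Dirichlet bound applies. -/
theorem HalfLinePrimitive.sub_exp (hu : HalfLinePrimitive u v) (hv : HalfLinePrimitive v w)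
    {κ : ℝ} (hκ : 0 < κ) :
    HalfLinePrimitive (fun x => u x - u 0 * (Real.exp (-κ * x) : ℂ))
      (fun x => v x - (-κ * u 0) * (Real.exp (-κ * x) : ℂ)) ∧
    HalfLinePrimitive (fun x => v x - (-κ * u 0) * (Real.exp (-κ * x) : ℂ))
      (fun x => w x - (-κ * (-κ * u 0)) * (Real.exp (-κ * x) : ℂ)) ∧
    halfNormSq (fun x => v x - (-κ * u 0) * (Real.exp (-κ * x) : ℂ)) +
      κ ^ 2 * halfNormSq (fun x => u x - u 0 * (Real.exp (-κ * x) : ℂ)) / 2 ≤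
      halfNormSq (fun x => -w x + (κ ^ 2 : ℝ) * u x) / (2 * κ ^ 2) := by
  have h1 := hu.sub (halfLinePrimitive_exp hκ (u 0))
  have h2 := hv.sub (halfLinePrimitive_exp hκ (-κ * u 0))
  refine ⟨h1, h2, ?_⟩
  have h3 := h1.dirichlet_bound h2 (by simp) hκ
  refine h3.trans_eq ?_
  congr 2
  funext x
  push_cast
  ring

/-- |u(0)|² is 2κ times the squared norm of u(0)e^{-κx}, and that exponential differs from u by a
function controlled by the right-hand side. The factor κ ~ √n is what produces the weight
(n+1)^{-1/2} in the summability of traces. -/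
theorem HalfLinePrimitive.trace_bound (hu : HalfLinePrimitive u v) (hv : HalfLinePrimitive v w)
    {κ : ℝ} (hκ : 0 < κ) (hκ2 : 1 / 2 ≤ κ ^ 2) :
    ‖u 0‖ ^ 2 ≤ 16 * κ * (halfNormSq u + halfNormSq (fun x => -w x + (κ ^ 2 : ℝ) * u x)) := by
  obtain ⟨h1, h2, h3⟩ := hu.sub_exp hv hκ
  set F := halfNormSq (fun x => -w x + (κ ^ 2 : ℝ) * u x)
  have hF : 0 ≤ F := halfNormSq_nonneg _
  have h4 := halfNormSq_const_mul_exp hκ (u 0)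
  have h5 : halfNormSq (fun x => u 0 * (Real.exp (-κ * x) : ℂ)) ≤
      2 * halfNormSq u + 2 * halfNormSq (fun x => u x - u 0 * (Real.exp (-κ * x) : ℂ)) := by
    simp only [halfNormSq]
    rw [← integral_const_mul, ← integral_const_mul,
      ← integral_add ((integrableOn_norm_sq hu.memLp).const_mul _)
        ((integrableOn_norm_sq h1.memLp).const_mul _)]
    refine integral_mono (integrableOn_norm_sq (memLp_const_mul_exp hκ _))
      (((integrableOn_norm_sq hu.memLp).const_mul _).add
        ((integrableOn_norm_sq h1.memLp).const_mul _)) fun x => ?_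
    have h6 := norm_sub_le (u x) (u x - u 0 * (Real.exp (-κ * x) : ℂ))
    rw [sub_sub_cancel] at h6
    have h7 := mul_self_le_mul_self (norm_nonneg _) h6
    nlinarith [sq_nonneg (‖u x‖ - ‖u x - u 0 * (Real.exp (-κ * x) : ℂ)‖)]
  have h6 := halfNormSq_nonneg (fun x => v x - (-κ * u 0) * (Real.exp (-κ * x) : ℂ))
  set N1 := halfNormSq (fun x => u x - u 0 * (Real.exp (-κ * x) : ℂ))
  have hN1 : N1 ≤ 4 * F := by
    have h7 : κ ^ 2 * N1 / 2 ≤ F / (2 * κ ^ 2) := by linarith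
    rw [le_div_iff₀ (by positivity)] at h7
    have h8 : 0 ≤ N1 := halfNormSq_nonneg _
    have h9 : (1 / 2) * (1 / 2) ≤ κ ^ 2 * κ ^ 2 := mul_le_mul hκ2 hκ2 (by norm_num) (by positivity)
    nlinarith
  rw [h4, div_le_iff₀ (by positivity)] at h5
  have hu0 := halfNormSq_nonneg u
  nlinarith [mul_nonneg hκ.le hu0, mul_nonneg hκ.le hF, mul_le_mul_of_nonneg_left hN1 hκ.le]

theorem ae_eq_zero_of_halfNormSq {f : ℝ → ℂ} (hf : MemLp f 2 (volume.restrict (Ioi 0)))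
    (h : halfNormSq f = 0) : f =ᵐ[volume.restrict (Ioi 0)] 0 := by
  have := (integral_eq_zero_iff_of_nonneg (fun _ => by positivity) (integrableOn_norm_sq hf)).1 h
  filter_upwards [this] with x hx
  simpa using hx

/-- With zero right-hand side the bound of `HalfLinePrimitive.sub_exp` forces u = u(0)e^{-√λ x},
which also yields the derivative at 0. -/
theorem HalfLinePrimitive.deriv_eq_of_ode (hu : HalfLinePrimitive u v)
    (hv : HalfLinePrimitive v w) {lam : ℝ} (hl : 0 < lam)
    (hw : w =ᵐ[volume.restrict (Ioi 0)] fun x => lam * u x) :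
    v 0 = -(√lam : ℂ) * u 0 ∧ (u 0 = 0 → u =ᵐ[volume.restrict (Ioi 0)] 0) := by
  have hκ : 0 < √lam := Real.sqrt_pos.2 hl
  obtain ⟨h1, h2, h3⟩ := hu.sub_exp hv hκ
  have hF : halfNormSq (fun x => -w x + ((√lam ^ 2 : ℝ) : ℂ) * u x) = 0 := by
    rw [halfNormSq]
    refine (integral_congr_ae ?_).trans (integral_zero _ _)
    filter_upwards [hw] with x hx
    rw [hx, Real.sq_sqrt hl.le]
    simp
  rw [hF, zero_div] at h3
  have n1 := halfNormSq_nonneg (fun x => v x - (-(√lam : ℂ) * u 0) * (Real.exp (-√lam * x) : ℂ))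
  have n2 := halfNormSq_nonneg (fun x => u x - u 0 * (Real.exp (-√lam * x) : ℂ))
  rw [Real.sq_sqrt hl.le] at h3
  have n3 := mul_nonneg hl.le n2
  constructor
  · have := h2.eq_zero_of_ae (ae_eq_zero_of_halfNormSq h2.memLp (by linarith))
    simp only [mul_zero, Real.exp_zero, Complex.ofReal_one, mul_one] at this
    exact sub_eq_zero.1 this
  · intro h0
    have h4 : lam * halfNormSq (fun x => u x - u 0 * (Real.exp (-√lam * x) : ℂ)) = 0 := by linarith
    have := ae_eq_zero_of_halfNormSq h1.memLp ((mul_eq_zero.1 h4).resolve_left hl.ne')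
    simpa [h0] using this

/-- The conserved quantity |u'|² - λ|u|² vanishes because u and u' are in L². For λ ≤ 0 this forces
u' = 0, and a constant in L²(0, ∞) is 0. The threshold λ = 0 is included. -/
theorem HalfLinePrimitive.eq_zero_of_ode (hu : HalfLinePrimitive u v)
    (hv : HalfLinePrimitive v w) {lam : ℝ} (hl : lam ≤ 0)
    (hw : w =ᵐ[volume.restrict (Ioi 0)] fun x => lam * u x) :
    u =ᵐ[volume.restrict (Ioi 0)] 0 := by
  have key : ∀ a, 0 ≤ a → ‖v a‖ ^ 2 = lam * ‖u a‖ ^ 2 := by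
    intro a ha
    have h1 := hu.two_re_integral ha
    have h2 := hv.two_re_integral ha
    have h3 : ∫ x in Ioi a, 2 * ((starRingEnd ℂ) (w x) * v x).re =
        lam * ∫ x in Ioi a, 2 * ((starRingEnd ℂ) (v x) * u x).re := by
      rw [← integral_const_mul]
      refine integral_congr_ae (ae_mono (Measure.restrict_mono (Ioi_subset_Ioi ha) le_rfl) ?_)
      filter_upwards [hw] with x hx
      rw [hx]
      simp only [map_mul, Complex.conj_ofReal, Complex.mul_re, Complex.mul_im, Complex.conj_re,
        Complex.conj_im, Complex.ofReal_re, Complex.ofReal_im]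
      ring
    rw [h2, h1] at h3
    linarith
  have hv0 : ∀ a, 0 ≤ a → v a = 0 := by
    intro a ha
    have := key a ha
    have h2 : ‖v a‖ ^ 2 ≤ 0 := by
      rw [this]
      exact mul_nonpos_of_nonpos_of_nonneg hl (by positivity)
    have h3 : ‖v a‖ = 0 := by nlinarith [norm_nonneg (v a)]
    exact norm_eq_zero.1 h3
  have hc : ∀ a, 0 ≤ a → u a = u 0 := by
    intro a ha
    rw [hu.eq a ha, intervalIntegral.integral_congr (g := fun _ => 0), intervalIntegral.integral_zero,
      add_zero]
    intro t ht
    rw [uIcc_of_le ha] at ht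
    exact hv0 t ht.1
  have h0 : u 0 = 0 := by
    by_contra hne
    have h2 := integrableOn_norm_sq hu.memLp
    have h3 : IntegrableOn (fun _ : ℝ => ‖u 0‖ ^ 2) (Ioi 0) :=
      h2.congr_fun (fun x hx => by simp only [hc x (le_of_lt hx)]) measurableSet_Ioi
    rw [integrableOn_const_iff] at h3
    rcases h3 with h | h
    · rw [enorm_eq_zero] at h
      exact hne (norm_eq_zero.1 (pow_eq_zero_iff (two_ne_zero) |>.1 h))
    · simp at h
  rw [EventuallyEq, ae_restrict_iff' measurableSet_Ioi]
  exact Eventually.of_forall fun x hx => by rw [hc x (le_of_lt hx), h0]; rfl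

end Energy

/-! ### Functions on the line with a kink at the origin -/

theorem measurePreserving_neg_restrict {s t : Set ℝ} (hs : MeasurableSet s)
    (hst : ∀ x, x ∈ t ↔ -x ∈ s) : MeasurePreserving (fun x : ℝ => -x)
    (volume.restrict t) (volume.restrict s) := by
  have h := (Measure.measurePreserving_neg (volume : Measure ℝ)).restrict_preimage hs
  have e : (Neg.neg : ℝ → ℝ) ⁻¹' s = t := by
    ext x
    exact (hst x).symm
  rwa [e] at h

theorem measurePreserving_neg_Ioi : MeasurePreserving (fun x : ℝ => -x)
    (volume.restrict (Ioi 0)) (volume.restrict (Iio 0)) :=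
  measurePreserving_neg_restrict measurableSet_Iio (by simp)

theorem HasWeakDeriv.comp_neg {s t : Set ℝ} (hs : MeasurableSet s) (hst : ∀ x, x ∈ t ↔ -x ∈ s)
    {u v : ℝ → ℂ} (hu : MemLp u 2 (volume.restrict s))
    (hv : MemLp v 2 (volume.restrict s)) (h : HasWeakDeriv s u v) :
    HasWeakDeriv t (fun x => u (-x)) (fun x => -v (-x)) := by
  have hm := measurePreserving_neg_restrict hs hst
  refine ⟨locallyIntegrableOn_of_locallyIntegrable_restrict
    ((hu.comp_measurePreserving hm).locallyIntegrable (by norm_num)),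
    locallyIntegrableOn_of_locallyIntegrable_restrict
    ((hv.comp_measurePreserving hm).neg.locallyIntegrable (by norm_num)), fun φ hφ hc ht => ?_⟩
  have h1 := h.2.2 (fun x => φ (-x)) (hφ.comp contDiff_neg)
    (hc.comp_homeomorph (Homeomorph.neg ℝ)) (by
      have : tsupport (fun x => φ (-x)) = (Homeomorph.neg ℝ) ⁻¹' (tsupport φ) :=
        tsupport_comp_eq_preimage φ (Homeomorph.neg ℝ)
      rw [this]
      intro x hx
      have h2 : -x ∈ t := ht hx
      simpa using (hst _).1 h2)
  simp only [deriv_comp_neg] at h1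
  rw [← integral_neg_eq_self, ← integral_neg_eq_self (fun x => φ x • -v (-x))]
  simp only [neg_neg, smul_neg, integral_neg, neg_smul] at h1 ⊢
  linear_combination -h1

theorem IsH2With.comp_neg {s t : Set ℝ} (hs : MeasurableSet s) (hst : ∀ x, x ∈ t ↔ -x ∈ s)
    {u w : ℝ → ℂ} (h : IsH2With s u w) :
    IsH2With t (fun x => u (-x)) (fun x => w (-x)) := by
  obtain ⟨h1, h2, v, h3, h4, h5⟩ := h
  have hm := measurePreserving_neg_restrict hs hst
  refine ⟨h1.comp_measurePreserving hm, h2.comp_measurePreserving hm, fun x => -v (-x),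
    (h3.comp_measurePreserving hm).neg, h4.comp_neg hs hst h1 h3, ?_⟩
  have h6 := (h5.comp_neg hs hst h3 h2).const_smul (-1)
  convert h6 using 1 <;> · funext x; simp

theorem exists_halfLinePrimitives {n : ℕ} {u f : ℝ → ℂ} (hu : Continuous u) (hL : IsLPlus n u f)
    {a b : ℂ} (ha : HasDerivWithinAt u a (Ici 0) 0) (hb : HasDerivWithinAt u b (Iic 0) 0) :
    ∃ v₁ w₁ v₂ w₂ : ℝ → ℂ, HalfLinePrimitive u v₁ ∧ HalfLinePrimitive v₁ w₁ ∧
      HalfLinePrimitive (fun x => u (-x)) v₂ ∧ HalfLinePrimitive v₂ w₂ ∧ v₁ 0 = a ∧ v₂ 0 = -b ∧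
      (f =ᵐ[volume.restrict (Ioi 0)] fun x => -w₁ x + ((n + 1 / 2 : ℝ) : ℂ) * u x) ∧
      ((fun x => f (-x)) =ᵐ[volume.restrict (Ioi 0)]
        fun x => -w₂ x + ((n + 1 / 2 : ℝ) : ℂ) * u (-x)) := by
  obtain ⟨h, h1, h2, h3⟩ := hL
  obtain ⟨v₁, p1, p2, p3⟩ := h2.exists_halfLinePrimitive hu.continuousOn
  obtain ⟨v₂, q1, q2, q3⟩ := (h1.comp_neg (t := Ioi 0) measurableSet_Iio (by simp)).exists_halfLinePrimitive
    (hu.comp continuous_neg).continuousOn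
  have hu0 : UniqueDiffWithinAt ℝ (Ici (0 : ℝ)) 0 := uniqueDiffWithinAt_Ici 0
  have hb' : HasDerivWithinAt (fun x => u (-x)) (-b) (Ici 0) 0 := by
    have h4 : HasDerivWithinAt (fun x : ℝ => -x) (-1) (Ici 0) 0 := (hasDerivWithinAt_id 0 _).neg
    have h5 : HasDerivWithinAt u b (Iic 0) (-0) := by simpa using hb
    have := HasDerivWithinAt.scomp (0 : ℝ) h5 h4 (fun x hx => by simpa using hx)
    simpa [Function.comp_def] using this
  refine ⟨v₁, h, v₂, fun x => h (-x), p1, p2, q1, q2, hu0.eq_deriv _ p3 ha, hu0.eq_deriv _ q3 hb',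
    ?_, ?_⟩
  · filter_upwards [ae_restrict_of_ae h3] with x hx
    rw [hx]
    push_cast
    rfl
  · filter_upwards [measurePreserving_neg_Ioi.quasiMeasurePreserving.ae (ae_restrict_of_ae h3)]
      with x hx
    rw [hx]
    push_cast
    rfl

theorem integral_eq_add_comp_neg {E : Type*} [NormedAddCommGroup E] [NormedSpace ℝ E] {g : ℝ → E}
    (hg : Integrable g) : ∫ x, g x = (∫ x in Ioi (0 : ℝ), g x) + ∫ x in Ioi (0 : ℝ), g (-x) := by
  rw [integral_comp_neg_Ioi, neg_zero, ← intervalIntegral.integral_Iic_add_Ioi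
    (hg.integrableOn) (hg.integrableOn), add_comm]

theorem integral_norm_sq_eq {f : ℝ → ℂ} (hf : MemLp f 2 volume) :
    ∫ x, ‖f x‖ ^ 2 = halfNormSq f + halfNormSq (fun x => f (-x)) :=
  integral_eq_add_comp_neg (hf.integrable_norm_pow (by norm_num))

theorem halfNormSq_congr {f g : ℝ → ℂ} (h : f =ᵐ[volume.restrict (Ioi 0)] g) :
    halfNormSq f = halfNormSq g :=
  integral_congr_ae (h.mono fun x hx => by simp only [hx])

section Line

variable {n : ℕ} {u f : ℝ → ℂ} {a b : ℂ}

/-- Green's formula on both half-lines; q is the energy integral, and the factor 2 in front of κ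
comes from adding the two half-line trace inequalities. The parameter κ stays free so that it can
later be matched to E. -/
theorem IsLPlus.quadratic_form (hu : Continuous u) (hu2 : MemLp u 2 volume)
    (hf : MemLp f 2 volume) (hL : IsLPlus n u f)
    (ha : HasDerivWithinAt u a (Ici 0) 0) (hb : HasDerivWithinAt u b (Iic 0) 0) :
    ∃ q : ℝ, ∫ x, (starRingEnd ℂ) (f x) * u x = (q : ℂ) + (starRingEnd ℂ) (a - b) * u 0 ∧
      ∀ κ : ℝ, (n + 1 / 2 - κ ^ 2) * (∫ x, ‖u x‖ ^ 2) + 2 * κ * ‖u 0‖ ^ 2 ≤ q := by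
  obtain ⟨v₁, w₁, v₂, w₂, p1, p2, q1, q2, e1, e2, h1, h2⟩ := exists_halfLinePrimitives hu hL ha hb
  have hI : Integrable (fun x => (starRingEnd ℂ) (f x) * u x) := hf.star.integrable_mul hu2
  have g1 := p1.green p2 (n + 1 / 2)
  have g2 := q1.green q2 (n + 1 / 2)
  refine ⟨halfNormSq v₁ + (n + 1 / 2) * halfNormSq u + (halfNormSq v₂ + (n + 1 / 2) *
    halfNormSq fun x => u (-x)), ?_, fun κ => ?_⟩
  · rw [integral_eq_add_comp_neg hI]
    have c1 : ∫ x in Ioi (0 : ℝ), (starRingEnd ℂ) (f x) * u x = ∫ x in Ioi (0 : ℝ),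
        (starRingEnd ℂ) (-w₁ x + ((n + 1 / 2 : ℝ) : ℂ) * u x) * u x :=
      integral_congr_ae (h1.mono fun x hx => by simp only [hx])
    have c2 : ∫ x in Ioi (0 : ℝ), (starRingEnd ℂ) (f (-x)) * u (-x) = ∫ x in Ioi (0 : ℝ),
        (starRingEnd ℂ) (-w₂ x + ((n + 1 / 2 : ℝ) : ℂ) * u (-x)) * u (-x) :=
      integral_congr_ae (h2.mono fun x hx => by simp only [hx])
    rw [c1, c2, g1, g2, e1, e2]
    simp only [map_sub, map_neg, neg_zero]
    push_cast
    ring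
  · rw [integral_norm_sq_eq hu2]
    have t1 := p1.trace_le_energy κ
    have t2 := q1.trace_le_energy κ
    simp only [neg_zero] at t2
    linarith

theorem halfNormSq_le {f : ℝ → ℂ} (hf : MemLp f 2 volume) : halfNormSq f ≤ ∫ x, ‖f x‖ ^ 2 := by
  rw [integral_norm_sq_eq hf]
  linarith [halfNormSq_nonneg fun x => f (-x)]

theorem IsLPlus.trace_bound (hu : Continuous u) (hu2 : MemLp u 2 volume)
    (hf : MemLp f 2 volume) (hL : IsLPlus n u f)
    (ha : HasDerivWithinAt u a (Ici 0) 0) (hb : HasDerivWithinAt u b (Iic 0) 0) :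
    ‖u 0‖ ^ 2 ≤ 16 * √(n + 1 / 2) * ((∫ x, ‖u x‖ ^ 2) + ∫ x, ‖f x‖ ^ 2) := by
  obtain ⟨v₁, w₁, v₂, w₂, p1, p2, q1, q2, e1, e2, h1, h2⟩ := exists_halfLinePrimitives hu hL ha hb
  have hn : (0 : ℝ) < n + 1 / 2 := by positivity
  have hs : √((n : ℝ) + 1 / 2) ^ 2 = n + 1 / 2 := Real.sq_sqrt hn.le
  have h := p1.trace_bound p2 (Real.sqrt_pos.2 hn) (by
    rw [hs]
    have : (0 : ℝ) ≤ n := by positivity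
    linarith)
  rw [hs, ← halfNormSq_congr h1] at h
  refine h.trans ?_
  have := halfNormSq_le hu2
  have := halfNormSq_le hf
  gcongr

theorem ae_eq_zero_of_halves (h1 : u =ᵐ[volume.restrict (Ioi 0)] 0)
    (h2 : (fun x => u (-x)) =ᵐ[volume.restrict (Ioi 0)] 0) : u =ᵐ[volume] 0 := by
  have h3 : ∀ᵐ x ∂(volume.restrict (Iio (0 : ℝ))), u x = 0 := by
    have e : volume.restrict (Iio (0 : ℝ)) = (volume.restrict (Ioi (0 : ℝ))).map (fun x => -x) :=
      measurePreserving_neg_Ioi.map_eq.symm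
    rw [e]
    refine (MeasurableEmbedding.ae_map_iff (MeasurableEquiv.neg ℝ).measurableEmbedding).2 ?_
    exact h2
  rw [ae_restrict_iff' measurableSet_Iio] at h3
  rw [EventuallyEq, ae_restrict_iff' measurableSet_Ioi] at h1
  have h0 : ∀ᵐ x : ℝ, x ≠ 0 := by simp [ae_iff]
  filter_upwards [h0, h1, h3] with x e0 e1 e3
  rcases lt_or_gt_of_ne e0 with h | h
  · exact e3 h
  · exact e1 h

theorem IsLPlus.eigen_pos (hu : Continuous u) (hL : IsLPlus n u f)
    (ha : HasDerivWithinAt u a (Ici 0) 0) (hb : HasDerivWithinAt u b (Iic 0) 0) {E : ℝ}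
    (hf : f =ᵐ[volume] fun x => (E : ℂ) * u x) (hE : E < n + 1 / 2) :
    a - b = -2 * (√(n + 1 / 2 - E) : ℂ) * u 0 ∧ (u 0 = 0 → u =ᵐ[volume] 0) := by
  obtain ⟨v₁, w₁, v₂, w₂, p1, p2, q1, q2, e1, e2, h1, h2⟩ := exists_halfLinePrimitives hu hL ha hb
  have hf2 : (fun x => f (-x)) =ᵐ[volume.restrict (Ioi 0)] fun x => (E : ℂ) * u (-x) :=
    measurePreserving_neg_Ioi.quasiMeasurePreserving.ae (ae_restrict_of_ae hf)
  have o1 : w₁ =ᵐ[volume.restrict (Ioi 0)] fun x => ((n + 1 / 2 - E : ℝ) : ℂ) * u x := by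
    filter_upwards [h1, ae_restrict_of_ae hf] with x k1 k2
    rw [k2] at k1
    push_cast at k1 ⊢
    linear_combination k1
  have o2 : w₂ =ᵐ[volume.restrict (Ioi 0)] fun x => ((n + 1 / 2 - E : ℝ) : ℂ) * u (-x) := by
    filter_upwards [h2, hf2] with x k1 k2
    rw [k2] at k1
    push_cast at k1 ⊢
    linear_combination k1
  obtain ⟨r1, r2⟩ := p1.deriv_eq_of_ode p2 (by linarith) o1
  obtain ⟨s1, s2⟩ := q1.deriv_eq_of_ode q2 (by linarith) o2
  simp only [neg_zero] at s1 s2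
  refine ⟨?_, fun h0 => ae_eq_zero_of_halves (r2 h0) (s2 h0)⟩
  rw [← e1, show b = -v₂ 0 by rw [e2]; ring, r1, s1]
  ring

theorem IsLPlus.eigen_nonpos (hu : Continuous u) (hL : IsLPlus n u f)
    (ha : HasDerivWithinAt u a (Ici 0) 0) (hb : HasDerivWithinAt u b (Iic 0) 0) {E : ℝ}
    (hf : f =ᵐ[volume] fun x => (E : ℂ) * u x) (hE : n + 1 / 2 ≤ E) : u =ᵐ[volume] 0 := by
  obtain ⟨v₁, w₁, v₂, w₂, p1, p2, q1, q2, e1, e2, h1, h2⟩ := exists_halfLinePrimitives hu hL ha hb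
  have hf2 : (fun x => f (-x)) =ᵐ[volume.restrict (Ioi 0)] fun x => (E : ℂ) * u (-x) :=
    measurePreserving_neg_Ioi.quasiMeasurePreserving.ae (ae_restrict_of_ae hf)
  refine ae_eq_zero_of_halves (p1.eq_zero_of_ode p2 (lam := n + 1 / 2 - E) (by linarith) ?_)
    (q1.eq_zero_of_ode q2 (lam := n + 1 / 2 - E) (by linarith) ?_)
  · filter_upwards [h1, ae_restrict_of_ae hf] with x k1 k2
    rw [k2] at k1
    push_cast at k1 ⊢
    linear_combination k1
  · filter_upwards [h2, hf2] with x k1 k2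
    rw [k2] at k1
    push_cast at k1 ⊢
    linear_combination k1

end Line

/-! ### Exponential solutions -/

theorem hasWeakDeriv_const (Ω : Set ℝ) (c : ℂ) : HasWeakDeriv Ω (fun _ => c) 0 := by
  refine ⟨locallyIntegrableOn_const c, locallyIntegrableOn_zero, fun φ hφ hc _ => ?_⟩
  have h1 : ∫ x, deriv φ x = 0 := by
    have hd : Continuous (deriv φ) := hφ.continuous_deriv (by simp)
    exact integral_eq_zero_of_hasDerivAt_of_integrable
      (fun x => (hφ.differentiable (by simp) x).hasDerivAt)
      (hd.integrable_of_hasCompactSupport hc.deriv)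
      (hφ.continuous.integrable_of_hasCompactSupport hc)
  rw [integral_smul_const, h1]
  simp

theorem HasWeakDeriv.congr_eqOn {Ω : Set ℝ} {u v u' v' : ℝ → ℂ} (h : HasWeakDeriv Ω u v)
    (hu : EqOn u u' Ω) (hv : EqOn v v' Ω)
    (hu' : LocallyIntegrableOn u' Ω) (hv' : LocallyIntegrableOn v' Ω) : HasWeakDeriv Ω u' v' := by
  refine ⟨hu', hv', fun φ hφ hc hs => ?_⟩
  have e := h.2.2 φ hφ hc hs
  have e1 : ∀ x, deriv φ x • u' x = deriv φ x • u x := by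
    intro x
    by_cases hx : x ∈ Ω
    · rw [hu hx]
    · rw [image_eq_zero_of_notMem_tsupport fun h' => hx (hs (tsupport_deriv_subset' h'))]
      simp
  have e2 : ∀ x, φ x • v' x = φ x • v x := by
    intro x
    by_cases hx : x ∈ Ω
    · rw [hv hx]
    · rw [image_eq_zero_of_notMem_tsupport fun h' => hx (hs h')]
      simp
  simp only [e1, e2, e]

theorem HalfLinePrimitive.hasWeakDeriv {p p' : ℝ → ℂ} (h : HalfLinePrimitive p p') :
    HasWeakDeriv (Ioi 0) p p' := by
  refine ((hasWeakDeriv_const (Ioi 0) (p 0)).add (hasWeakDeriv_primitive h.memLp')).congr_eqOn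
    (fun x hx => (h.eq x (le_of_lt hx)).symm) (fun x _ => by simp)
    (locallyIntegrableOn_of_locallyIntegrable_restrict (h.memLp.locallyIntegrable (by norm_num)))
    (locallyIntegrableOn_of_locallyIntegrable_restrict (h.memLp'.locallyIntegrable (by norm_num)))

/-- The function `c e^{-κ|x|}`. -/
noncomputable def expAbs (κ : ℝ) (c : ℂ) (x : ℝ) : ℂ := c * (Real.exp (-κ * |x|) : ℂ)

theorem continuous_expAbs (κ : ℝ) (c : ℂ) : Continuous (expAbs κ c) := by
  unfold expAbs
  fun_prop

theorem expAbs_zero (κ : ℝ) (c : ℂ) : expAbs κ c 0 = c := by simp [expAbs]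

theorem expAbs_neg (κ : ℝ) (c : ℂ) (x : ℝ) : expAbs κ c (-x) = expAbs κ c x := by simp [expAbs]

theorem expAbs_eqOn (κ : ℝ) (c : ℂ) :
    EqOn (fun x : ℝ => c * (Real.exp (-κ * x) : ℂ)) (expAbs κ c) (Ici 0) := fun x hx => by
  simp only [expAbs, abs_of_nonneg (show (0 : ℝ) ≤ x from hx)]

variable {κ : ℝ}

theorem memLp_expAbs_Ioi (hκ : 0 < κ) (c : ℂ) :
    MemLp (expAbs κ c) 2 (volume.restrict (Ioi 0)) := by
  refine (memLp_congr_ae ?_).1 (memLp_const_mul_exp hκ c)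
  rw [EventuallyEq, ae_restrict_iff' measurableSet_Ioi]
  exact Eventually.of_forall fun x hx => expAbs_eqOn κ c (Ioi_subset_Ici_self hx)

theorem memLp_expAbs (hκ : 0 < κ) (c : ℂ) : MemLp (expAbs κ c) 2 volume := by
  have h1 := memLp_expAbs_Ioi hκ c
  have h2 : MemLp (expAbs κ c) 2 (volume.restrict (Iio 0)) := by
    have := h1.comp_measurePreserving
      (measurePreserving_neg_restrict (t := Iio 0) measurableSet_Ioi (by simp))
    refine this.ae_eq (Eventually.of_forall fun x => ?_)
    simp [expAbs_neg]
  rw [memLp_two_iff_integrable_sq_norm (continuous_expAbs κ c).aestronglyMeasurable]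
  have i1 := integrableOn_norm_sq h1
  have i2 := integrableOn_norm_sq h2
  rw [← integrableOn_univ, ← Iic_union_Ioi (a := (0 : ℝ))]
  exact ((integrableOn_Iic_iff_integrableOn_Iio).2 i2).union i1

theorem integral_norm_sq_expAbs (hκ : 0 < κ) (c : ℂ) :
    ∫ x, ‖expAbs κ c x‖ ^ 2 = ‖c‖ ^ 2 / κ := by
  rw [integral_norm_sq_eq (memLp_expAbs hκ c)]
  simp only [expAbs_neg]
  have h : halfNormSq (expAbs κ c) = ‖c‖ ^ 2 / (2 * κ) := by
    rw [← halfNormSq_const_mul_exp hκ c]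
    refine (halfNormSq_congr ?_).symm
    rw [EventuallyEq, ae_restrict_iff' measurableSet_Ioi]
    exact Eventually.of_forall fun x hx => expAbs_eqOn κ c (Ioi_subset_Ici_self hx)
  change halfNormSq (expAbs κ c) + halfNormSq (expAbs κ c) = _
  rw [h]
  field_simp
  norm_num

theorem isH2With_expAbs_Ioi (hκ : 0 < κ) (c : ℂ) :
    IsH2With (Ioi 0) (expAbs κ c) (expAbs κ (κ ^ 2 * c)) := by
  have hl : ∀ c, LocallyIntegrableOn (expAbs κ c) (Ioi 0) := fun c =>
    locallyIntegrableOn_of_locallyIntegrable_restrict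
      ((memLp_expAbs_Ioi hκ c).locallyIntegrable (by norm_num))
  have he : ∀ c, EqOn (fun x : ℝ => c * (Real.exp (-κ * x) : ℂ)) (expAbs κ c) (Ioi 0) := fun c =>
    (expAbs_eqOn κ c).mono Ioi_subset_Ici_self
  have h2 := (halfLinePrimitive_exp hκ (-κ * c)).hasWeakDeriv
  rw [show -(κ : ℂ) * (-κ * c) = κ ^ 2 * c by ring] at h2
  exact ⟨memLp_expAbs_Ioi hκ c, memLp_expAbs_Ioi hκ _, expAbs κ (-κ * c), memLp_expAbs_Ioi hκ _,
    (halfLinePrimitive_exp hκ c).hasWeakDeriv.congr_eqOn (he _) (he _) (hl _) (hl _),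
    h2.congr_eqOn (he _) (he _) (hl _) (hl _)⟩

theorem isH2With_expAbs_Iio (hκ : 0 < κ) (c : ℂ) :
    IsH2With (Iio 0) (expAbs κ c) (expAbs κ (κ ^ 2 * c)) := by
  have := (isH2With_expAbs_Ioi hκ c).comp_neg (t := Iio 0) measurableSet_Ioi (by simp)
  simpa only [expAbs_neg] using this

theorem memW_expAbs (hκ : 0 < κ) (c : ℂ) : MemW (expAbs κ c) :=
  ⟨continuous_expAbs κ c, ⟨_, isH2With_expAbs_Iio hκ c⟩, ⟨_, isH2With_expAbs_Ioi hκ c⟩⟩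

theorem hasDerivWithinAt_expAbs_Ici (κ : ℝ) (c : ℂ) :
    HasDerivWithinAt (expAbs κ c) (-κ * c) (Ici 0) 0 := by
  have h1 : HasDerivAt (fun x : ℝ => Real.exp (-κ * x)) (Real.exp (-κ * 0) * (-κ * 1)) 0 :=
    ((hasDerivAt_id (0 : ℝ)).const_mul (-κ)).exp
  have h2 := (h1.ofReal_comp).const_mul c
  refine ((h2.congr_deriv ?_).hasDerivWithinAt).congr (fun x hx => (expAbs_eqOn κ c hx).symm)
    (expAbs_eqOn κ c (by simp)).symm
  simp
  ring

theorem hasDerivWithinAt_expAbs_Iic (κ : ℝ) (c : ℂ) :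
    HasDerivWithinAt (expAbs κ c) (κ * c) (Iic 0) 0 := by
  have h4 : HasDerivWithinAt (fun x : ℝ => -x) (-1) (Iic 0) 0 := (hasDerivWithinAt_id 0 _).neg
  have h5 : HasDerivWithinAt (expAbs κ c) (-κ * c) (Ici 0) (-0) := by
    simpa using hasDerivWithinAt_expAbs_Ici κ c
  have := HasDerivWithinAt.scomp (0 : ℝ) h5 h4 (fun x hx => by simpa using hx)
  simpa [Function.comp_def, expAbs_neg] using this

/-! ### Eigenvectors assembled from exponentials -/

theorem norm_sq_Lp_eq {f : Lp ℂ 2 (volume : Measure ℝ)} {g : ℝ → ℂ} (h : f =ᵐ[volume] g) :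
    ‖f‖ ^ 2 = ∫ x, ‖g x‖ ^ 2 := by
  have h1 : ‖f‖ ^ 2 = (inner ℂ f f).re := by
    rw [inner_self_eq_norm_sq_to_K, ← RCLike.ofReal_pow]
    rfl
  rw [h1, L2.inner_def]
  have h2 : ∀ x, inner ℂ (f x) (f x) = ((‖f x‖ ^ 2 : ℝ) : ℂ) := fun x => by
    rw [inner_self_eq_norm_sq_to_K]
    push_cast
    rfl
  simp only [h2]
  rw [integral_complex_ofReal, Complex.ofReal_re]
  exact integral_congr_ae (h.mono fun x hx => by simp only [hx])

/-- Since ‖C e^{-κ|x|}‖² = |C|²/κ, this makes the weight (n+1)^{-1/2} sufficient for membership in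
ℓ²(L²). -/
theorem kappa_ge {E : ℝ} (hE : E < 1 / 2) :
    ∃ c : ℝ, 0 < c ∧ ∀ n : ℕ, c * √(n + 1) ≤ √(n + 1 / 2 - E) := by
  refine ⟨√(min 1 (1 / 2 - E)), Real.sqrt_pos.2 (lt_min one_pos (by linarith)), fun n => ?_⟩
  rw [← Real.sqrt_mul (le_min zero_le_one (by linarith))]
  apply Real.sqrt_le_sqrt
  have h1 := min_le_left 1 (1 / 2 - E)
  have h2 := min_le_right 1 (1 / 2 - E)
  have h3 : (0 : ℝ) ≤ n := by positivity
  nlinarith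

/-- A solution of the recurrence for the values at the origin produces an eigenvector. -/
theorem exists_eigenvector {α E : ℝ} (hE : E < 1 / 2) {C : ℕ → ℂ}
    (hC : Summable fun n : ℕ => ‖C n‖ ^ 2 / √((n : ℝ) + 1))
    (hrec : ∀ n : ℕ, -2 * (√(n + 1 / 2 - E) : ℂ) * C n = ((α / √2 : ℝ) : ℂ) *
      (((√((n : ℝ) + 1) : ℝ) : ℂ) * C (n + 1) + ((√(n : ℝ) : ℝ) : ℂ) * C (n - 1)))
    (hne : ∃ n, C n ≠ 0) : ∃ U ∈ eigenspace (A α) (E : ℂ), U ≠ 0 := by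
  have hκ : ∀ n : ℕ, 0 < √((n : ℝ) + 1 / 2 - E) := fun n => Real.sqrt_pos.2 (by
    have : (0 : ℝ) ≤ n := by positivity
    linarith)
  set u : ℕ → ℝ → ℂ := fun n => expAbs (√((n : ℝ) + 1 / 2 - E)) (C n) with hu
  have hmem : ∀ n, MemLp (u n) 2 volume := fun n => memLp_expAbs (hκ n) _
  have hnorm : ∀ n, ‖(hmem n).toLp‖ ^ 2 = ‖C n‖ ^ 2 / √((n : ℝ) + 1 / 2 - E) := fun n => by
    rw [norm_sq_Lp_eq (hmem n).coeFn_toLp, integral_norm_sq_expAbs (hκ n)]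
  have hU : Memℓp (fun n => (hmem n).toLp) 2 := by
    rw [memℓp_gen_iff (by norm_num)]
    simp only [ENNReal.toReal_ofNat, Real.rpow_ofNat, hnorm]
    obtain ⟨c, hc, hcn⟩ := kappa_ge hE
    refine Summable.of_nonneg_of_le (fun n => by positivity) (fun n => ?_) (hC.mul_left (1 / c))
    rw [one_div_mul_eq_div, div_div, mul_comm _ c]
    exact div_le_div_of_nonneg_left (by positivity) (by positivity) (hcn n)
  set U : H := ⟨fun n => (hmem n).toLp, hU⟩ with hUdef
  have hUn : ∀ n, (U n : ℝ → ℂ) =ᵐ[volume] u n := fun n => (hmem n).coeFn_toLp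
  refine ⟨U, ?_, ?_⟩
  · have hact : ActsAs α U ((E : ℂ) • U) := by
      refine ⟨u, fun n => memW_expAbs (hκ n) _, hUn, fun n => ?_, fun n => ?_⟩
      · refine ⟨_, _, hasDerivWithinAt_expAbs_Ici _ _, hasDerivWithinAt_expAbs_Iic _ _, ?_⟩
        simp only [hu, expAbs_zero]
        rw [← hrec n]
        ring
      · refine ⟨_, isH2With_expAbs_Iio (hκ n) _, isH2With_expAbs_Ioi (hκ n) _, ?_⟩
        rw [lp.coeFn_smul, Pi.smul_apply]
        filter_upwards [Lp.coeFn_smul (E : ℂ) (U n), hUn n] with x e1 e2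
        rw [e1, Pi.smul_apply, e2]
        simp only [hu, expAbs, smul_eq_mul]
        rw [← Complex.ofReal_pow, Real.sq_sqrt (by have := Real.sqrt_pos.1 (hκ n); exact this.le)]
        push_cast
        ring
    exact (mem_graph_iff α _ _).2 hact
  · intro h0
    obtain ⟨n, hn⟩ := hne
    have h1 : ‖U n‖ ^ 2 = ‖C n‖ ^ 2 / √((n : ℝ) + 1 / 2 - E) := hnorm n
    rw [h0] at h1
    have h2 : 0 < ‖C n‖ ^ 2 / √((n : ℝ) + 1 / 2 - E) :=
      div_pos (by have := norm_pos_iff.2 hn; positivity) (hκ n)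
    have h3 : ‖(0 : H) n‖ = 0 := by simp
    rw [h3] at h1
    norm_num at h1
    linarith

/-! ### Values at the origin -/

/-- `C n` is the value at the origin of the continuous representative of the component `U n`. -/
def IsTrace (U : H) (C : ℕ → ℂ) : Prop :=
  ∀ n, ∃ u : ℝ → ℂ, Continuous u ∧ U n =ᵐ[volume] u ∧ u 0 = C n

theorem IsTrace.eq_of_ae {U : H} {C : ℕ → ℂ} (h : IsTrace U C) {n : ℕ} {u : ℝ → ℂ}
    (hu : Continuous u) (hU : U n =ᵐ[volume] u) : C n = u 0 := by
  obtain ⟨u', h1, h2, h3⟩ := h n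
  rw [← h3, (h1.ae_eq_iff_eq volume hu).1 (h2.symm.trans hU)]

theorem IsTrace.add {U V : H} {C D : ℕ → ℂ} (hU : IsTrace U C) (hV : IsTrace V D) :
    IsTrace (U + V) (C + D) := by
  intro n
  obtain ⟨u, h1, h2, h3⟩ := hU n
  obtain ⟨v, k1, k2, k3⟩ := hV n
  refine ⟨u + v, h1.add k1, ?_, by simp [h3, k3]⟩
  rw [lp.coeFn_add, Pi.add_apply]
  exact (Lp.coeFn_add _ _).trans (h2.add k2)

theorem IsTrace.smul {U : H} {C : ℕ → ℂ} (c : ℂ) (hU : IsTrace U C) : IsTrace (c • U) (c • C) := by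
  intro n
  obtain ⟨u, h1, h2, h3⟩ := hU n
  refine ⟨c • u, h1.const_smul c, ?_, by simp [h3]⟩
  rw [lp.coeFn_smul, Pi.smul_apply]
  exact (Lp.coeFn_smul _ _).trans (h2.const_smul c)

theorem IsTrace.sum {ι : Type*} (s : Finset ι) {U : ι → H} {C : ι → ℕ → ℂ}
    (h : ∀ i ∈ s, IsTrace (U i) (C i)) : IsTrace (∑ i ∈ s, U i) (∑ i ∈ s, C i) := by
  classical
  induction s using Finset.induction_on with
  | empty =>
    intro n
    exact ⟨0, continuous_zero, by simpa using Lp.coeFn_zero ℂ 2 (volume : Measure ℝ), by simp⟩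
  | insert i s hi ih =>
    rw [Finset.sum_insert hi, Finset.sum_insert hi]
    exact (h i (by simp)).add (ih fun j hj => h j (by simp [hj]))

/-- The right-hand side of the matching condition. -/
noncomputable def jump (α : ℝ) (C : ℕ → ℂ) (n : ℕ) : ℂ := ((α / √2 : ℝ) : ℂ) *
  (((√((n : ℝ) + 1) : ℝ) : ℂ) * C (n + 1) + ((√(n : ℝ) : ℝ) : ℂ) * C (n - 1))

theorem ActsAs.exists_isTrace {α : ℝ} {U F : H} (h : ActsAs α U F) : ∃ C, IsTrace U C := by
  obtain ⟨u, h1, h2, -⟩ := h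
  exact ⟨fun n => u n 0, fun n => ⟨u n, (h1 n).1, h2 n, rfl⟩⟩

theorem ActsAs.exists_components {α : ℝ} {U F : H} (h : ActsAs α U F) {C : ℕ → ℂ}
    (hC : IsTrace U C) (n : ℕ) : ∃ (u : ℝ → ℂ) (a b : ℂ), Continuous u ∧ U n =ᵐ[volume] u ∧
      u 0 = C n ∧ IsLPlus n u (F n) ∧ HasDerivWithinAt u a (Ici 0) 0 ∧
      HasDerivWithinAt u b (Iic 0) 0 ∧ a - b = jump α C n := by
  obtain ⟨u, h1, h2, h3, h4⟩ := h
  have hCu : ∀ m, C m = u m 0 := fun m => hC.eq_of_ae (h1 m).1 (h2 m)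
  obtain ⟨a, b, ha, hb, hab⟩ := h3 n
  exact ⟨u n, a, b, (h1 n).1, h2 n, (hCu n).symm, h4 n, ha, hb, by rw [hab, jump, hCu, hCu]⟩

theorem inner_Lp_eq {f g : Lp ℂ 2 (volume : Measure ℝ)} {u : ℝ → ℂ} (h : g =ᵐ[volume] u) :
    inner ℂ f g = ∫ x, (starRingEnd ℂ) (f x) * u x := by
  rw [L2.inner_def]
  refine integral_congr_ae (h.mono fun x hx => ?_)
  simp only [RCLike.inner_apply, hx]
  ring

theorem ActsAs.quadratic_form {α : ℝ} {U F : H} (h : ActsAs α U F) {C : ℕ → ℂ}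
    (hC : IsTrace U C) (n : ℕ) : ∃ q : ℝ,
      inner ℂ (F n) (U n) = (q : ℂ) + (starRingEnd ℂ) (jump α C n) * C n ∧
      ∀ κ : ℝ, (n + 1 / 2 - κ ^ 2) * ‖U n‖ ^ 2 + 2 * κ * ‖C n‖ ^ 2 ≤ q := by
  obtain ⟨u, a, b, hu, hU, h0, hL, ha, hb, hab⟩ := h.exists_components hC n
  obtain ⟨q, h1, h2⟩ := hL.quadratic_form hu ((memLp_congr_ae hU).1 (Lp.memLp _)) (Lp.memLp _) ha hb
  refine ⟨q, ?_, fun κ => ?_⟩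
  · rw [inner_Lp_eq hU, h1, hab, h0]
  · rw [norm_sq_Lp_eq hU, ← h0]
    exact h2 κ

theorem summable_norm_sq (U : H) : Summable fun n => ‖U n‖ ^ 2 := by
  have := (memℓp_gen_iff (p := 2) (by norm_num)).1 (lp.memℓp U)
  simpa using this

theorem ActsAs.summable_trace {α : ℝ} {U F : H} (h : ActsAs α U F) {C : ℕ → ℂ}
    (hC : IsTrace U C) : Summable fun n : ℕ => ‖C n‖ ^ 2 / √((n : ℝ) + 1) := by
  refine Summable.of_nonneg_of_le (fun n => by positivity) (fun n => ?_)
    (((summable_norm_sq U).add (summable_norm_sq F)).mul_left 16)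
  obtain ⟨u, a, b, hu, hU, h0, hL, ha, hb, hab⟩ := h.exists_components hC n
  have h1 := hL.trace_bound hu ((memLp_congr_ae hU).1 (Lp.memLp _)) (Lp.memLp _) ha hb
  rw [← norm_sq_Lp_eq hU, ← norm_sq_Lp_eq (EventuallyEq.refl _ _), h0] at h1
  rw [div_le_iff₀ (by positivity)]
  have h2 : √((n : ℝ) + 1 / 2) ≤ √((n : ℝ) + 1) := Real.sqrt_le_sqrt (by linarith)
  have h3 : 0 ≤ ‖U n‖ ^ 2 + ‖F n‖ ^ 2 := by positivity
  nlinarith [mul_le_mul_of_nonneg_left h2 h3]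

/-! ### Vanishing of the boundary term along a subsequence -/

/-- Otherwise the harmonic series would converge. -/
theorem frequently_lt_of_summable_div {x : ℕ → ℝ} (hx : Summable fun n : ℕ => x n / ((n : ℝ) + 1))
    {ε : ℝ} (hε : 0 < ε) : ∃ᶠ n in atTop, x n < ε := by
  intro hn
  have h1 : ∀ᶠ n : ℕ in atTop, ε / ((n : ℝ) + 1) ≤ x n / ((n : ℝ) + 1) := by
    filter_upwards [hn] with n h2
    have := not_lt.1 h2
    gcongr
  have h2 : Summable fun n : ℕ => ε / ((n : ℝ) + 1) := by
    refine Summable.of_norm_bounded_eventually_nat hx ?_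
    filter_upwards [h1] with n h3
    rwa [Real.norm_of_nonneg (by positivity)]
  have h3 : Summable fun n : ℕ => 1 / ((n : ℝ) + 1) := by
    refine (h2.mul_left (1 / ε)).congr fun n => ?_
    field_simp
  have h4 : Summable fun n : ℕ => 1 / (((n + 1 : ℕ)) : ℝ) := by simpa using h3
  exact Real.not_summable_one_div_natCast ((summable_nat_add_iff 1).1 h4)

/-- The boundary term divided by n + 1 is |C_{n+1}||C_n|/√(n+1), summable by the trace bound. It
need not tend to 0, but it is small along a subsequence, which suffices for every limit of partial
sums below. -/
theorem frequently_boundary_lt {C : ℕ → ℂ} (hC : Summable fun n : ℕ => ‖C n‖ ^ 2 / √((n : ℝ) + 1))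
    {ε : ℝ} (hε : 0 < ε) :
    ∃ᶠ n : ℕ in atTop, √((n : ℝ) + 1) * (‖C (n + 1)‖ * ‖C n‖) < ε := by
  refine frequently_lt_of_summable_div ?_ hε
  have h1 := (summable_nat_add_iff 1).2 hC
  refine Summable.of_nonneg_of_le (fun n => by positivity) (fun n => ?_) ((hC.add h1).mul_left 2)
  have e : √((n : ℝ) + 1) * (‖C (n + 1)‖ * ‖C n‖) / ((n : ℝ) + 1) =
      ‖C (n + 1)‖ * ‖C n‖ / √((n : ℝ) + 1) := by
    have h2 : √((n : ℝ) + 1) * √((n : ℝ) + 1) = (n : ℝ) + 1 := Real.mul_self_sqrt (by positivity)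
    have h3 : 0 < √((n : ℝ) + 1) := by positivity
    rw [div_eq_div_iff (by positivity) (by positivity)]
    linear_combination ‖C (n + 1)‖ * ‖C n‖ * h2
  rw [e]
  have h4 : √(((n + 1 : ℕ) : ℝ) + 1) ≤ 2 * √((n : ℝ) + 1) := by
    rw [show (2 : ℝ) = √4 by rw [show (4 : ℝ) = 2 ^ 2 by norm_num]; simp, ← Real.sqrt_mul (by norm_num)]
    apply Real.sqrt_le_sqrt
    push_cast
    have : (0 : ℝ) ≤ n := by positivity
    linarith
  have h5 : ‖C (n + 1)‖ ^ 2 / (2 * √((n : ℝ) + 1)) ≤ ‖C (n + 1)‖ ^ 2 / √(((n + 1 : ℕ) : ℝ) + 1) :=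
    div_le_div_of_nonneg_left (by positivity) (by positivity) h4
  have h6 : ‖C (n + 1)‖ * ‖C n‖ / √((n : ℝ) + 1) ≤ 2 * (‖C n‖ ^ 2 / √((n : ℝ) + 1) +
      ‖C (n + 1)‖ ^ 2 / (2 * √((n : ℝ) + 1))) := by
    have h7 : 0 < √((n : ℝ) + 1) := by positivity
    rw [show 2 * (‖C n‖ ^ 2 / √((n : ℝ) + 1) + ‖C (n + 1)‖ ^ 2 / (2 * √((n : ℝ) + 1))) =
      (2 * ‖C n‖ ^ 2 + ‖C (n + 1)‖ ^ 2) / √((n : ℝ) + 1) by field_simp]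
    gcongr
    nlinarith [sq_nonneg (‖C n‖ - ‖C (n + 1)‖), sq_nonneg (‖C n‖ + ‖C (n + 1)‖)]
  linarith

/-! ### The quadratic form of the operator -/

/-- The coupling is symmetric, so each edge n, n+1 contributes a conjugate pair and hence a real
number; only the edge leaving the truncation is unpaired. -/
theorem sum_jump_mul (α : ℝ) (C : ℕ → ℂ) (N : ℕ) :
    ∑ n ∈ Finset.range (N + 1), (starRingEnd ℂ) (jump α C n) * C n =
      ((α / √2 : ℝ) : ℂ) * (((∑ n ∈ Finset.range N,
        2 * √((n : ℝ) + 1) * ((starRingEnd ℂ) (C (n + 1)) * C n).re : ℝ) : ℂ) +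
        (√((N : ℝ) + 1) : ℂ) * ((starRingEnd ℂ) (C (N + 1)) * C N)) := by
  induction N with
  | zero => simp [jump]; ring
  | succ N ih =>
    rw [Finset.sum_range_succ, ih, Finset.sum_range_succ]
    have h : ((2 * √((N : ℝ) + 1) * ((starRingEnd ℂ) (C (N + 1)) * C N).re : ℝ) : ℂ) =
        (√((N : ℝ) + 1) : ℂ) * ((starRingEnd ℂ) (C (N + 1)) * C N +
          (starRingEnd ℂ) (C N) * C (N + 1)) := by
      have := Complex.add_conj ((starRingEnd ℂ) (C (N + 1)) * C N)
      rw [map_mul, Complex.conj_conj] at this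
      rw [mul_comm ((starRingEnd ℂ) (C N)), this]
      push_cast
      ring
    rw [Complex.ofReal_add, h]
    simp only [jump, map_mul, map_add, Complex.conj_ofReal, Nat.add_sub_cancel]
    push_cast
    ring

theorem norm_boundary_le (C : ℕ → ℂ) (N : ℕ) :
    ‖(√((N : ℝ) + 1) : ℂ) * ((starRingEnd ℂ) (C (N + 1)) * C N)‖ =
      √((N : ℝ) + 1) * (‖C (N + 1)‖ * ‖C N‖) := by
  rw [norm_mul, norm_mul, RCLike.norm_conj, Complex.norm_real,
    Real.norm_of_nonneg (Real.sqrt_nonneg _)]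

/-- The partial sums are real up to the boundary term, which is arbitrarily small along a
subsequence. -/
theorem ActsAs.im_inner_eq_zero {α : ℝ} {U F : H} (h : ActsAs α U F) : (inner ℂ F U).im = 0 := by
  obtain ⟨C, hC⟩ := h.exists_isTrace
  choose q hq _ using h.quadratic_form hC
  have hs := (lp.hasSum_inner (𝕜 := ℂ) F U).tendsto_sum_nat.comp (tendsto_add_atTop_nat 1)
  have hs2 := (Complex.continuous_im.tendsto _).comp hs
  have heq : ∀ N, (∑ n ∈ Finset.range (N + 1), inner ℂ (F n) (U n)).im =
      (((α / √2 : ℝ) : ℂ) * ((√((N : ℝ) + 1) : ℂ) * ((starRingEnd ℂ) (C (N + 1)) * C N))).im := by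
    intro N
    simp only [hq]
    rw [Finset.sum_add_distrib, sum_jump_mul, mul_add, Complex.add_im, Complex.add_im,
      ← Complex.ofReal_sum, Complex.ofReal_im, ← Complex.ofReal_mul, Complex.ofReal_im]
    ring
  by_contra hne
  have hpos : 0 < |(inner ℂ F U).im| := abs_pos.2 hne
  have hev : ∀ᶠ N in atTop, |(inner ℂ F U).im| / 2 <
      |(∑ n ∈ Finset.range (N + 1), inner ℂ (F n) (U n)).im| :=
    hs2.abs.eventually (lt_mem_nhds (by linarith))
  have hfr := frequently_boundary_lt (h.summable_trace hC)
    (ε := |(inner ℂ F U).im| / 2 / (|α / √2| + 1)) (by positivity)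
  obtain ⟨N, h1, h2⟩ := (hfr.and_eventually hev).exists
  rw [heq] at h2
  have h3 := Complex.abs_im_le_norm
    (((α / √2 : ℝ) : ℂ) * ((√((N : ℝ) + 1) : ℂ) * ((starRingEnd ℂ) (C (N + 1)) * C N)))
  rw [norm_mul, norm_boundary_le, Complex.norm_real, Real.norm_eq_abs] at h3
  rw [lt_div_iff₀ (by positivity)] at h1
  have h4 : 0 ≤ √((N : ℝ) + 1) * (‖C (N + 1)‖ * ‖C N‖) := by positivity
  nlinarith

theorem norm_sq_H (U : H) : HasSum (fun n => ‖U n‖ ^ 2) (‖U‖ ^ 2) := by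
  have := lp.hasSum_norm (p := 2) (by norm_num) U
  simpa using this

/-- A lower bound for the partial sums of the form of the values at the origin gives a lower bound
for the form of the operator. -/
theorem ActsAs.le_re_inner {α : ℝ} {U F : H} (h : ActsAs α U F) {C : ℕ → ℂ}
    (hC : IsTrace U C) {E : ℝ} (hE : E ≤ 1 / 2)
    (hQ : ∀ᶠ N : ℕ in atTop, 0 ≤ (∑ n ∈ Finset.range (N + 1),
      2 * √((n : ℝ) + 1 / 2 - E) * ‖C n‖ ^ 2) + α / √2 * ∑ n ∈ Finset.range N,
        2 * √((n : ℝ) + 1) * ((starRingEnd ℂ) (C (n + 1)) * C n).re) :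
    E * ‖U‖ ^ 2 ≤ (inner ℂ F U).re := by
  choose q hq hq2 using h.quadratic_form hC
  have hs := (lp.hasSum_inner (𝕜 := ℂ) F U).tendsto_sum_nat.comp (tendsto_add_atTop_nat 1)
  have hs2 := (Complex.continuous_re.tendsto _).comp hs
  have hs3 := ((norm_sq_H U).mul_left E).tendsto_sum_nat.comp (tendsto_add_atTop_nat 1)
  have hs4 := hs2.sub hs3
  by_contra hlt
  rw [not_le] at hlt
  set L := (inner ℂ F U).re - E * ‖U‖ ^ 2 with hL
  have hL0 : L < 0 := by linarith
  have hev := hs4.eventually (gt_mem_nhds (show L < L / 2 by linarith))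
  have hfr := frequently_boundary_lt (h.summable_trace hC)
    (ε := -(L / 2) / (|α / √2| + 1)) (div_pos (by linarith) (by positivity))
  obtain ⟨N, h1, h2, h3⟩ := (hfr.and_eventually (hev.and hQ)).exists
  simp only [Function.comp_apply, hq] at h2
  rw [Finset.sum_add_distrib, sum_jump_mul, mul_add, Complex.add_re, Complex.add_re,
      ← Complex.ofReal_sum, Complex.ofReal_re, ← Complex.ofReal_mul, Complex.ofReal_re] at h2
  have h4 := Complex.abs_re_le_norm
    (((α / √2 : ℝ) : ℂ) * ((√((N : ℝ) + 1) : ℂ) * ((starRingEnd ℂ) (C (N + 1)) * C N)))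
  rw [norm_mul, norm_boundary_le, Complex.norm_real, Real.norm_eq_abs] at h4
  rw [lt_div_iff₀ (by positivity)] at h1
  have h5 : 0 ≤ √((N : ℝ) + 1) * (‖C (N + 1)‖ * ‖C N‖) := by positivity
  have h6 : ∑ n ∈ Finset.range (N + 1), E * ‖U n‖ ^ 2 + ∑ n ∈ Finset.range (N + 1),
      2 * √((n : ℝ) + 1 / 2 - E) * ‖C n‖ ^ 2 ≤ ∑ n ∈ Finset.range (N + 1), q n := by
    rw [← Finset.sum_add_distrib]
    refine Finset.sum_le_sum fun n _ => ?_
    -- With κ² = n + 1/2 - E the coefficient of ‖U n‖² in the energy bound becomes exactly E.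
    have := hq2 n (√((n : ℝ) + 1 / 2 - E))
    rw [Real.sq_sqrt (by have : (0 : ℝ) ≤ n := by positivity
                         linarith)] at this
    linarith
  have h7 := neg_abs_le (((α / √2 : ℝ) : ℂ) * ((√((N : ℝ) + 1) : ℂ) *
    ((starRingEnd ℂ) (C (N + 1)) * C N))).re
  nlinarith

/-! ### Eigenvectors -/

theorem actsAs_of_mem_eigenspace {α : ℝ} {z : ℂ} {U : H} (h : U ∈ eigenspace (A α) z) :
    ActsAs α U (z • U) := (mem_graph_iff α _ _).1 h

theorem eigenvalue_real {α : ℝ} {z : ℂ} (h : z ∈ pointSpectrum (A α)) : z = (z.re : ℂ) := by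
  obtain ⟨U, hU, hne⟩ := h
  have h1 := (actsAs_of_mem_eigenspace hU).im_inner_eq_zero
  rw [inner_smul_left, inner_self_eq_norm_sq_to_K] at h1
  have h2 : 0 < ‖U‖ := norm_pos_iff.2 hne
  have h3 : ((‖U‖ : ℝ) : ℂ) ^ 2 = ((‖U‖ ^ 2 : ℝ) : ℂ) := by push_cast; rfl
  rw [show (RCLike.ofReal ‖U‖ : ℂ) = ((‖U‖ : ℝ) : ℂ) from rfl, h3, Complex.im_mul_ofReal,
    Complex.conj_im] at h1
  have h4 : z.im = 0 := by
    rcases mul_eq_zero.1 h1 with h5 | h5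
    · linarith
    · exact absurd h5 (by positivity)
  exact Complex.ext (by simp) (by simp [h4])

/-- The jump is included in the last alternative because at the indices with n + 1/2 ≤ E it feeds
the recurrence that propagates C = 0. -/
theorem eigenvector_component {α E : ℝ} {U : H} (h : U ∈ eigenspace (A α) (E : ℂ)) {C : ℕ → ℂ}
    (hC : IsTrace U C) (n : ℕ) :
    (E < n + 1 / 2 → jump α C n = -2 * (√(n + 1 / 2 - E) : ℂ) * C n) ∧ (C n = 0 → U n = 0) ∧
    (n + 1 / 2 ≤ E → U n = 0 ∧ C n = 0 ∧ jump α C n = 0) := by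
  obtain ⟨u, a, b, hu, hU, h0, hL, ha, hb, hab⟩ :=
    (actsAs_of_mem_eigenspace h).exists_components hC n
  have hF : (((E : ℂ) • U : H) n : ℝ → ℂ) =ᵐ[volume] fun x => (E : ℂ) * u x := by
    rw [lp.coeFn_smul, Pi.smul_apply]
    filter_upwards [Lp.coeFn_smul (E : ℂ) (U n), hU] with x e1 e2
    rw [e1, Pi.smul_apply, e2, smul_eq_mul]
  have hz : u =ᵐ[volume] 0 → U n = 0 := fun hz =>
    Lp.ext ((hU.trans hz).trans (Lp.coeFn_zero ℂ 2 volume).symm)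
  have hz3 : n + 1 / 2 ≤ E → u =ᵐ[volume] 0 := fun hE => hL.eigen_nonpos hu ha hb hF hE
  refine ⟨fun hE => ?_, fun hn => ?_, fun hE => ?_⟩
  · rw [← hab, (hL.eigen_pos hu ha hb hF hE).1, h0]
  · rcases lt_or_ge E (n + 1 / 2) with hE | hE
    · exact hz ((hL.eigen_pos hu ha hb hF hE).2 (h0.trans hn))
    · exact hz (hz3 hE)
  · have hu0 : u = 0 := (hu.ae_eq_iff_eq volume continuous_zero).1 (hz3 hE)
    refine ⟨hz (hz3 hE), by rw [← h0, hu0]; rfl, ?_⟩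
    subst hu0
    rw [← hab, (uniqueDiffWithinAt_Ici 0).eq_deriv _ ha (hasDerivWithinAt_const 0 _ 0),
      (uniqueDiffWithinAt_Iic 0).eq_deriv _ hb (hasDerivWithinAt_const 0 _ 0), sub_zero]

theorem eq_zero_of_components {U : H} (h : ∀ n, U n = 0) : U = 0 :=
  lp.ext (funext fun n => by simpa using h n)

/-- The three-term recurrence determines the values at the origin from the first one. -/
theorem trace_eq_zero_of_first {α E : ℝ} (hα : 0 < α) {U : H} (h : U ∈ eigenspace (A α) (E : ℂ))
    {C : ℕ → ℂ} (hC : IsTrace U C) (h0 : C 0 = 0) : U = 0 := by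
  have hj : ∀ n, C n = 0 → jump α C n = 0 := fun n hn => by
    obtain ⟨h1, h2, h3⟩ := eigenvector_component h hC n
    rcases lt_or_ge E (n + 1 / 2) with hE | hE
    · rw [h1 hE, hn, mul_zero]
    · exact (h3 hE).2.2
  have hα2 : ((α / √2 : ℝ) : ℂ) ≠ 0 := by
    rw [Complex.ofReal_ne_zero]
    positivity
  have hstep : ∀ n, C n = 0 → C (n - 1) = 0 → C (n + 1) = 0 := fun n hn hn1 => by
    have h1 := hj n hn
    rw [jump, hn1, mul_zero, add_zero] at h1
    have h2 : ((√((n : ℝ) + 1) : ℝ) : ℂ) ≠ 0 := by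
      rw [Complex.ofReal_ne_zero]
      positivity
    exact (mul_eq_zero.1 ((mul_eq_zero.1 h1).resolve_left hα2)).resolve_left h2
  have hall : ∀ n, C n = 0 ∧ C (n + 1) = 0 := by
    intro n
    induction n with
    | zero => exact ⟨h0, hstep 0 h0 h0⟩
    | succ n ih => exact ⟨ih.2, hstep (n + 1) ih.2 ih.1⟩
  exact eq_zero_of_components fun n => (eigenvector_component h hC n).2.1 (hall n).1

theorem no_eigenvalue_ge_half {α E : ℝ} (hα : 0 ≤ α) (hE : 1 / 2 ≤ E) :
    (E : ℂ) ∉ pointSpectrum (A α) := by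
  rintro ⟨U, hU, hne⟩
  obtain ⟨C, hC⟩ := (actsAs_of_mem_eigenspace hU).exists_isTrace
  rcases hα.eq_or_lt with rfl | hα
  · refine hne (eq_zero_of_components fun n => ?_)
    obtain ⟨h1, h2, h3⟩ := eigenvector_component hU hC n
    rcases lt_or_ge E (n + 1 / 2) with hE | hE
    · refine h2 ?_
      have h4 := h1 hE
      simp only [jump, zero_div, Complex.ofReal_zero, zero_mul] at h4
      have h5 : (√((n : ℝ) + 1 / 2 - E) : ℂ) ≠ 0 := by
        rw [Complex.ofReal_ne_zero]
        exact (Real.sqrt_pos.2 (by linarith)).ne'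
      rcases mul_eq_zero.1 h4.symm with h6 | h6
      · exact absurd h6 (mul_ne_zero (by norm_num) h5)
      · exact h6
    · exact (h3 hE).1
  · refine hne (trace_eq_zero_of_first hα hU hC ?_)
    exact ((eigenvector_component hU hC 0).2.2 (by simpa using hE)).2.1

theorem finrank_eigenspace {α E : ℝ} (hα : 0 < α) (h : (E : ℂ) ∈ pointSpectrum (A α)) :
    Module.finrank ℂ (eigenspace (A α) (E : ℂ)) = 1 := by
  obtain ⟨U, hU, hne⟩ := h
  obtain ⟨C, hC⟩ := (actsAs_of_mem_eigenspace hU).exists_isTrace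
  have hC0 : C 0 ≠ 0 := fun h0 => hne (trace_eq_zero_of_first hα hU hC h0)
  rw [finrank_eq_one_iff']
  refine ⟨⟨U, hU⟩, fun h0 => hne (congrArg Subtype.val h0), fun V => ?_⟩
  obtain ⟨D, hD⟩ := (actsAs_of_mem_eigenspace V.2).exists_isTrace
  -- The combination V - (D 0 / C 0) U has first trace 0, hence vanishes.
  refine ⟨D 0 / C 0, Subtype.ext ?_⟩
  have h1 := trace_eq_zero_of_first hα
    (add_mem V.2 (Submodule.smul_mem _ (-(D 0 / C 0)) hU)) (hD.add (hC.smul (-(D 0 / C 0)))) (by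
      simp only [Pi.add_apply, Pi.smul_apply, smul_eq_mul]
      field_simp
      ring)
  rw [neg_smul, ← sub_eq_add_neg, sub_eq_zero] at h1
  exact h1.symm

/-! ### Three-term recurrences -/

/-- `P` satisfies `b₀ P₀ = a₀ P₁` and `bₙ Pₙ = aₙ Pₙ₊₁ + aₙ₋₁ Pₙ₋₁` for `n ≥ 1`. -/
def IsJacobiSol (a b P : ℕ → ℝ) : Prop :=
  b 0 * P 0 = a 0 * P 1 ∧ ∀ n, b (n + 1) * P (n + 1) = a (n + 1) * P (n + 2) + a n * P n

/-- The solution of the three-term recurrence with initial value `1`. -/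
noncomputable def jacobiSol (a b : ℕ → ℝ) : ℕ → ℝ
  | 0 => 1
  | 1 => b 0 / a 0
  | n + 2 => (b (n + 1) * jacobiSol a b (n + 1) - a n * jacobiSol a b n) / a (n + 1)

theorem jacobiSol_isJacobiSol {a : ℕ → ℝ} (ha : ∀ n, 0 < a n) (b : ℕ → ℝ) :
    IsJacobiSol a b (jacobiSol a b) := by
  refine ⟨?_, fun n => ?_⟩
  · have := (ha 0).ne'
    simp only [jacobiSol]
    field_simp
  · have := (ha (n + 1)).ne'
    rw [jacobiSol]
    field_simp
    ring

theorem IsJacobiSol.ne_zero_or {a b P : ℕ → ℝ} (ha : ∀ n, 0 < a n) (h : IsJacobiSol a b P)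
    (h0 : P 0 ≠ 0) (n : ℕ) : P n ≠ 0 ∨ P (n + 1) ≠ 0 := by
  induction n with
  | zero => exact Or.inl h0
  | succ n ih =>
    by_contra! hc
    have h1 := h.2 n
    rw [hc.1, hc.2] at h1
    have h2 : P n = 0 := by
      have h3 : a n * P n = 0 := by linarith
      exact (mul_eq_zero.1 h3).resolve_left (ha n).ne'
    exact ih.elim (fun h => h h2) (fun h => h hc.1)

/-- The edges `(n, n + 1)` along which `P` changes sign, or reaches zero. -/
def signChanges (P : ℕ → ℝ) : Set ℕ := {n | P n ≠ 0 ∧ P n * P (n + 1) ≤ 0}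

/-- The partial sums of the quadratic form of a Jacobi matrix. -/
def jacobiForm (a b p : ℕ → ℝ) (N : ℕ) : ℝ :=
  (∑ n ∈ Finset.range (N + 1), b n * p n ^ 2) - 2 * ∑ n ∈ Finset.range N, a n * (p n * p (n + 1))

theorem jacobiForm_succ (a b p : ℕ → ℝ) (N : ℕ) : jacobiForm a b p (N + 1) =
    jacobiForm a b p N + b (N + 1) * p (N + 1) ^ 2 - 2 * (a N * (p N * p (N + 1))) := by
  simp only [jacobiForm]
  rw [Finset.sum_range_succ (fun n => b n * p n ^ 2) (N + 1),
    Finset.sum_range_succ (fun n => a n * (p n * p (n + 1))) N]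
  ring

/-- Picone's inequality for Jacobi forms. -/
theorem IsJacobiSol.picone {a b P : ℕ → ℝ} (ha : ∀ n, 0 < a n) (h : IsJacobiSol a b P)
    (h0 : P 0 ≠ 0) {p : ℕ → ℝ} (hp : ∀ n ∈ signChanges P, p (n + 1) * P n = p n * P (n + 1)) (N : ℕ) :
    (P N = 0 → p N = 0) ∧ a N * (P (N + 1) / P N) * p N ^ 2 ≤ jacobiForm a b p N := by
  induction N with
  | zero =>
    refine ⟨fun h1 => absurd h1 h0, le_of_eq ?_⟩
    have h1 := h.1
    simp only [jacobiForm, Finset.sum_range_one, Finset.range_zero, Finset.sum_empty, zero_add]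
    field_simp
    linear_combination -(p 0 ^ 2) * h1
  | succ N ih =>
    obtain ⟨ih1, ih2⟩ := ih
    rw [jacobiForm_succ]
    have hrec := h.2 N
    have haN := ha N
    -- When P N = 0 the quotient P (N+1) / P N is 0 by convention; the bound survives because p N =
    -- 0 there.
    by_cases hN : P N = 0
    · have hN1 : P (N + 1) ≠ 0 := (h.ne_zero_or ha h0 N).resolve_left (by simpa using hN)
      refine ⟨fun h1 => absurd h1 hN1, ?_⟩
      rw [hN, mul_zero, add_zero] at hrec
      rw [ih1 hN] at ih2 ⊢
      have e : b (N + 1) = a (N + 1) * (P (N + 2) / P (N + 1)) := by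
        field_simp
        linarith
      rw [e]
      norm_num at ih2
      norm_num
      exact ih2
    · by_cases hN1 : P (N + 1) = 0
      · have hbad := hp N ⟨hN, by rw [hN1]; simp⟩
        rw [hN1, mul_zero] at hbad
        have hpz : p (N + 1) = 0 := (mul_eq_zero.1 hbad).resolve_right hN
        refine ⟨fun _ => hpz, ?_⟩
        rw [hN1] at ih2
        rw [hpz]
        simp only [zero_div, mul_zero, zero_mul] at ih2
        norm_num
        exact ih2
      · refine ⟨fun h1 => absurd h1 hN1, ?_⟩
        have e : b (N + 1) = a (N + 1) * (P (N + 2) / P (N + 1)) + a N * (P N / P (N + 1)) := by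
          field_simp
          linarith
        -- Completing the square: the expression is a_N (p_{N+1}P_N - p_N P_{N+1})² / (P_N P_{N+1}),
        -- nonnegative off the sign changes and zero on them by the condition on p.
        have key : 0 ≤ a N * (P (N + 1) / P N) * p N ^ 2 - 2 * (a N * (p N * p (N + 1))) +
            a N * (P N / P (N + 1)) * p (N + 1) ^ 2 := by
          have e2 : a N * (P (N + 1) / P N) * p N ^ 2 - 2 * (a N * (p N * p (N + 1))) +
            a N * (P N / P (N + 1)) * p (N + 1) ^ 2 =
            a N * (p (N + 1) * P N - p N * P (N + 1)) ^ 2 / (P N * P (N + 1)) := by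
            field_simp
            ring
          rw [e2]
          by_cases hs : P N * P (N + 1) ≤ 0
          · rw [hp N ⟨hN, hs⟩, sub_self]
            simp
          · have := not_le.1 hs
            positivity
        rw [e]
        linarith

/-- Beyond the last sign change the quotient P_{N+1}/P_N in Picone's bound is nonnegative. Each sign
change thus costs one linear condition on p. -/
theorem IsJacobiSol.jacobiForm_nonneg {a b P : ℕ → ℝ} (ha : ∀ n, 0 < a n) (h : IsJacobiSol a b P)
    (h0 : P 0 ≠ 0) (hfin : (signChanges P).Finite) {p : ℕ → ℝ}
    (hp : ∀ n ∈ signChanges P, p (n + 1) * P n = p n * P (n + 1)) :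
    ∀ᶠ N in atTop, 0 ≤ jacobiForm a b p N := by
  obtain ⟨M, hM⟩ := hfin.bddAbove
  filter_upwards [eventually_gt_atTop M] with N hN
  obtain ⟨h1, h2⟩ := h.picone ha h0 hp N
  refine le_trans ?_ h2
  by_cases hz : P N = 0
  · rw [h1 hz]
    simp
  · have h3 : N ∉ signChanges P := fun hs => absurd (hM hs) (by omega)
    have h4 : 0 < P N * P (N + 1) := by
      by_contra h5
      exact h3 ⟨hz, not_lt.1 h5⟩
    have h6 : 0 ≤ P (N + 1) / P N := by
      rw [show P (N + 1) / P N = P N * P (N + 1) / P N ^ 2 by field_simp]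
      positivity
    have := ha N
    positivity

/-! ### The recurrence for the values at the origin -/

/-- The off-diagonal entries `√(n+1)`. -/
noncomputable def offDiag (n : ℕ) : ℝ := √((n : ℝ) + 1)

/-- The diagonal entries `2μ√(n + 1/2 - E)`. -/
noncomputable def diag (μ E : ℝ) (n : ℕ) : ℝ := 2 * μ * √((n : ℝ) + 1 / 2 - E)

/-- Up to alternating signs, the values at the origin of a formal eigenvector. -/
noncomputable def eigenSol (μ E : ℝ) : ℕ → ℝ := jacobiSol offDiag (diag μ E)

theorem offDiag_pos (n : ℕ) : 0 < offDiag n := by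
  unfold offDiag
  positivity

theorem eigenSol_isJacobiSol (μ E : ℝ) : IsJacobiSol offDiag (diag μ E) (eigenSol μ E) :=
  jacobiSol_isJacobiSol offDiag_pos _

theorem eigenSol_zero (μ E : ℝ) : eigenSol μ E 0 = 1 := by
  unfold eigenSol
  rw [jacobiSol]

theorem jump_alternating {α : ℝ} (hα : 0 < α) (c : ℂ) (E : ℝ) (n : ℕ) :
    jump α (fun n => c * ((-1) ^ n * (eigenSol (√2 / α) E n : ℂ))) n =
      -2 * (√(n + 1 / 2 - E) : ℂ) * (c * ((-1) ^ n * (eigenSol (√2 / α) E n : ℂ))) := by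
  have h2 : (√2 : ℝ) ≠ 0 := by positivity
  obtain ⟨h0, h1⟩ := eigenSol_isJacobiSol (√2 / α) E
  simp only [offDiag, diag] at h0 h1
  have e : ((α / √2 : ℝ) : ℂ) * ((√2 / α : ℝ) : ℂ) = 1 := by
    rw [← Complex.ofReal_mul]
    rw [show α / √2 * (√2 / α) = 1 by field_simp]
    simp
  rcases n with _ | n
  · have h0' := congrArg (fun x : ℝ => (x : ℂ)) h0
    simp only [jump]
    push_cast at h0' e ⊢
    simp only [Real.sqrt_zero, Complex.ofReal_zero, zero_mul, add_zero, zero_add, pow_zero, pow_one,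
      one_mul] at h0' ⊢
    linear_combination (c * ((α : ℂ) / (√2 : ℝ))) * h0' -
      2 * c * (√(1 / 2 - E) : ℝ) * (eigenSol (√2 / α) E 0 : ℂ) * e
  · have h1' := congrArg (fun x : ℝ => (x : ℂ)) (h1 n)
    simp only [jump, Nat.add_sub_cancel]
    push_cast at h1' e ⊢
    linear_combination (-c * (-1) ^ n * ((α : ℂ) / (√2 : ℝ))) * h1' +
      2 * c * (-1) ^ n * (√((n : ℝ) + 1 + 1 / 2 - E) : ℝ) * (eigenSol (√2 / α) E (n + 1) : ℂ) * e

theorem trace_eq_eigenSol {α E : ℝ} (hα : 0 < α) (hE : E < 1 / 2) {U : H}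
    (h : U ∈ eigenspace (A α) (E : ℂ)) {C : ℕ → ℂ} (hC : IsTrace U C) (n : ℕ) :
    C n = C 0 * ((-1) ^ n * (eigenSol (√2 / α) E n : ℂ)) := by
  have hα2 : ((α / √2 : ℝ) : ℂ) ≠ 0 := by
    rw [Complex.ofReal_ne_zero]
    positivity
  have hj : ∀ n, jump α C n = -2 * (√(n + 1 / 2 - E) : ℂ) * C n := fun n =>
    (eigenvector_component h hC n).1 (by
      have : (0 : ℝ) ≤ n := by positivity
      linarith)
  set D : ℕ → ℂ := fun n => C 0 * ((-1) ^ n * (eigenSol (√2 / α) E n : ℂ)) with hD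
  have hjD : ∀ n, jump α D n = -2 * (√(n + 1 / 2 - E) : ℂ) * D n := jump_alternating hα (C 0) E
  have hstep : ∀ n, C n = D n → C (n - 1) = D (n - 1) → C (n + 1) = D (n + 1) := by
    intro n h1 h2
    have h3 : jump α C n = jump α D n := by rw [hj, hjD, h1]
    rw [jump, jump, h2] at h3
    have h4 : ((√((n : ℝ) + 1) : ℝ) : ℂ) ≠ 0 := by
      rw [Complex.ofReal_ne_zero]
      positivity
    exact mul_left_cancel₀ h4 (add_right_cancel (mul_left_cancel₀ hα2 h3))
  have h00 : C 0 = D 0 := by simp [hD, eigenSol_zero]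
  have hall : ∀ n, C n = D n ∧ C (n + 1) = D (n + 1) := by
    intro n
    induction n with
    | zero => exact ⟨h00, hstep 0 h00 h00⟩
    | succ n ih => exact ⟨ih.2, hstep (n + 1) ih.2 ih.1⟩
  exact (hall n).1

theorem norm_alternating (c : ℂ) (x : ℝ) (n : ℕ) : ‖c * ((-1) ^ n * (x : ℂ))‖ ^ 2 = ‖c‖ ^ 2 * x ^ 2 := by
  rw [norm_mul, norm_mul, norm_pow, norm_neg, norm_one, one_pow, one_mul, Complex.norm_real,
    Real.norm_eq_abs, mul_pow, sq_abs]

/-- The eigenvalues below `1/2` are those `E` for which the solution of the recurrence is square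
summable with weight `(n+1)^{-1/2}`. -/
theorem mem_pointSpectrum_iff {α E : ℝ} (hα : 0 < α) (hE : E < 1 / 2) :
    (E : ℂ) ∈ pointSpectrum (A α) ↔
      Summable fun n : ℕ => eigenSol (√2 / α) E n ^ 2 / √((n : ℝ) + 1) := by
  constructor
  · rintro ⟨U, hU, hne⟩
    obtain ⟨C, hC⟩ := (actsAs_of_mem_eigenspace hU).exists_isTrace
    have hC0 : C 0 ≠ 0 := fun h0 => hne (trace_eq_zero_of_first hα hU hC h0)
    have h1 := (actsAs_of_mem_eigenspace hU).summable_trace hC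
    have h2 : 0 < ‖C 0‖ ^ 2 := by
      have := norm_pos_iff.2 hC0
      positivity
    refine (h1.mul_left (1 / ‖C 0‖ ^ 2)).congr fun n => ?_
    rw [trace_eq_eigenSol hα hE hU hC n, norm_alternating]
    field_simp
  · intro h
    refine exists_eigenvector (C := fun n => 1 * ((-1) ^ n * (eigenSol (√2 / α) E n : ℂ))) hE ?_
      (fun n => (jump_alternating hα 1 E n).symm) ⟨0, by simp [eigenSol_zero]⟩
    simpa [norm_alternating] using h

/-! ### An upper bound for the number of eigenvalues -/

/-- The form is real at U + tV for every complex t; expanding leaves (E - E') Im(t(U,V)) = 0, and t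
= 1, i are enough. -/
theorem inner_eigenvectors_eq_zero {α E E' : ℝ} {U V : H} (hU : U ∈ eigenspace (A α) (E : ℂ))
    (hV : V ∈ eigenspace (A α) (E' : ℂ)) (hne : E ≠ E') : inner ℂ U V = 0 := by
  have key : ∀ t : ℂ, (t * inner ℂ U V).im = 0 := by
    intro t
    have h1 := ((actsAs_of_mem_eigenspace hU).add
      ((actsAs_of_mem_eigenspace hV).const_smul t)).im_inner_eq_zero
    have e1 : (inner ℂ U U : ℂ).im = 0 := inner_self_im (𝕜 := ℂ) U
    have e2 : (inner ℂ V V : ℂ).im = 0 := inner_self_im (𝕜 := ℂ) V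
    have e3 : (inner ℂ V U : ℂ) = (starRingEnd ℂ) (inner ℂ U V) := (inner_conj_symm V U).symm
    simp only [inner_add_left, inner_add_right, inner_smul_left, inner_smul_right,
      Complex.conj_ofReal, e3] at h1
    simp only [Complex.add_im, Complex.add_re, Complex.mul_im, Complex.mul_re, Complex.conj_re, Complex.conj_im,
      Complex.ofReal_re, Complex.ofReal_im, e1, e2] at h1
    have h2 : (E - E') * (t * inner ℂ U V).im = 0 := by
      rw [Complex.mul_im]
      linear_combination h1
    exact (mul_eq_zero.1 h2).resolve_left (sub_ne_zero.2 hne)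
  have h1 := key 1
  have h2 := key Complex.I
  apply Complex.ext
  · simpa using h2
  · simpa using h1

/-- With more eigenvalues than conditions, some nonzero real combination of eigenvectors satisfies
all conditions. Its form is at least ‖V‖²/2 by the hypothesis, yet strictly smaller because all the
eigenvalues are below 1/2. -/
theorem card_eigenvalues_le {α : ℝ} (hα : 0 < α) {ι : Type*} [Fintype ι]
    (ℓ : ι → (ℕ → ℝ) →ₗ[ℝ] ℝ)
    (hℓ : ∀ D : ℕ → ℝ, (∀ i, ℓ i D = 0) →
      ∀ᶠ N in atTop, 0 ≤ jacobiForm offDiag (diag (√2 / α) (1 / 2)) D N)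
    (s : Finset ℝ) (hs : ∀ E ∈ s, E < 1 / 2 ∧ (E : ℂ) ∈ pointSpectrum (A α)) :
    s.card ≤ Fintype.card ι := by
  by_contra hlt
  rw [not_le] at hlt
  have hex : ∀ E : s, ∃ U : H, U ∈ eigenspace (A α) ((E : ℝ) : ℂ) ∧ U ≠ 0 ∧
      IsTrace U (fun n => (-1) ^ n * (eigenSol (√2 / α) E n : ℂ)) := by
    intro E
    obtain ⟨hE, U, hU, hne⟩ := hs E E.2
    obtain ⟨C, hC⟩ := (actsAs_of_mem_eigenspace hU).exists_isTrace
    have hC0 : C 0 ≠ 0 := fun h0 => hne (trace_eq_zero_of_first hα hU hC h0)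
    -- Normalizing the first trace to 1 makes all traces real, so that real linear conditions
    -- suffice.
    refine ⟨(C 0)⁻¹ • U, Submodule.smul_mem _ _ hU, smul_ne_zero (inv_ne_zero hC0) hne, ?_⟩
    have h1 := hC.smul (C 0)⁻¹
    have h2 : ((C 0)⁻¹ • C) = fun n => (-1) ^ n * (eigenSol (√2 / α) E n : ℂ) := by
      funext n
      rw [Pi.smul_apply, trace_eq_eigenSol hα hE hU hC n, smul_eq_mul]
      field_simp
    rwa [h2] at h1
  choose U hU hne hT using hex
  let T : (s → ℝ) →ₗ[ℝ] (ι → ℝ) := LinearMap.pi fun i =>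
    (ℓ i).comp (Fintype.linearCombination ℝ fun E : s => eigenSol (√2 / α) E)
  have hker : LinearMap.ker T ≠ ⊥ := LinearMap.ker_ne_bot_of_finrank_lt (by simpa using hlt)
  obtain ⟨c, hc, hc0⟩ := (Submodule.ne_bot_iff _).1 hker
  set D : ℕ → ℝ := Fintype.linearCombination ℝ (fun E : s => eigenSol (√2 / α) E) c with hD
  have hDℓ : ∀ i, ℓ i D = 0 := fun i => congrFun (LinearMap.mem_ker.1 hc) i
  have hDn : ∀ n, D n = ∑ E : s, c E * eigenSol (√2 / α) E n := fun n => by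
    simp [hD, Fintype.linearCombination_apply]
  set V : H := ∑ E : s, (c E : ℂ) • U E with hV
  set F : H := ∑ E : s, (c E : ℂ) • (((E : ℝ) : ℂ) • U E) with hF
  have hact : ActsAs α V F := by
    have : ((V, F) : H × H) ∈ (A α).graph := by
      have e : ((V, F) : H × H) = ∑ E : s, (c E : ℂ) • ((U E, ((E : ℝ) : ℂ) • U E) : H × H) := by
        simp only [Prod.smul_mk]
        rw [Prod.ext_iff]
        simp only [Prod.fst_sum, Prod.snd_sum]
        exact ⟨hV, hF⟩
      rw [e]
      exact Submodule.sum_mem _ fun E _ => Submodule.smul_mem _ _ (hU E)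
    exact (mem_graph_iff α _ _).1 this
  have htr : IsTrace V (fun n => (-1) ^ n * (D n : ℂ)) := by
    have h1 := IsTrace.sum Finset.univ fun (E : s) _ => (hT E).smul (c E : ℂ)
    have h2 : (∑ E : s, (c E : ℂ) • fun n : ℕ => (-1 : ℂ) ^ n * (eigenSol (√2 / α) E n : ℂ)) =
        fun n => (-1) ^ n * (D n : ℂ) := by
      funext n
      rw [Finset.sum_apply, hDn]
      push_cast
      rw [Finset.mul_sum]
      refine Finset.sum_congr rfl fun E _ => ?_
      simp only [Pi.smul_apply, smul_eq_mul]
      ring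
    rwa [h2] at h1
  have hlow := hact.le_re_inner htr le_rfl (by
    filter_upwards [hℓ D hDℓ] with N hN
    have hμ : 0 < α / √2 := by positivity
    have e : (∑ n ∈ Finset.range (N + 1),
        2 * √((n : ℝ) + 1 / 2 - 1 / 2) * ‖(-1 : ℂ) ^ n * (D n : ℂ)‖ ^ 2) + α / √2 *
        ∑ n ∈ Finset.range N, 2 * √((n : ℝ) + 1) * ((starRingEnd ℂ)
          ((-1 : ℂ) ^ (n + 1) * (D (n + 1) : ℂ)) * ((-1 : ℂ) ^ n * (D n : ℂ))).re =
        α / √2 * jacobiForm offDiag (diag (√2 / α) (1 / 2)) D N := by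
      rw [jacobiForm, mul_sub, Finset.mul_sum, Finset.mul_sum, Finset.mul_sum, Finset.mul_sum,
        sub_eq_add_neg, ← Finset.sum_neg_distrib]
      congr 1
      · refine Finset.sum_congr rfl fun n _ => ?_
        have h3 := norm_alternating 1 (D n) n
        rw [one_mul, norm_one, one_pow, one_mul] at h3
        rw [h3, diag]
        field_simp
      · refine Finset.sum_congr rfl fun n _ => ?_
        have h3 : (starRingEnd ℂ) ((-1 : ℂ) ^ (n + 1) * (D (n + 1) : ℂ)) * ((-1 : ℂ) ^ n * (D n : ℂ)) =
            ((-(D n * D (n + 1)) : ℝ) : ℂ) := by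
          have h4 : ((-1 : ℂ) ^ n) * (-1) ^ n = 1 := by
            rw [← mul_pow]
            norm_num
          simp only [map_mul, map_pow, map_neg, map_one, Complex.conj_ofReal]
          push_cast
          linear_combination (-(D (n + 1) : ℂ) * D n) * h4
        rw [h3, Complex.ofReal_re, offDiag]
        ring
    rw [e]
    positivity)
  have horth : ∀ E E' : s, E ≠ E' → inner ℂ (U E) (U E') = 0 := fun E E' h =>
    inner_eigenvectors_eq_zero (hU E) (hU E') fun h' => h (Subtype.ext h')
  have hin : ∀ w : s → ℂ, inner ℂ (∑ E : s, w E • U E) V =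
      ∑ E : s, (starRingEnd ℂ) (w E) * (c E * (‖U E‖ ^ 2 : ℝ)) := by
    intro w
    rw [hV, sum_inner]
    refine Finset.sum_congr rfl fun E _ => ?_
    rw [inner_smul_left, inner_sum, Finset.sum_eq_single E]
    · rw [inner_smul_right, inner_self_eq_norm_sq_to_K]
      push_cast
      rfl
    · intro E' _ h'
      rw [inner_smul_right, horth E E' h'.symm, mul_zero]
    · simp
  have hVV : ‖V‖ ^ 2 = ∑ E : s, c E ^ 2 * ‖U E‖ ^ 2 := by
    have h1 := hin (fun E => (c E : ℂ))
    rw [← hV, inner_self_eq_norm_sq_to_K] at h1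
    have h2 : ((‖V‖ ^ 2 : ℝ) : ℂ) = ((∑ E : s, c E ^ 2 * ‖U E‖ ^ 2 : ℝ) : ℂ) := by
      push_cast
      refine Eq.trans ?_ (h1.trans ?_)
      · rfl
      · refine Finset.sum_congr rfl fun E _ => ?_
        rw [Complex.conj_ofReal]
        push_cast
        ring
    exact_mod_cast h2
  have hFV : (inner ℂ F V).re = ∑ E : s, (E : ℝ) * (c E ^ 2 * ‖U E‖ ^ 2) := by
    have h1 := hin (fun E => (c E : ℂ) * ((E : ℝ) : ℂ))
    simp only [mul_smul] at h1
    rw [← hF] at h1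
    rw [h1]
    have h2 : ∑ E : s, (starRingEnd ℂ) ((c E : ℂ) * ((E : ℝ) : ℂ)) * (c E * (‖U E‖ ^ 2 : ℝ)) =
        ((∑ E : s, (E : ℝ) * (c E ^ 2 * ‖U E‖ ^ 2) : ℝ) : ℂ) := by
      push_cast
      refine Finset.sum_congr rfl fun E _ => ?_
      rw [map_mul, Complex.conj_ofReal, Complex.conj_ofReal]
      ring
    rw [h2, Complex.ofReal_re]
  rw [hVV, hFV, Finset.mul_sum] at hlow
  have hstrict : ∑ E : s, (E : ℝ) * (c E ^ 2 * ‖U E‖ ^ 2) < ∑ E : s, 1 / 2 * (c E ^ 2 * ‖U E‖ ^ 2) := by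
    have hcE : ∃ E, c E ≠ 0 := by
      by_contra! hall
      exact hc0 (funext hall)
    obtain ⟨E₀, hE₀⟩ := hcE
    refine Finset.sum_lt_sum (fun E _ => ?_) ⟨E₀, Finset.mem_univ _, ?_⟩
    · exact mul_le_mul_of_nonneg_right (hs E E.2).1.le (by positivity)
    · have h1 := norm_pos_iff.2 (hne E₀)
      exact mul_lt_mul_of_pos_right (hs E₀ E₀.2).1 (by positivity)
  linarith

/-! ### Growing and decaying solutions -/

section Growth

variable {a b P : ℕ → ℝ} {μ : ℝ} {n₀ : ℕ}

/-- The absolute value of `P` does not decrease from `n` to `n + 1`. -/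
def GrowsAt (P : ℕ → ℝ) (n : ℕ) : Prop := P n ^ 2 ≤ P (n + 1) ^ 2 ∧ P (n + 1) ≠ 0

/-- Diagonal dominance b_{n+1} ≥ a_n + a_{n+1} propagates growth: once |P| fails to decrease, the
next step keeps the sign and does not decrease either. This gives the alternative between growth
forever and decay. -/
theorem IsJacobiSol.sq_le_mul_of_growsAt (ha : ∀ n, 0 < a n) (h : IsJacobiSol a b P) {n : ℕ}
    (hb : a n + a (n + 1) ≤ b (n + 1)) (hg : GrowsAt P n) :
    P (n + 1) ^ 2 ≤ P (n + 1) * P (n + 2) := by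
  have h1 := h.2 n
  have h2 : a (n + 1) * (P (n + 1) * P (n + 2)) = b (n + 1) * P (n + 1) ^ 2 -
      a n * (P n * P (n + 1)) := by linear_combination -P (n + 1) * h1
  have h3 : P n * P (n + 1) ≤ P (n + 1) ^ 2 := by nlinarith [sq_nonneg (P n - P (n + 1)), hg.1]
  have h4 : (a n + a (n + 1)) * P (n + 1) ^ 2 ≤ b (n + 1) * P (n + 1) ^ 2 :=
    mul_le_mul_of_nonneg_right hb (sq_nonneg _)
  have h5 : a n * (P n * P (n + 1)) ≤ a n * P (n + 1) ^ 2 :=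
    mul_le_mul_of_nonneg_left h3 (ha n).le
  have h6 : a (n + 1) * P (n + 1) ^ 2 ≤ a (n + 1) * (P (n + 1) * P (n + 2)) := by linarith
  exact le_of_mul_le_mul_left h6 (ha _)

theorem sq_le_sq_of_sq_le_mul {x y : ℝ} (h : x ^ 2 ≤ x * y) : x ^ 2 ≤ y ^ 2 := by
  nlinarith [sq_nonneg (x - y)]

theorem growsAt_succ_of_sq_le_mul {n : ℕ} (h0 : P (n + 1) ≠ 0)
    (h : P (n + 1) ^ 2 ≤ P (n + 1) * P (n + 2)) : GrowsAt P (n + 1) := by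
  refine ⟨sq_le_sq_of_sq_le_mul h, fun hz => ?_⟩
  rw [show n + 1 + 1 = n + 2 from rfl] at hz
  rw [hz, mul_zero] at h
  have : 0 < P (n + 1) ^ 2 := by positivity
  linarith

theorem IsJacobiSol.growsAt_of_le (ha : ∀ n, 0 < a n) (h : IsJacobiSol a b P)
    (hb : ∀ n, n₀ ≤ n → a n + a (n + 1) ≤ b (n + 1)) {n m : ℕ} (hn : n₀ ≤ n) (hg : GrowsAt P n)
    (hm : n ≤ m) : GrowsAt P m := by
  induction m, hm using Nat.le_induction with
  | base => exact hg
  | succ m hm ih =>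
    exact growsAt_succ_of_sq_le_mul ih.2 (h.sq_le_mul_of_growsAt ha (hb m (hn.trans hm)) ih)

theorem IsJacobiSol.notMem_signChanges_of_growsAt (ha : ∀ n, 0 < a n) (h : IsJacobiSol a b P)
    (hb : ∀ n, n₀ ≤ n → a n + a (n + 1) ≤ b (n + 1)) {n m : ℕ} (hn : n₀ ≤ n) (hg : GrowsAt P n)
    (hm : n + 1 ≤ m) : m ∉ signChanges P := by
  obtain ⟨m, rfl⟩ : ∃ k, m = k + 1 := ⟨m - 1, by omega⟩
  have hg' := h.growsAt_of_le ha hb hn hg (show n ≤ m by omega)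
  have h1 := h.sq_le_mul_of_growsAt ha (hb m (by omega)) hg'
  rintro ⟨h2, h3⟩
  have : 0 < P (m + 1) ^ 2 := by positivity
  rw [show m + 1 + 1 = m + 2 from rfl] at h3
  linarith

theorem IsJacobiSol.sq_ge_of_growsAt (ha : ∀ n, 0 < a n) (h : IsJacobiSol a b P)
    (hb : ∀ n, n₀ ≤ n → a n + a (n + 1) ≤ b (n + 1)) {n m : ℕ} (hn : n₀ ≤ n) (hg : GrowsAt P n)
    (hm : n + 1 ≤ m) : P (n + 1) ^ 2 ≤ P m ^ 2 := by
  induction m, hm using Nat.le_induction with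
  | base => exact le_rfl
  | succ m hm ih => exact ih.trans (h.growsAt_of_le ha hb hn hg (by omega)).1

theorem not_summable_of_sq_ge {c : ℝ} (hc : 0 < c) {M : ℕ} (h : ∀ m, M ≤ m → c ≤ P m ^ 2) :
    ¬ Summable fun n : ℕ => P n ^ 2 / √((n : ℝ) + 1) := by
  intro hs
  have h1 : Summable fun n : ℕ => (√((n : ℝ) + 1) * c / √((n : ℝ) + 1)) / ((n : ℝ) + 1) := by
    refine Summable.of_norm_bounded_eventually_nat hs ?_
    filter_upwards [eventually_ge_atTop M] with n hn
    have h2 : (0 : ℝ) < √((n : ℝ) + 1) := by positivity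
    have h3 : √((n : ℝ) + 1) ≤ (n : ℝ) + 1 := by
      rw [Real.sqrt_le_left (by positivity)]
      have : (0 : ℝ) ≤ n := by positivity
      nlinarith
    rw [Real.norm_of_nonneg (by positivity), mul_div_assoc, mul_div_cancel₀ _ h2.ne']
    calc c / ((n : ℝ) + 1) ≤ c / √((n : ℝ) + 1) := by gcongr
      _ ≤ _ := by
        have := h n hn
        gcongr
  have h2 : ∀ n : ℕ, √((n : ℝ) + 1) * c / √((n : ℝ) + 1) = c := fun n => by
    have : (0 : ℝ) < √((n : ℝ) + 1) := by positivity
    field_simp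
  simp only [h2] at h1
  exact (frequently_lt_of_summable_div h1 hc).exists.elim fun n hn => lt_irrefl _ hn

theorem IsJacobiSol.not_summable_of_growsAt (ha : ∀ n, 0 < a n) (h : IsJacobiSol a b P)
    (hb : ∀ n, n₀ ≤ n → a n + a (n + 1) ≤ b (n + 1)) {n : ℕ} (hn : n₀ ≤ n) (hg : GrowsAt P n) :
    ¬ Summable fun n : ℕ => P n ^ 2 / √((n : ℝ) + 1) :=
  not_summable_of_sq_ge (c := P (n + 1) ^ 2) (M := n + 1) (by have := hg.2; positivity)
    fun _ hm => h.sq_ge_of_growsAt ha hb hn hg hm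

/-- After a sign change the term a_n P_n P_{n+1} is nonpositive and helps the diagonal, so |P|
starts to grow. -/
theorem IsJacobiSol.growsAt_of_mem_signChanges (ha : ∀ n, 0 < a n) (h : IsJacobiSol a b P)
    (h0 : P 0 ≠ 0) {n : ℕ} (hb : a n + a (n + 1) ≤ b (n + 1)) (hs : n ∈ signChanges P) :
    GrowsAt P (n + 1) := by
  by_cases hz : P (n + 1) = 0
  · have h1 := (h.ne_zero_or ha h0 (n + 1)).resolve_left (by simpa using hz)
    exact ⟨by simpa [hz] using sq_nonneg (P (n + 1 + 1)), h1⟩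
  · refine growsAt_succ_of_sq_le_mul hz ?_
    have h1 := h.2 n
    have h2 : a (n + 1) * (P (n + 1) * P (n + 2)) = b (n + 1) * P (n + 1) ^ 2 -
        a n * (P n * P (n + 1)) := by linear_combination -P (n + 1) * h1
    have h3 := ha n
    have h4 : a (n + 1) * P (n + 1) ^ 2 ≤ b (n + 1) * P (n + 1) ^ 2 :=
      mul_le_mul_of_nonneg_right (by linarith) (sq_nonneg _)
    have h5 := mul_nonpos_of_nonneg_of_nonpos h3.le hs.2
    exact le_of_mul_le_mul_left (show a (n + 1) * P (n + 1) ^ 2 ≤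
      a (n + 1) * (P (n + 1) * P (n + 2)) by linarith) (ha _)

/-- A sign change in the dominated region starts permanent growth without further sign changes, so
there is at most one. -/
theorem IsJacobiSol.eq_of_mem_signChanges (ha : ∀ n, 0 < a n) (h : IsJacobiSol a b P)
    (h0 : P 0 ≠ 0) (hb : ∀ n, n₀ ≤ n → a n + a (n + 1) ≤ b (n + 1)) {n m : ℕ} (hn : n₀ ≤ n)
    (hm : n₀ ≤ m) (hsn : n ∈ signChanges P) (hsm : m ∈ signChanges P) : n = m := by
  have key : ∀ n m, n₀ ≤ n → n ∈ signChanges P → m ∈ signChanges P → ¬ n < m := by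
    intro n m hn hsn hsm hlt
    have hg := h.growsAt_of_mem_signChanges ha h0 (hb n hn) hsn
    rcases (show n + 1 ≤ m from hlt).eq_or_lt with rfl | hlt'
    · by_cases hz : P (n + 1) = 0
      · exact hsm.1 hz
      · have h1 := h.2 n
        have h2 : a (n + 1) * (P (n + 1) * P (n + 2)) = b (n + 1) * P (n + 1) ^ 2 -
            a n * (P n * P (n + 1)) := by linear_combination -P (n + 1) * h1
        have h3 := mul_nonpos_of_nonneg_of_nonpos (ha n).le hsn.2
        have h4 : 0 < b (n + 1) * P (n + 1) ^ 2 := by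
          have := hb n hn
          have := ha n
          have := ha (n + 1)
          have : 0 < b (n + 1) := by linarith
          positivity
        have h5 := mul_nonpos_of_nonneg_of_nonpos (ha (n + 1)).le hsm.2
        rw [show n + 1 + 1 = n + 2 from rfl] at h5
        linarith
    · exact h.notMem_signChanges_of_growsAt ha hb (by omega) hg hlt' hsm
  rcases lt_trichotomy n m with hlt | heq | hlt
  · exact absurd hlt (key n m hn hsn hsm)
  · exact heq
  · exact absurd hlt (key m n hm hsm hsn)

theorem IsJacobiSol.finite_signChanges (ha : ∀ n, 0 < a n) (h : IsJacobiSol a b P)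
    (h0 : P 0 ≠ 0) (hb : ∀ n, n₀ ≤ n → a n + a (n + 1) ≤ b (n + 1)) : (signChanges P).Finite := by
  have h1 : (signChanges P ∩ Ici n₀).Subsingleton := fun n hn m hm =>
    h.eq_of_mem_signChanges ha h0 hb hn.2 hm.2 hn.1 hm.1
  refine ((finite_Iio n₀).union h1.finite).subset fun n hn => ?_
  rcases lt_or_ge n n₀ with h2 | h2
  · exact Or.inl h2
  · exact Or.inr ⟨hn, h2⟩

/-- If |P| always decreases, then b|P_{n+1}| ≤ a_{n+1}|P_{n+2}| + a_n|P_n| together with |P_{n+2}| ≤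
|P_{n+1}| gives μ|P_{n+1}| ≤ |P_n|. The excess μ > 1 in the dominance is the geometric rate. -/
theorem IsJacobiSol.decays (ha : ∀ n, 0 < a n) (h : IsJacobiSol a b P)
    (h0 : P 0 ≠ 0) (hμ : 1 < μ) (hb : ∀ n, n₀ ≤ n → μ * a n + a (n + 1) ≤ b (n + 1))
    (hng : ∀ n, n₀ ≤ n → ¬ GrowsAt P n) :
    (∀ n, n₀ ≤ n → P n ≠ 0) ∧ (∀ n, n₀ ≤ n → n ∉ signChanges P) ∧
      Summable fun n : ℕ => P n ^ 2 / √((n : ℝ) + 1) := by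
  have hlt : ∀ n, n₀ ≤ n → P (n + 1) ^ 2 < P n ^ 2 := by
    intro n hn
    by_contra hc
    have hc := not_lt.1 hc
    by_cases hz : P (n + 1) = 0
    · have h1 := (h.ne_zero_or ha h0 n).resolve_right (by simpa using hz)
      rw [hz] at hc
      norm_num at hc
      exact h1 hc
    · exact hng n hn ⟨hc, hz⟩
  have hne : ∀ n, n₀ ≤ n → P n ≠ 0 := by
    intro n hn hz
    have := hlt n hn
    rw [hz] at this
    have h2 := sq_nonneg (P (n + 1))
    norm_num at this
    linarith
  have hb' : ∀ n, n₀ ≤ n → a n + a (n + 1) ≤ b (n + 1) := fun n hn => by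
    have := hb n hn
    have := ha n
    nlinarith
  refine ⟨hne, fun n hn hs => ?_, ?_⟩
  · exact hng (n + 1) (by omega) (h.growsAt_of_mem_signChanges ha h0 (hb' n hn) hs)
  · have hstep : ∀ n, n₀ ≤ n → μ * |P (n + 1)| ≤ |P n| := by
      intro n hn
      have h1 := h.2 n
      have h2 : |P (n + 2)| ≤ |P (n + 1)| := sq_le_sq.1 (hlt (n + 1) (by omega)).le
      have h3 : b (n + 1) * |P (n + 1)| ≤ a (n + 1) * |P (n + 2)| + a n * |P n| := by
        have h4 : 0 ≤ b (n + 1) := by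
          have := hb' n hn
          have := ha n
          have := ha (n + 1)
          linarith
        calc b (n + 1) * |P (n + 1)| = |b (n + 1) * P (n + 1)| := by
              rw [abs_mul, abs_of_nonneg h4]
          _ = |a (n + 1) * P (n + 2) + a n * P n| := by rw [h1]
          _ ≤ |a (n + 1) * P (n + 2)| + |a n * P n| := abs_add_le _ _
          _ = _ := by rw [abs_mul, abs_mul, abs_of_pos (ha n), abs_of_pos (ha (n + 1))]
      have h5 := mul_le_mul_of_nonneg_left h2 (ha (n + 1)).le
      have h6 := mul_le_mul_of_nonneg_right (hb n hn) (abs_nonneg (P (n + 1)))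
      have h7 : a n * (μ * |P (n + 1)|) ≤ a n * |P n| := by linarith
      exact le_of_mul_le_mul_left h7 (ha n)
    have hgeo : ∀ k, |P (n₀ + k)| ≤ |P n₀| * (1 / μ) ^ k := by
      intro k
      induction k with
      | zero => simp
      | succ k ih =>
        have h1 := hstep (n₀ + k) (by omega)
        have h2 : |P (n₀ + (k + 1))| ≤ 1 / μ * |P (n₀ + k)| := by
          rw [one_div_mul_eq_div, le_div_iff₀ (by linarith), mul_comm]
          exact h1
        calc _ ≤ 1 / μ * |P (n₀ + k)| := h2
          _ ≤ 1 / μ * (|P n₀| * (1 / μ) ^ k) := by gcongr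
          _ = _ := by ring
    refine (summable_nat_add_iff n₀).1 ?_
    have hr : (1 / μ) ^ 2 < 1 := by
      rw [one_div, inv_pow]
      exact inv_lt_one_of_one_lt₀ (by nlinarith)
    refine Summable.of_nonneg_of_le (fun k => by positivity) (fun k => ?_)
      ((summable_geometric_of_lt_one (by positivity) hr).mul_left (|P n₀| ^ 2))
    have h1 : (1 : ℝ) ≤ √(((k + n₀ : ℕ) : ℝ) + 1) := by
      rw [Real.one_le_sqrt]
      have : (0 : ℝ) ≤ ((k + n₀ : ℕ) : ℝ) := by positivity
      linarith
    calc P (k + n₀) ^ 2 / √(((k + n₀ : ℕ) : ℝ) + 1) ≤ P (k + n₀) ^ 2 :=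
          div_le_self (sq_nonneg _) h1
      _ = |P (n₀ + k)| ^ 2 := by rw [sq_abs, add_comm]
      _ ≤ (|P n₀| * (1 / μ) ^ k) ^ 2 := by
          have := hgeo k
          gcongr
      _ = _ := by ring

end Growth

/-! ### Counting sign changes -/

open Classical in
/-- The number of sign changes along the first `N` edges. -/
noncomputable def signCount (P : ℕ → ℝ) (N : ℕ) : ℕ :=
  ∑ n ∈ Finset.range N, if n ∈ signChanges P then 1 else 0

theorem signCount_eq_ncard {P : ℕ → ℝ} {N : ℕ} (h : ∀ n, N ≤ n → n ∉ signChanges P) :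
    (signChanges P).ncard = signCount P N := by
  classical
  have : signChanges P = (((Finset.range N).filter (· ∈ signChanges P) : Finset ℕ) : Set ℕ) := by
    ext n
    simp only [Finset.coe_filter, Finset.mem_range, mem_ofPred_eq]
    constructor
    · intro hn
      refine ⟨?_, hn⟩
      by_contra hc
      exact h n (not_lt.1 hc) hn
    · exact fun hn => hn.2
  conv_lhs => rw [this]
  rw [ncard_coe_finset, Finset.card_filter, signCount]

theorem signCount_le_ncard {P : ℕ → ℝ} (hf : (signChanges P).Finite) (N : ℕ) :
    signCount P N ≤ (signChanges P).ncard := by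
  classical
  rw [signCount, ← Finset.card_filter, ← ncard_coe_finset]
  refine ncard_le_ncard (fun n hn => ?_) hf
  simp only [Finset.coe_filter, Finset.mem_range, mem_ofPred_eq] at hn
  exact hn.2

theorem ncard_le_signCount_succ {P : ℕ → ℝ} {N : ℕ}
    (h : ∀ n m, N ≤ n → N ≤ m → n ∈ signChanges P → m ∈ signChanges P → n = m) :
    (signChanges P).ncard ≤ signCount P N + 1 := by
  classical
  have h1 : signChanges P ⊆ (((Finset.range N).filter (· ∈ signChanges P) : Finset ℕ) : Set ℕ) ∪
      (signChanges P ∩ Ici N) := by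
    intro n hn
    rcases lt_or_ge n N with h2 | h2
    · left
      simp [h2, hn]
    · exact Or.inr ⟨hn, h2⟩
  have h2 : (signChanges P ∩ Ici N).Subsingleton := fun n hn m hm => h n m hn.2 hm.2 hn.1 hm.1
  have h3 : (signChanges P ∩ Ici N).ncard ≤ 1 := by
    rw [ncard_le_one h2.finite]
    exact fun n hn m hm => h2 hn hm
  refine (ncard_le_ncard h1 ((Finset.finite_toSet _).union h2.finite)).trans
    ((ncard_union_le _ _).trans ?_)
  rw [ncard_coe_finset, Finset.card_filter]
  exact Nat.add_le_add_left h3 _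

/-- Two adjacent terms never vanish together, and at an interior zero the neighbours have opposite
signs. The two edges around such a zero therefore carry exactly one sign change for every nearby
parameter, so the truncated count is locally constant when its last term is nonzero. -/
theorem eventually_signCount_eq {X : Type*} [TopologicalSpace X] {a : ℕ → ℝ} {b P : X → ℕ → ℝ}
    (ha : ∀ n, 0 < a n) (hP : ∀ x, IsJacobiSol a (b x) (P x)) (h0 : ∀ x, P x 0 ≠ 0)
    (hc : ∀ n, Continuous fun x => P x n) {x₀ : X} (N : ℕ) (hN : P x₀ N ≠ 0) :
    ∀ᶠ x in 𝓝 x₀, signCount (P x) N = signCount (P x₀) N := by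
  induction N using Nat.strong_induction_on with
  | _ N ih =>
  have hmulpos : ∀ m n, 0 < P x₀ m * P x₀ n → ∀ᶠ x in 𝓝 x₀, 0 < P x m * P x n := fun m n hmn =>
    ((hc m).mul (hc n)).continuousAt.eventually (lt_mem_nhds hmn)
  have hmulneg : ∀ m n, P x₀ m * P x₀ n < 0 → ∀ᶠ x in 𝓝 x₀, P x m * P x n < 0 := fun m n hmn =>
    ((hc m).mul (hc n)).continuousAt.eventually (gt_mem_nhds hmn)
  rcases N with _ | N
  · exact Eventually.of_forall fun x => by simp [signCount]
  by_cases hz : P x₀ N = 0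
  · rcases N with _ | N
    · exact absurd hz (h0 x₀)
    have hN1 : P x₀ N ≠ 0 := ((hP x₀).ne_zero_or ha (h0 x₀) N).resolve_right (by simpa using hz)
    -- The recurrence at the zero reads a_{N+1}P_{N+2} = -a_N P_N.
    have hneg : P x₀ N * P x₀ (N + 2) < 0 := by
      have h1 := (hP x₀).2 N
      rw [hz, mul_zero] at h1
      have h2 : a (N + 1) * (P x₀ N * P x₀ (N + 2)) = -(a N * P x₀ N ^ 2) := by
        linear_combination -P x₀ N * h1
      have h3 : 0 < a N * P x₀ N ^ 2 := by
        have := ha N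
        positivity
      by_contra hc'
      have h4 := mul_nonneg (ha (N + 1)).le (not_lt.1 hc')
      linarith
    have key : ∀ x, P x N * P x (N + 2) < 0 → signCount (P x) (N + 2) = signCount (P x) N + 1 := by
      intro x hx
      have hxN : P x N ≠ 0 := fun h => by rw [h, zero_mul] at hx; exact lt_irrefl _ hx
      have hxN2 : P x (N + 2) ≠ 0 := fun h => by rw [h, mul_zero] at hx; exact lt_irrefl _ hx
      simp only [signCount, Finset.sum_range_succ, add_assoc]
      congr 1
      by_cases h1 : P x N * P x (N + 1) ≤ 0
      · have hs1 : N ∈ signChanges (P x) := ⟨hxN, h1⟩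
        have hs2 : N + 1 ∉ signChanges (P x) := by
          rintro ⟨h2, h3⟩
          have h4 : P x N * P x (N + 1) < 0 := lt_of_le_of_ne h1 (mul_ne_zero hxN h2)
          have h5 : P x (N + 1) * P x (N + 2) < 0 := lt_of_le_of_ne h3 (mul_ne_zero h2 hxN2)
          have h6 := mul_pos_of_neg_of_neg h4 h5
          have h7 : 0 < P x (N + 1) ^ 2 := by positivity
          nlinarith
        simp [hs1, hs2]
      · have h1 := not_le.1 h1
        have hs1 : N ∉ signChanges (P x) := fun h => absurd h.2 (not_le.2 h1)
        have hxN1 : P x (N + 1) ≠ 0 := fun h => by rw [h, mul_zero] at h1; exact lt_irrefl _ h1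
        have hs2 : N + 1 ∈ signChanges (P x) := by
          refine ⟨hxN1, ?_⟩
          by_contra h2
          have h2 := not_le.1 h2
          have h6 := mul_pos h1 h2
          have h7 : 0 < P x (N + 1) ^ 2 := by positivity
          have h8 : P x N * P x (N + 1) * (P x (N + 1) * P x (N + 1 + 1)) =
            P x (N + 1) ^ 2 * (P x N * P x (N + 2)) := by ring_nf
          rw [h8] at h6
          have := mul_neg_of_pos_of_neg h7 hx
          linarith
        simp [hs1, hs2]
    filter_upwards [ih N (by omega) hN1, hmulneg N (N + 2) hneg] with x h1 h2
    rw [show N + 1 + 1 = N + 2 from rfl, key x h2, key x₀ hneg, h1]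
  · have hmul : P x₀ N * P x₀ (N + 1) ≠ 0 := mul_ne_zero hz hN
    rcases lt_or_gt_of_ne hmul with hneg | hpos
    · filter_upwards [ih N (by omega) hz, hmulneg N (N + 1) hneg] with x h1 h2
      have hx : N ∈ signChanges (P x) :=
        ⟨fun h => by rw [h, zero_mul] at h2; exact lt_irrefl _ h2, h2.le⟩
      have hx0 : N ∈ signChanges (P x₀) := ⟨hz, hneg.le⟩
      simp only [signCount, Finset.sum_range_succ] at h1 ⊢
      rw [h1, if_pos hx, if_pos hx0]
    · filter_upwards [ih N (by omega) hz, hmulpos N (N + 1) hpos] with x h1 h2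
      have hx : N ∉ signChanges (P x) := fun h => absurd h.2 (not_le.2 h2)
      have hx0 : N ∉ signChanges (P x₀) := fun h => absurd h.2 (not_le.2 hpos)
      simp only [signCount, Finset.sum_range_succ] at h1 ⊢
      rw [h1, if_neg hx, if_neg hx0]

/-! ### Eigenvalues from sign changes -/

theorem continuous_eigenSol (μ : ℝ) (n : ℕ) : Continuous fun E => eigenSol μ E n := by
  have hd : ∀ n, Continuous fun E => diag μ E n := fun n => by
    unfold diag
    fun_prop
  induction n using Nat.strong_induction_on with
  | _ n ih =>
    unfold eigenSol at ih ⊢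
    match n with
    | 0 =>
      simp only [jacobiSol]
      exact continuous_const
    | 1 =>
      simp only [jacobiSol]
      exact (hd 0).div_const _
    | n + 2 =>
      simp only [jacobiSol]
      exact (((hd (n + 1)).mul (ih (n + 1) (by omega))).sub
        (continuous_const.mul (ih n (by omega)))).div_const _

/-- The threshold is independent of E ≤ 1/2; this uniformity lets the oscillation argument vary E.
It comes from √(n+2) ≤ μ√(n+1), valid as soon as n(μ²-1) ≥ 1. -/
theorem exists_diag_ge {μ : ℝ} (hμ : 1 < μ) : ∃ n₀ : ℕ, ∀ n, n₀ ≤ n → ∀ E, E ≤ 1 / 2 →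
    μ * offDiag n + offDiag (n + 1) ≤ diag μ E (n + 1) := by
  obtain ⟨n₀, hn₀⟩ := exists_nat_ge (1 / (μ ^ 2 - 1))
  refine ⟨n₀, fun n hn E hE => ?_⟩
  have hμ2 : 0 < μ ^ 2 - 1 := by nlinarith
  have h1 : 1 ≤ (n : ℝ) * (μ ^ 2 - 1) := by
    rw [div_le_iff₀ hμ2] at hn₀
    have : (n₀ : ℝ) ≤ n := by exact_mod_cast hn
    nlinarith
  have h2 : offDiag (n + 1) ≤ μ * √((n : ℝ) + 1) := by
    unfold offDiag
    rw [Real.sqrt_le_left (by positivity), mul_pow, Real.sq_sqrt (by positivity)]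
    push_cast
    nlinarith
  have h3 : √((n : ℝ) + 1) ≤ √(((n + 1 : ℕ) : ℝ) + 1 / 2 - E) := by
    apply Real.sqrt_le_sqrt
    push_cast
    linarith
  unfold diag
  have h4 := mul_le_mul_of_nonneg_left h3 (show 0 ≤ 2 * μ by linarith)
  have h5 : offDiag n = √((n : ℝ) + 1) := rfl
  rw [h5]
  linarith

theorem diag_ge_of_nonpos {μ E : ℝ} (hμ : 1 ≤ μ) (hE : E ≤ 0) (n : ℕ) :
    offDiag n + offDiag (n + 1) ≤ diag μ E (n + 1) := by
  unfold diag offDiag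
  have h0 : (0 : ℝ) ≤ n := by positivity
  set x := √((n : ℝ) + 1)
  set y := √(((n + 1 : ℕ) : ℝ) + 1)
  set z := √(((n + 1 : ℕ) : ℝ) + 1 / 2 - E)
  have hx : x ^ 2 = n + 1 := Real.sq_sqrt (by positivity)
  have hy : y ^ 2 = ((n + 1 : ℕ) : ℝ) + 1 := Real.sq_sqrt (by positivity)
  have hz : z ^ 2 = ((n + 1 : ℕ) : ℝ) + 1 / 2 - E := Real.sq_sqrt (by push_cast; linarith)
  push_cast at hy hz
  have hz0 : 0 ≤ z := Real.sqrt_nonneg _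
  have h1 : x + y ≤ 2 * z := by
    apply abs_le_of_sq_le_sq' _ (by positivity) |>.2
    nlinarith [sq_nonneg (x - y)]
  nlinarith

theorem eigenSol_growsAt_zero {μ E : ℝ} (hμ : 1 ≤ μ) (hE : E ≤ 0) : GrowsAt (eigenSol μ E) 0 ∧
    0 ∉ signChanges (eigenSol μ E) := by
  have h1 : eigenSol μ E 1 = 2 * μ * √(1 / 2 - E) := by
    simp [eigenSol, jacobiSol, diag, offDiag]
  have h2 : 1 ≤ eigenSol μ E 1 := by
    rw [h1]
    have h3 : (1 : ℝ) / 2 ≤ √(1 / 2 - E) := by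
      apply Real.le_sqrt_of_sq_le
      linarith
    nlinarith
  refine ⟨⟨?_, by rw [zero_add]; linarith⟩, fun h => ?_⟩
  · rw [eigenSol_zero, zero_add]
    nlinarith
  · have := h.2
    rw [eigenSol_zero, zero_add, one_mul] at this
    linarith

theorem eigenSol_signChanges_of_nonpos {μ E : ℝ} (hμ : 1 ≤ μ) (hE : E ≤ 0) :
    signChanges (eigenSol μ E) = ∅ := by
  obtain ⟨h1, h2⟩ := eigenSol_growsAt_zero hμ hE
  rw [eq_empty_iff_forall_notMem]
  intro n
  rcases Nat.eq_zero_or_pos n with rfl | hn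
  · exact h2
  · exact (eigenSol_isJacobiSol μ E).notMem_signChanges_of_growsAt offDiag_pos (n₀ := 0)
      (fun n _ => diag_ge_of_nonpos hμ hE n) le_rfl h1 hn

theorem finite_signChanges_eigenSol {μ E : ℝ} (hμ : 1 < μ) (hE : E ≤ 1 / 2) :
    (signChanges (eigenSol μ E)).Finite := by
  obtain ⟨n₀, hn₀⟩ := exists_diag_ge hμ
  refine (eigenSol_isJacobiSol μ E).finite_signChanges offDiag_pos (by simp [eigenSol_zero])
    (n₀ := n₀) fun n hn => ?_
  have h1 := hn₀ n hn E hE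
  have h2 := offDiag_pos n
  nlinarith

/-- Take the infimum E₀ of the energies in [0, E'] with more than j sign changes. If the solution at
E₀ grew in the dominated region, the total count would be constant near E₀, contradicting the
infimum. So it decays, hence is summable. All its sign changes then lie below n₀, where the count is
stable, and a nearby energy can have at most one more; the count at E₀ is therefore exactly j. -/
theorem exists_summable_eigenSol {μ E' : ℝ} (hμ : 1 < μ) (hE0 : 0 ≤ E') (hE' : E' < 1 / 2) {j : ℕ}
    (hj : j < (signChanges (eigenSol μ E')).ncard) :
    ∃ E, 0 < E ∧ E ≤ E' ∧ (signChanges (eigenSol μ E)).ncard = j ∧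
      Summable fun n : ℕ => eigenSol μ E n ^ 2 / √((n : ℝ) + 1) := by
  obtain ⟨n₀, hn₀⟩ := exists_diag_ge hμ
  have hb' : ∀ E, E ≤ 1 / 2 → ∀ n, n₀ ≤ n → offDiag n + offDiag (n + 1) ≤ diag μ E (n + 1) := by
    intro E hE n hn
    have h1 := hn₀ n hn E hE
    have h2 := offDiag_pos n
    nlinarith
  have hsol := eigenSol_isJacobiSol μ
  have hz0 : ∀ E, eigenSol μ E 0 ≠ 0 := fun E => by simp [eigenSol_zero]
  set z : ℝ → ℕ := fun E => (signChanges (eigenSol μ E)).ncard with hz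
  have hzz : z 0 = 0 := by
    simp only [hz]
    rw [eigenSol_signChanges_of_nonpos hμ.le le_rfl, ncard_empty]
  set S : Set ℝ := {E | 0 ≤ E ∧ E ≤ E' ∧ j < z E} with hS
  have hSne : S.Nonempty := ⟨E', hE0, le_rfl, hj⟩
  have hSb : BddBelow S := ⟨0, fun E hE => hE.1⟩
  set E₀ := sInf S with hE₀
  have hE₀0 : 0 ≤ E₀ := le_csInf hSne fun E hE => hE.1
  have hE₀' : E₀ ≤ E' := csInf_le hSb ⟨hE0, le_rfl, hj⟩
  have hev12 : ∀ᶠ E in 𝓝 E₀, E ≤ 1 / 2 :=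
    (gt_mem_nhds (show E₀ < 1 / 2 by linarith)).mono fun E hE => hE.le
  have hnear : ∀ p : ℝ → Prop, (∀ᶠ E in 𝓝 E₀, p E) → ∃ E ∈ S, p E := by
    intro p hp
    have h1 : E₀ ∈ closure S := csInf_mem_closure hSne hSb
    rw [mem_closure_iff_frequently] at h1
    obtain ⟨E, h2, h3⟩ := (h1.and_eventually hp).exists
    exact ⟨E, h2, h3⟩
  -- The count is 0 at E = 0, so E₀ would be positive and points slightly to its left would lie in
  -- S.
  have hleft : (∀ᶠ E in 𝓝 E₀, j < z E) → False := by
    intro hev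
    have hpos : 0 < E₀ := by
      rcases hE₀0.eq_or_lt with h | h
      · have h1 := hev.self_of_nhds
        rw [← h, hzz] at h1
        omega
      · exact h
    have h1 : ∀ᶠ E in 𝓝[<] E₀, j < z E ∧ 0 < E :=
      (hev.and (lt_mem_nhds hpos)).filter_mono nhdsWithin_le_nhds
    obtain ⟨E, ⟨h2, h3⟩, h4⟩ := (h1.and self_mem_nhdsWithin).exists
    have h4 : E < E₀ := h4
    exact absurd (csInf_le hSb (show E ∈ S from ⟨h3.le, by linarith, h2⟩)) (not_le.2 h4)
  have hng : ∀ n, n₀ ≤ n → ¬ GrowsAt (eigenSol μ E₀) n := by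
    intro n hn hg
    -- The strict inequality, available one step later because μ > 1, is an open condition in E.
    have hstrict : eigenSol μ E₀ (n + 1) ^ 2 < eigenSol μ E₀ (n + 2) ^ 2 := by
      have h1 := (hsol E₀).2 n
      have h2 := hn₀ n hn E₀ (by linarith)
      set x := eigenSol μ E₀ n
      set y := eigenSol μ E₀ (n + 1)
      set w := eigenSol μ E₀ (n + 2)
      have hy : 0 < y ^ 2 := by have := hg.2; positivity
      have ha := offDiag_pos n
      have ha1 := offDiag_pos (n + 1)
      have h3 : offDiag (n + 1) * (y * w) = diag μ E₀ (n + 1) * y ^ 2 - offDiag n * (x * y) := by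
        linear_combination -y * h1
      have h4 : x * y ≤ y ^ 2 := by nlinarith [sq_nonneg (x - y), hg.1]
      have h5 := mul_le_mul_of_nonneg_right h2 hy.le
      have h6 := mul_le_mul_of_nonneg_left h4 ha.le
      have h7 : 0 < (μ - 1) * offDiag n * y ^ 2 := by
        have : 0 < μ - 1 := by linarith
        positivity
      have h8 : y ^ 2 < y * w := by
        have h9 : offDiag (n + 1) * y ^ 2 < offDiag (n + 1) * (y * w) := by linarith
        exact lt_of_mul_lt_mul_left h9 ha1.le
      nlinarith [sq_nonneg (y - w)]
    have hne : eigenSol μ E₀ (n + 2) ≠ 0 := fun h => by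
      rw [h] at hstrict
      have := sq_nonneg (eigenSol μ E₀ (n + 1))
      norm_num at hstrict
      linarith
    have hgrow : ∀ E, E ≤ 1 / 2 → eigenSol μ E (n + 1) ^ 2 < eigenSol μ E (n + 2) ^ 2 →
        z E = signCount (eigenSol μ E) (n + 2) := by
      intro E hE hlt
      refine signCount_eq_ncard fun m hm => ?_
      refine (hsol E).notMem_signChanges_of_growsAt offDiag_pos (hb' E hE) (n := n + 1)
        (by omega) ⟨hlt.le, fun h => ?_⟩ hm
      rw [show n + 1 + 1 = n + 2 from rfl] at h
      rw [h] at hlt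
      have := sq_nonneg (eigenSol μ E (n + 1))
      norm_num at hlt
      linarith
    have hconst : ∀ᶠ E in 𝓝 E₀, z E = z E₀ := by
      have h1 := eventually_signCount_eq offDiag_pos hsol hz0 (continuous_eigenSol μ) (n + 2) hne
      have h2 : ∀ᶠ E in 𝓝 E₀, eigenSol μ E (n + 1) ^ 2 < eigenSol μ E (n + 2) ^ 2 :=
        (((continuous_eigenSol μ (n + 1)).pow 2).continuousAt).eventually_lt
          (((continuous_eigenSol μ (n + 2)).pow 2).continuousAt) hstrict
      filter_upwards [h1, h2, hev12] with E e1 e2 e3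
      rw [hgrow E e3 e2, hgrow E₀ (by linarith) hstrict, e1]
    obtain ⟨E, hES, hE⟩ := hnear _ hconst
    have : j < z E₀ := hE ▸ hES.2.2
    exact hleft (hconst.mono fun E hE => by rw [hE]; exact this)
  obtain ⟨hne, hnsc, hsum⟩ := (hsol E₀).decays offDiag_pos (hz0 E₀) hμ
    (fun n hn => hn₀ n hn E₀ (by linarith)) hng
  have hcnt := eventually_signCount_eq offDiag_pos hsol hz0 (continuous_eigenSol μ) n₀ (hne n₀ le_rfl)
  have hzE₀ : z E₀ = signCount (eigenSol μ E₀) n₀ := signCount_eq_ncard hnsc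
  have hle : z E₀ ≤ j := by
    by_contra hlt
    have hlt := not_le.1 hlt
    refine hleft ?_
    filter_upwards [hcnt, hev12] with E e1 e2
    have := signCount_le_ncard (finite_signChanges_eigenSol hμ e2) n₀
    rw [e1, ← hzE₀] at this
    exact hlt.trans_le this
  -- Near E₀ the count below n₀ does not change, and at most one sign change can occur from n₀ on.
  have hge : j ≤ z E₀ := by
    obtain ⟨E, hES, e1, e2⟩ := hnear _ (hcnt.and hev12)
    have h1 : z E ≤ signCount (eigenSol μ E) n₀ + 1 := ncard_le_signCount_succ
      fun n m hn hm h2 h3 => (hsol E).eq_of_mem_signChanges offDiag_pos (hz0 E) (hb' E e2) hn hm h2 h3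
    rw [e1, ← hzE₀] at h1
    have := hES.2.2
    omega
  refine ⟨E₀, ?_, hE₀', le_antisymm hle hge, hsum⟩
  rcases hE₀0.eq_or_lt with h | h
  · rw [← h] at hsum
    exact absurd hsum ((hsol 0).not_summable_of_growsAt offDiag_pos (n₀ := 0)
      (fun n _ => diag_ge_of_nonpos hμ.le le_rfl n) le_rfl (eigenSol_growsAt_zero hμ.le le_rfl).1)
  · exact h

/-! ### Absence of summable solutions for strong coupling -/

section Turan

variable {A e : ℕ → ℝ} {μ : ℝ}

/-- A Turán type determinant. -/
def turan (A e : ℕ → ℝ) (μ : ℝ) (n : ℕ) : ℝ :=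
  A n ^ 2 * (e n ^ 2 + e (n + 1) ^ 2) - 2 * μ * A n * (e n * e (n + 1))

/-- The difference telescopes to the variation of A alone, so the monotonicity of A controls that of
the determinant. -/
theorem turan_succ_sub (h : ∀ n, A (n + 1) * e (n + 2) + A n * e n = 2 * μ * e (n + 1)) (n : ℕ) :
    turan A e μ (n + 1) - turan A e μ n = (A (n + 1) ^ 2 - A n ^ 2) * e (n + 1) ^ 2 := by
  simp only [turan]
  rw [show n + 1 + 1 = n + 2 from rfl]
  linear_combination (A (n + 1) * e (n + 2) - A n * e n) * h n

theorem turan_eq (n : ℕ) : turan A e μ n =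
    (A n * e n - μ * e (n + 1)) ^ 2 + (A n ^ 2 - μ ^ 2) * e (n + 1) ^ 2 := by
  simp only [turan]
  ring

theorem turan_pos {n : ℕ} (hμ : 0 < μ) (hA : μ < A n) (he : e n ≠ 0 ∨ e (n + 1) ≠ 0) :
    0 < turan A e μ n := by
  rw [turan_eq]
  have h1 : 0 < A n ^ 2 - μ ^ 2 := by nlinarith
  by_cases hz : e (n + 1) = 0
  · have h2 := he.resolve_right (by simpa using hz)
    rw [hz]
    have h3 : A n * e n ≠ 0 := mul_ne_zero (by linarith) h2
    have : 0 < (A n * e n) ^ 2 := by positivity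
    simpa using this
  · positivity

theorem turan_le (hμ : 0 ≤ μ) (n : ℕ) (hA : 0 ≤ A n) :
    turan A e μ n ≤ (A n ^ 2 + μ * A n) * (e n ^ 2 + e (n + 1) ^ 2) := by
  simp only [turan]
  have h1 : 0 ≤ μ * A n := by positivity
  nlinarith [mul_nonneg h1 (sq_nonneg (e n + e (n + 1)))]

/-- For decreasing A the determinant S itself decreases, but S_n - (A_n² - μ²)e_{n+1}² is a square,
so S decreases no faster, proportionally, than A² - μ². -/
theorem turan_quotient_mono {n : ℕ} (h : ∀ n, A (n + 1) * e (n + 2) + A n * e n = 2 * μ * e (n + 1))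
    (hμ : 0 < μ) (h1 : μ < A (n + 1)) (hA : A (n + 1) ≤ A n) :
    turan A e μ n / (A n ^ 2 - μ ^ 2) ≤ turan A e μ (n + 1) / (A (n + 1) ^ 2 - μ ^ 2) := by
  have p1 : 0 < A (n + 1) ^ 2 - μ ^ 2 := by nlinarith
  have p0 : 0 < A n ^ 2 - μ ^ 2 := by nlinarith
  have hd := turan_succ_sub h n
  have he : turan A e μ n - (A n ^ 2 - μ ^ 2) * e (n + 1) ^ 2 =
      (A n * e n - μ * e (n + 1)) ^ 2 := by
    rw [turan_eq]
    ring
  rw [div_le_div_iff₀ p0 p1]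
  have h2 : turan A e μ (n + 1) = turan A e μ n + (A (n + 1) ^ 2 - A n ^ 2) * e (n + 1) ^ 2 := by
    linarith
  rw [h2]
  have h3 : A (n + 1) ^ 2 ≤ A n ^ 2 := by nlinarith
  have h4 : 0 ≤ (A n ^ 2 - A (n + 1) ^ 2) * (A n * e n - μ * e (n + 1)) ^ 2 :=
    mul_nonneg (by linarith) (sq_nonneg _)
  rw [← he] at h4
  nlinarith

/-- S_n is at most a constant times e_n² + e_{n+1}², which is small along a subsequence. -/
theorem false_of_turan_ge (hμ : 0 ≤ μ) (hsum : Summable fun n : ℕ => (e n ^ 2 + e (n + 1) ^ 2) /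
    ((n : ℝ) + 1)) {K c : ℝ} (hc : 0 < c) {n₀ : ℕ}
    (hA : ∀ n, n₀ ≤ n → 0 ≤ A n ∧ A n ≤ K) (hS : ∀ n, n₀ ≤ n → c ≤ turan A e μ n) : False := by
  have hK : 0 ≤ K := (hA n₀ le_rfl).1.trans (hA n₀ le_rfl).2
  have hfr := frequently_lt_of_summable_div hsum (ε := c / (K ^ 2 + μ * K + 1)) (by positivity)
  obtain ⟨n, h1, h2⟩ := (hfr.and_eventually (eventually_ge_atTop n₀)).exists
  rw [lt_div_iff₀ (by positivity)] at h1
  obtain ⟨a1, a2⟩ := hA n h2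
  have h3 := hS n h2
  have h4 := turan_le (e := e) hμ n a1
  have h5 : A n ^ 2 + μ * A n ≤ K ^ 2 + μ * K + 1 := by nlinarith [mul_le_mul_of_nonneg_left a2 hμ]
  have h6 : 0 ≤ e n ^ 2 + e (n + 1) ^ 2 := by positivity
  nlinarith [mul_le_mul_of_nonneg_right h5 h6]

theorem sum_off_eq (h0 : A 0 * e 1 = 2 * e 0)
    (h : ∀ n, A (n + 1) * e (n + 2) + A n * e n = 2 * e (n + 1)) (N : ℕ) :
    ∑ n ∈ Finset.range (N + 1), 2 * A n * (e n * e (n + 1)) =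
      (∑ n ∈ Finset.range (N + 1), 2 * e n ^ 2) + A N * (e N * e (N + 1)) := by
  induction N with
  | zero =>
    simp
    linear_combination e 0 * h0
  | succ N ih =>
    rw [Finset.sum_range_succ, ih, Finset.sum_range_succ (fun n => 2 * e n ^ 2) (N + 1)]
    rw [show N + 1 + 1 = N + 2 from rfl]
    linear_combination e (N + 1) * h N

theorem sum_adjacent_eq (N : ℕ) : ∑ n ∈ Finset.range (N + 1), (e n ^ 2 + e (n + 1) ^ 2) =
    (∑ n ∈ Finset.range (N + 1), 2 * e n ^ 2) + e (N + 1) ^ 2 - e 0 ^ 2 := by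
  induction N with
  | zero => simp; ring
  | succ N ih =>
    rw [Finset.sum_range_succ, ih, Finset.sum_range_succ (fun n => 2 * e n ^ 2) (N + 1)]
    ring

/-- The critical case μ = 1. Summing the recurrence against e shows that the bulk parts of ∑(e_n² +
e_{n+1}²) and ∑ 2A_n e_n e_{n+1} coincide; what remains is a boundary term, bounded along a
subsequence, and the convergent correction from A² - 1. So ∑ S_n converges, although S_n ≥ c/(n+1).
-/
theorem false_of_turan_ge_div (hsum : Summable fun n : ℕ => (e n ^ 2 + e (n + 1) ^ 2) /
    ((n : ℝ) + 1)) (h0 : A 0 * e 1 = 2 * e 0)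
    (h : ∀ n, A (n + 1) * e (n + 2) + A n * e n = 2 * e (n + 1)) {K C c : ℝ} (hc : 0 < c)
    (hC : 0 ≤ C) (hA : ∀ n, 0 ≤ A n ∧ A n ≤ K) (hA2 : ∀ n : ℕ, A n ^ 2 ≤ 1 + C / ((n : ℝ) + 1))
    (hS : ∀ n : ℕ, c / ((n : ℝ) + 1) ≤ turan A e 1 n) : False := by
  have hK : 0 ≤ K := (hA 0).1.trans (hA 0).2
  set X := ∑' n : ℕ, (e n ^ 2 + e (n + 1) ^ 2) / ((n : ℝ) + 1) with hX
  have hub : ∀ N, ∑ n ∈ Finset.range (N + 1), turan A e 1 n ≤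
      (K + 1) * (e N ^ 2 + e (N + 1) ^ 2) + C * X := by
    intro N
    have h1 : ∀ n ∈ Finset.range (N + 1), turan A e 1 n ≤ (e n ^ 2 + e (n + 1) ^ 2) +
        C * ((e n ^ 2 + e (n + 1) ^ 2) / ((n : ℝ) + 1)) - 2 * A n * (e n * e (n + 1)) := by
      intro n _
      have h2 : 0 ≤ e n ^ 2 + e (n + 1) ^ 2 := by positivity
      have h3 := mul_le_mul_of_nonneg_right (hA2 n) h2
      simp only [turan]
      have h4 : (1 + C / ((n : ℝ) + 1)) * (e n ^ 2 + e (n + 1) ^ 2) = (e n ^ 2 + e (n + 1) ^ 2) +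
        C * ((e n ^ 2 + e (n + 1) ^ 2) / ((n : ℝ) + 1)) := by ring
      linarith
    have h2 := Finset.sum_le_sum h1
    rw [Finset.sum_sub_distrib, Finset.sum_add_distrib, ← Finset.mul_sum, sum_off_eq h0 h,
      sum_adjacent_eq] at h2
    have h3 : ∑ n ∈ Finset.range (N + 1), (e n ^ 2 + e (n + 1) ^ 2) / ((n : ℝ) + 1) ≤ X :=
      hsum.sum_le_tsum _ fun n _ => by positivity
    have h4 := mul_le_mul_of_nonneg_left h3 hC
    obtain ⟨a1, a2⟩ := hA N
    have h5 : -(A N * (e N * e (N + 1))) ≤ K * (e N ^ 2 + e (N + 1) ^ 2) := by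
      have h6 := mul_nonneg a1 (sq_nonneg (e N + e (N + 1)))
      have h7 : A N * (e N ^ 2 + e (N + 1) ^ 2) ≤ K * (e N ^ 2 + e (N + 1) ^ 2) :=
        mul_le_mul_of_nonneg_right a2 (by positivity)
      have h8 : 0 ≤ A N * (e N ^ 2 + e (N + 1) ^ 2) := by positivity
      nlinarith
    nlinarith [sq_nonneg (e 0), sq_nonneg (e N)]
  have hpos : ∀ n, 0 ≤ turan A e 1 n := fun n => le_trans (by positivity) (hS n)
  have hfr := frequently_lt_of_summable_div hsum (ε := 1) one_pos
  have hbd : ∀ N, ∑ n ∈ Finset.range N, turan A e 1 n ≤ K + 1 + C * X := by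
    intro N
    obtain ⟨M, h1, h2⟩ := (hfr.and_eventually (eventually_ge_atTop N)).exists
    calc ∑ n ∈ Finset.range N, turan A e 1 n ≤ ∑ n ∈ Finset.range (M + 1), turan A e 1 n :=
          Finset.sum_le_sum_of_subset_of_nonneg
            (Finset.range_mono (by omega)) fun n _ _ => hpos n
      _ ≤ (K + 1) * (e M ^ 2 + e (M + 1) ^ 2) + C * X := hub M
      _ ≤ _ := by nlinarith
  have hs : Summable (turan A e 1) := summable_of_sum_range_le hpos hbd
  have hs2 : Summable fun n : ℕ => c / ((n : ℝ) + 1) :=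
    Summable.of_nonneg_of_le (fun n => by positivity) hS hs
  exact (frequently_lt_of_summable_div hs2 hc).exists.elim fun n hn => lt_irrefl _ hn

end Turan

theorem not_summable_eigenSol {μ E : ℝ} (hμ0 : 0 < μ) (hμ : μ ≤ 1) (hE : E < 1 / 2) :
    ¬ Summable fun n : ℕ => eigenSol μ E n ^ 2 / √((n : ℝ) + 1) := by
  intro hsum
  set l : ℝ := 1 / 2 - E with hl
  have hl0 : 0 < l := by linarith
  set κ : ℕ → ℝ := fun n => √((n : ℝ) + l) with hκ
  have hκ0 : ∀ n, 0 < κ n := fun n => Real.sqrt_pos.2 (by positivity)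
  have hκ2 : ∀ n, κ n ^ 2 = n + l := fun n => Real.sq_sqrt (by positivity)
  have hdiag : ∀ n, diag μ E n = 2 * μ * κ n := fun n => by
    simp only [diag, hκ, hl]
    congr 2
    ring
  set g : ℕ → ℝ := fun n => √(κ n) with hg
  have hg0 : ∀ n, 0 < g n := fun n => Real.sqrt_pos.2 (hκ0 n)
  have hg2 : ∀ n, g n ^ 2 = κ n := fun n => Real.sq_sqrt (hκ0 n).le
  set d := eigenSol μ E with hd
  obtain ⟨r0, r1⟩ := eigenSol_isJacobiSol μ E
  rw [← hd] at r0 r1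
  -- The factor √κ_n turns the diagonal into the constant 2μ and the weight (n+1)^{-1/2} into
  -- (n+1)^{-1}; the off-diagonal entries A_n tend to 1.
  set e : ℕ → ℝ := fun n => g n * d n with he
  set A : ℕ → ℝ := fun n => offDiag n / (g n * g (n + 1)) with hA
  have hA0 : ∀ n, 0 < A n := fun n => div_pos (offDiag_pos n) (mul_pos (hg0 n) (hg0 _))
  have hA2 : ∀ n : ℕ, A n ^ 2 = ((n : ℝ) + 1) / (κ n * κ (n + 1)) := fun n => by
    simp only [hA]
    rw [div_pow, mul_pow, hg2, hg2, offDiag, Real.sq_sqrt (by positivity)]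
  have hA4 : ∀ n : ℕ, (A n ^ 2) ^ 2 = ((n : ℝ) + 1) ^ 2 / ((n + l) * (n + 1 + l)) := fun n => by
    rw [hA2, div_pow, mul_pow, hκ2, hκ2]
    push_cast
    rfl
  have hrec : ∀ n, A (n + 1) * e (n + 2) + A n * e n = 2 * μ * e (n + 1) := by
    intro n
    have h1 := r1 n
    rw [hdiag, ← hg2] at h1
    have p0 := (hg0 n).ne'
    have p1 := (hg0 (n + 1)).ne'
    have p2 := (hg0 (n + 2)).ne'
    simp only [hA, he]
    rw [show n + 1 + 1 = n + 2 from rfl]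
    field_simp
    linear_combination -h1
  have hrec0 : A 0 * e 1 = 2 * μ * e 0 := by
    have h1 := r0
    rw [hdiag, ← hg2] at h1
    have p0 := (hg0 0).ne'
    have p1 := (hg0 1).ne'
    simp only [hA, he]
    rw [show 0 + 1 = 1 from rfl]
    field_simp
    linear_combination -h1
  have hene : ∀ n, e n ≠ 0 ∨ e (n + 1) ≠ 0 := fun n =>
    ((eigenSol_isJacobiSol μ E).ne_zero_or offDiag_pos (by simp [eigenSol_zero]) n).imp
      (mul_ne_zero (hg0 n).ne') (mul_ne_zero (hg0 _).ne')
  have hsume : Summable fun n : ℕ => e n ^ 2 / ((n : ℝ) + 1) := by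
    refine Summable.of_nonneg_of_le (fun n => by positivity) (fun n => ?_)
      (hsum.mul_left (√(1 + l)))
    simp only [he]
    rw [mul_pow, hg2]
    have h1 : κ n ≤ √(1 + l) * √((n : ℝ) + 1) := by
      rw [← Real.sqrt_mul (by positivity)]
      apply Real.sqrt_le_sqrt
      have : (0 : ℝ) ≤ n := by positivity
      nlinarith
    have h2 : √((n : ℝ) + 1) * √((n : ℝ) + 1) = n + 1 := Real.mul_self_sqrt (by positivity)
    have h3 : 0 < √((n : ℝ) + 1) := by positivity
    have h4 : √(1 + l) * (d n ^ 2 / √((n : ℝ) + 1)) * ((n : ℝ) + 1) =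
        (√(1 + l) * √((n : ℝ) + 1)) * d n ^ 2 := by
      have h5 : d n ^ 2 / √((n : ℝ) + 1) * ((n : ℝ) + 1) = √((n : ℝ) + 1) * d n ^ 2 := by
        rw [div_mul_eq_mul_div, div_eq_iff h3.ne', mul_right_comm, h2, mul_comm]
      rw [mul_assoc, h5, mul_assoc]
    rw [div_le_iff₀ (by positivity), h4]
    exact mul_le_mul_of_nonneg_right h1 (sq_nonneg _)
  have hsumx : Summable fun n : ℕ => (e n ^ 2 + e (n + 1) ^ 2) / ((n : ℝ) + 1) := by
    have h1 := ((summable_nat_add_iff 1).2 hsume).mul_left 2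
    refine Summable.of_nonneg_of_le (fun n => by positivity) (fun n => ?_) (hsume.add h1)
    rw [add_div]
    have h2 : e (n + 1) ^ 2 / ((n : ℝ) + 1) ≤ 2 * (e (n + 1) ^ 2 / (((n + 1 : ℕ) : ℝ) + 1)) := by
      rw [← mul_div_assoc, div_le_div_iff₀ (by positivity) (by positivity)]
      push_cast
      have : (0 : ℝ) ≤ n := by positivity
      nlinarith [sq_nonneg (e (n + 1)), mul_nonneg this (sq_nonneg (e (n + 1)))]
    linarith
  -- For E ≥ 0 the sequence A decreases and stays above 1; for E < 0 it eventually increases. The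
  -- Turán determinants are then controlled by the quotient estimate and directly, respectively. For
  -- μ = 1 and E ≤ 0 the solution simply grows.
  rcases le_or_gt l (1 / 2) with hl2 | hl2
  · have hanti : ∀ n, A (n + 1) ≤ A n := by
      intro n
      have hn : (0 : ℝ) ≤ n := by positivity
      have h1 : (A (n + 1) ^ 2) ^ 2 ≤ (A n ^ 2) ^ 2 := by
        rw [hA4, hA4, div_le_div_iff₀ (by positivity) (by positivity)]
        push_cast
        have h2 : 0 ≤ ((1 - 2 * l) * (n + 1) + 1 - l) := by nlinarith
        have h3 : 0 ≤ ((n : ℝ) + 1 + l) * ((1 - 2 * l) * (n + 1) + 1 - l) := by positivity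
        linear_combination h3
      have h2 := (pow_le_pow_iff_left₀ (by positivity) (by positivity) two_ne_zero).1 h1
      exact (pow_le_pow_iff_left₀ (hA0 _).le (hA0 _).le two_ne_zero).1 h2
    have hA1 : ∀ n, 1 < A n := by
      intro n
      have hn : (0 : ℝ) ≤ n := by positivity
      have h1 : 1 < (A n ^ 2) ^ 2 := by
        rw [hA4, lt_div_iff₀ (by positivity)]
        nlinarith [mul_nonneg hn (show 0 ≤ 1 - 2 * l by linarith)]
      have h2 := (one_lt_pow_iff_of_nonneg (by positivity) two_ne_zero).1 h1
      exact (one_lt_pow_iff_of_nonneg (hA0 n).le two_ne_zero).1 h2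
    have hAμ : ∀ n, μ < A n := fun n => hμ.trans_lt (hA1 n)
    set F : ℕ → ℝ := fun n => turan A e μ n / (A n ^ 2 - μ ^ 2) with hF
    have hFmono : Monotone F := monotone_nat_of_le_succ fun n =>
      turan_quotient_mono hrec hμ0 (hAμ _) (hanti n)
    have hden : ∀ n, 0 < A n ^ 2 - μ ^ 2 := fun n => by nlinarith [hAμ n, hA0 n]
    have hF0 : 0 < F 0 := div_pos (turan_pos hμ0 (hAμ 0) (hene 0)) (hden 0)
    have hS : ∀ n, F 0 * (A n ^ 2 - μ ^ 2) ≤ turan A e μ n := fun n => by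
      have h1 := hFmono (Nat.zero_le n)
      simp only [hF] at h1 ⊢
      rwa [le_div_iff₀ (hden n)] at h1
    have hAK : ∀ n, 0 ≤ A n ∧ A n ≤ A 0 := fun n =>
      ⟨(hA0 n).le, antitone_nat_of_succ_le hanti (Nat.zero_le n)⟩
    rcases hμ.lt_or_eq with hμ1 | hμ1
    · refine false_of_turan_ge hμ0.le hsumx (c := F 0 * (1 - μ ^ 2)) (K := A 0) (n₀ := 0)
        (mul_pos hF0 (by nlinarith)) (fun n _ => hAK n) fun n _ => le_trans ?_ (hS n)
      have := hA1 n
      exact mul_le_mul_of_nonneg_left (by nlinarith) hF0.le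
    · subst hμ1
      rcases le_or_gt E 0 with hE0 | hE0
      · exact (eigenSol_isJacobiSol 1 E).not_summable_of_growsAt offDiag_pos (n₀ := 0)
          (fun n _ => diag_ge_of_nonpos le_rfl hE0 n) le_rfl (eigenSol_growsAt_zero le_rfl hE0).1
          hsum
      · refine false_of_turan_ge_div hsumx (by linarith [hrec0]) (fun n => by linarith [hrec n])
          (c := F 0 * E) (C := 1 / l) (K := A 0) (mul_pos hF0 hE0) (by positivity) hAK ?_ ?_
        · intro n
          have hn : (0 : ℝ) ≤ n := by positivity
          have h1 : (n : ℝ) + l ≤ κ n * κ (n + 1) := by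
            rw [← hκ2 n, pow_two]
            refine mul_le_mul_of_nonneg_left ?_ (hκ0 n).le
            apply Real.sqrt_le_sqrt
            push_cast
            linarith
          rw [hA2]
          calc ((n : ℝ) + 1) / (κ n * κ (n + 1)) ≤ ((n : ℝ) + 1) / (n + l) := by gcongr
            _ ≤ 1 + 1 / l / ((n : ℝ) + 1) := by
              rw [div_div, ← sub_nonneg]
              have : 1 + 1 / (l * ((n : ℝ) + 1)) - ((n : ℝ) + 1) / (n + l) =
                (n * (1 - l) + l ^ 2 * (n + 1)) / (l * (n + 1) * (n + l)) := by
                field_simp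
                ring
              rw [this]
              have : 0 ≤ 1 - l := by linarith
              positivity
        · intro n
          have hn : (0 : ℝ) ≤ n := by positivity
          refine le_trans ?_ (hS n)
          rw [mul_div_assoc]
          refine mul_le_mul_of_nonneg_left ?_ hF0.le
          have h1 : κ n * κ (n + 1) ≤ n + 1 / 2 + l := by
            have h2 := hκ2 n
            have h3 := hκ2 (n + 1)
            push_cast at h3
            nlinarith [sq_nonneg (κ n - κ (n + 1))]
          rw [hA2]
          have h2 : ((n : ℝ) + 1) / (n + 1 / 2 + l) ≤ ((n : ℝ) + 1) / (κ n * κ (n + 1)) :=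
            div_le_div_of_nonneg_left (by positivity) (mul_pos (hκ0 _) (hκ0 _)) h1
          refine le_trans ?_ (sub_le_sub_right h2 _)
          rw [div_le_iff₀ (by positivity)]
          have h3 : ((n : ℝ) + 1) / (n + 1 / 2 + l) - 1 ^ 2 = E / (n + 1 / 2 + l) := by
            rw [eq_div_iff (by positivity), sub_mul, div_mul_cancel₀ _ (by positivity)]
            linarith
          rw [h3, div_mul_eq_mul_div, le_div_iff₀ (by positivity)]
          exact mul_le_mul_of_nonneg_left (by linarith) hE0.le
  · rcases hμ.lt_or_eq with hμ1 | hμ1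
    -- Beyond n₁ the sequence A increases; beyond n₂ the lower bound (n+1)/(n+1+l) for A_n² exceeds
    -- μ².
    · obtain ⟨n₁, hn₁⟩ := exists_nat_ge ((1 - l) / (2 * l - 1))
      obtain ⟨n₂, hn₂⟩ := exists_nat_gt (μ ^ 2 * l / (1 - μ ^ 2))
      have h1μ : 0 < 1 - μ ^ 2 := by nlinarith
      rw [div_le_iff₀ (by linarith)] at hn₁
      rw [div_lt_iff₀ h1μ] at hn₂
      have hmono : ∀ n, n₁ ≤ n → A n ≤ A (n + 1) := by
        intro n hn'
        have hn : (n₁ : ℝ) ≤ n := by exact_mod_cast hn'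
        have h1 : (A n ^ 2) ^ 2 ≤ (A (n + 1) ^ 2) ^ 2 := by
          rw [hA4, hA4, div_le_div_iff₀ (by positivity) (by positivity)]
          push_cast
          have h2 : 0 ≤ ((2 * l - 1) * (n + 1) + l - 1) := by nlinarith
          have h3 : 0 ≤ ((n : ℝ) + 1 + l) * ((2 * l - 1) * (n + 1) + l - 1) := by positivity
          linear_combination h3
        have h2 := (pow_le_pow_iff_left₀ (by positivity) (by positivity) two_ne_zero).1 h1
        exact (pow_le_pow_iff_left₀ (hA0 _).le (hA0 _).le two_ne_zero).1 h2
      have hAμ : ∀ n, n₂ ≤ n → μ < A n := by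
        intro n hn'
        have hn : (n₂ : ℝ) ≤ n := by exact_mod_cast hn'
        have h1 : κ n * κ (n + 1) ≤ n + 1 + l := by
          have h2 := hκ2 n
          have h3 := hκ2 (n + 1)
          push_cast at h3
          nlinarith [sq_nonneg (κ n - κ (n + 1))]
        have h2 : ((n : ℝ) + 1) / (n + 1 + l) ≤ A n ^ 2 := by
          rw [hA2]
          exact div_le_div_of_nonneg_left (by positivity) (mul_pos (hκ0 _) (hκ0 _)) h1
        have h3 : μ ^ 2 < ((n : ℝ) + 1) / (n + 1 + l) := by
          rw [lt_div_iff₀ (by positivity)]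
          nlinarith
        exact (pow_lt_pow_iff_left₀ hμ0.le (hA0 n).le two_ne_zero).1 (h3.trans_le h2)
      have hAK : ∀ n, A n ≤ 1 + 1 / l := by
        intro n
        have hn : (0 : ℝ) ≤ n := by positivity
        have h1 : (n : ℝ) + l ≤ κ n * κ (n + 1) := by
          rw [← hκ2 n, pow_two]
          refine mul_le_mul_of_nonneg_left ?_ (hκ0 n).le
          apply Real.sqrt_le_sqrt
          push_cast
          linarith
        have h2 : A n ^ 2 ≤ 1 + 1 / l := by
          rw [hA2]
          calc ((n : ℝ) + 1) / (κ n * κ (n + 1)) ≤ ((n : ℝ) + 1) / (n + l) := by gcongr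
            _ ≤ 1 + 1 / l := by
              rw [← sub_nonneg]
              have : 1 + 1 / l - ((n : ℝ) + 1) / (n + l) = (n + l ^ 2) / (l * (n + l)) := by
                field_simp
                ring
              rw [this]
              positivity
        have h3 : 1 ≤ 1 + 1 / l := by
          have : 0 ≤ 1 / l := by positivity
          linarith
        nlinarith [hA0 n]
      set M := max n₁ n₂ with hM
      have hSm : ∀ n, M ≤ n → turan A e μ M ≤ turan A e μ n := by
        intro n hn
        induction n, hn using Nat.le_induction with
        | base => exact le_rfl
        | succ n hn ih =>
          have h1 := turan_succ_sub hrec n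
          have h2 := hmono n ((le_max_left _ _).trans hn)
          have h3 : 0 ≤ (A (n + 1) ^ 2 - A n ^ 2) * e (n + 1) ^ 2 :=
            mul_nonneg (by nlinarith [hA0 n]) (sq_nonneg _)
          linarith
      exact false_of_turan_ge hμ0.le hsumx
        (turan_pos hμ0 (hAμ M (le_max_right _ _)) (hene M)) (fun n _ => ⟨(hA0 n).le, hAK n⟩) hSm
    · subst hμ1
      exact (eigenSol_isJacobiSol 1 E).not_summable_of_growsAt offDiag_pos (n₀ := 0)
          (fun n _ => diag_ge_of_nonpos le_rfl (by linarith) n) le_rfl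
          (eigenSol_growsAt_zero le_rfl (by linarith)).1 hsum

theorem pointSpectrum_eq_empty {α : ℝ} (hα : √2 ≤ α) : pointSpectrum (A α) = ∅ := by
  have h2 : 0 < √2 := by positivity
  have hα0 : 0 < α := h2.trans_le hα
  rw [eq_empty_iff_forall_notMem]
  intro z hz
  have hre := eigenvalue_real hz
  rw [hre] at hz
  rcases lt_or_ge z.re (1 / 2) with h | h
  · refine not_summable_eigenSol (div_pos h2 hα0) ?_ h ((mem_pointSpectrum_iff hα0 h).1 hz)
    rwa [div_le_one hα0]
  · exact no_eigenvalue_ge_half hα0.le h hz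

/-! ### Meixner sequences -/

/-- The geometric series `∑ ξⁿ Xⁿ`. -/
noncomputable def geomSeries (ξ : ℝ) : PowerSeries ℝ :=
  PowerSeries.rescale ξ (PowerSeries.mk 1)

theorem geomSeries_mul (ξ : ℝ) : geomSeries ξ * (1 - PowerSeries.C ξ * PowerSeries.X) = 1 := by
  have h := congrArg (PowerSeries.rescale ξ) (PowerSeries.mk_one_mul_one_sub_eq_one ℝ)
  rwa [map_mul, map_sub, map_one, PowerSeries.rescale_X] at h

theorem rescale_C (a r : ℝ) : PowerSeries.rescale a (PowerSeries.C r) = PowerSeries.C r := by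
  ext n
  rw [PowerSeries.coeff_rescale, PowerSeries.coeff_C]
  split_ifs with h
  · simp [h]
  · simp

/-- The generating function `(1 - ηX)ᵐ (1 - ξX)⁻⁽ᵐ⁺¹⁾`. -/
noncomputable def meixnerSeries (ξ η : ℝ) (m : ℕ) : PowerSeries ℝ :=
  (1 - PowerSeries.C η * PowerSeries.X) ^ m * geomSeries ξ ^ (m + 1)

/-- The coefficients of `(1 - ηX)ᵐ (1 - ξX)⁻⁽ᵐ⁺¹⁾`. -/
noncomputable def meixner (ξ η : ℝ) (m n : ℕ) : ℝ := PowerSeries.coeff n (meixnerSeries ξ η m)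

/-- The logarithmic derivative is (m+1)ξ/(1-ξX) - mη/(1-ηX), and ξη = 1 makes the common denominator
1 - (ξ+η)X + X². Comparing coefficients gives the Jacobi recurrence with a_n = n + 1. -/
theorem derivative_meixnerSeries {ξ η : ℝ} (h : ξ * η = 1) (m : ℕ) :
    (1 - PowerSeries.C (ξ + η) * PowerSeries.X + PowerSeries.X ^ 2) *
      PowerSeries.derivative ℝ (meixnerSeries ξ η m) =
      (PowerSeries.C ((m + 1) * ξ - m * η) - PowerSeries.X) * meixnerSeries ξ η m := by
  set u : PowerSeries ℝ := 1 - PowerSeries.C η * PowerSeries.X with hu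
  set v : PowerSeries ℝ := 1 - PowerSeries.C ξ * PowerSeries.X with hv
  have hC : PowerSeries.C ξ * PowerSeries.C η = (1 : PowerSeries ℝ) := by
    rw [← map_mul, h, map_one]
  set W := geomSeries ξ with hW
  have hWv : W * v = 1 := geomSeries_mul ξ
  have hdu : PowerSeries.derivative ℝ u = -PowerSeries.C η := by
    rw [hu]
    simp [Derivation.leibniz, PowerSeries.derivative_C]
  have hdv : PowerSeries.derivative ℝ v = -PowerSeries.C ξ := by
    rw [hv]
    simp [Derivation.leibniz, PowerSeries.derivative_C]
  have hdW : v * PowerSeries.derivative ℝ W = PowerSeries.C ξ * W := by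
    have h1 := congrArg (PowerSeries.derivative ℝ) hWv
    rw [Derivation.leibniz, hdv, Derivation.map_one_eq_zero, smul_eq_mul, smul_eq_mul] at h1
    linear_combination h1
  have huv : 1 - PowerSeries.C (ξ + η) * PowerSeries.X + PowerSeries.X ^ 2 = u * v := by
    rw [hu, hv, map_add]
    linear_combination (-PowerSeries.X ^ 2) * hC
  have hpow : u * PowerSeries.derivative ℝ (u ^ m) = (m : PowerSeries ℝ) * u ^ m * (-PowerSeries.C η) := by
    rw [Derivation.leibniz_pow, hdu]
    rcases m with _ | m
    · simp
    · simp only [nsmul_eq_mul, smul_eq_mul, Nat.add_sub_cancel]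
      ring
  rw [huv, meixnerSeries, ← hu, ← hW, Derivation.leibniz, Derivation.leibniz_pow]
  simp only [nsmul_eq_mul, smul_eq_mul, Nat.add_sub_cancel]
  have hCm : (PowerSeries.C ((m + 1) * ξ - m * η) : PowerSeries ℝ) =
      (m + 1) * PowerSeries.C ξ - m * PowerSeries.C η := by
    simp
  rw [hCm]
  push_cast
  have e1 : v = 1 - PowerSeries.C ξ * PowerSeries.X := hv
  have e2 : u = 1 - PowerSeries.C η * PowerSeries.X := hu
  calc u * v * (u ^ m * (((m : PowerSeries ℝ) + 1) * (W ^ m * PowerSeries.derivative ℝ W)) +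
        W ^ (m + 1) * PowerSeries.derivative ℝ (u ^ m))
      = u ^ m * W ^ m * ((m + 1) * u * (v * PowerSeries.derivative ℝ W)) +
        W ^ (m + 1) * v * (u * PowerSeries.derivative ℝ (u ^ m)) := by ring
    _ = (((m : PowerSeries ℝ) + 1) * PowerSeries.C ξ * u - m * PowerSeries.C η * v) *
        (u ^ m * W ^ (m + 1)) := by
      rw [hdW, hpow]
      ring
    _ = _ := by
      congr 1
      rw [e1, e2]
      linear_combination (-PowerSeries.X) * hC

theorem meixner_zero (ξ η : ℝ) (m : ℕ) : meixner ξ η m 0 = 1 := by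
  have h1 : PowerSeries.constantCoeff (geomSeries ξ) = 1 := by
    rw [geomSeries, ← PowerSeries.coeff_zero_eq_constantCoeff_apply, PowerSeries.coeff_rescale]
    simp
  simp [meixner, meixnerSeries, h1]

theorem meixner_isJacobiSol {ξ η : ℝ} (h : ξ * η = 1) (m : ℕ) :
    IsJacobiSol (fun n => (n : ℝ) + 1)
      (fun n => (ξ + η) * n + ((m + 1) * ξ - m * η)) (meixner ξ η m) := by
  have hd := derivative_meixnerSeries h m
  set σ := ξ + η
  have hX : ∀ (n : ℕ) (F : PowerSeries ℝ), PowerSeries.coeff (n + 1) (PowerSeries.X * F) =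
    PowerSeries.coeff n F := fun n F => PowerSeries.coeff_succ_X_mul n F
  have hX0 : ∀ (F : PowerSeries ℝ), PowerSeries.coeff 0 (PowerSeries.X * F) = 0 := fun F => by simp
  have hco : ∀ n, PowerSeries.coeff n (PowerSeries.derivative ℝ (meixnerSeries ξ η m)) =
      meixner ξ η m (n + 1) * (n + 1) := fun n => PowerSeries.coeff_derivative _ n
  set D := PowerSeries.derivative ℝ (meixnerSeries ξ η m) with hD
  set G := meixnerSeries ξ η m with hG
  have hG' : ∀ n, PowerSeries.coeff n G = meixner ξ η m n := fun n => rfl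
  have hd' : D + PowerSeries.X * (PowerSeries.X * D) + PowerSeries.X * G =
      PowerSeries.C σ * (PowerSeries.X * D) + PowerSeries.C ((m + 1) * ξ - m * η) * G := by
    linear_combination hd
  have h0 := congrArg (PowerSeries.coeff 0) hd'
  simp only [map_add, PowerSeries.coeff_C_mul, hX0, hco, hG'] at h0
  refine ⟨?_, fun n => ?_⟩
  · norm_num at h0 ⊢
    linarith
  · have h1 := congrArg (PowerSeries.coeff (n + 1)) hd'
    rcases n with _ | n
    · simp only [map_add, PowerSeries.coeff_C_mul, hX, hX0, hco, hG'] at h1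
      norm_num at h1 ⊢
      linarith
    · simp only [map_add, PowerSeries.coeff_C_mul, hX, hco, hG'] at h1
      push_cast at h1 ⊢
      rw [show n + 1 + 2 = n + 1 + 1 + 1 from rfl]
      linarith

/-! ### Meixner sequences have exactly m sign changes -/

theorem choose_eq_eval (j : ℕ) : ∃ R : Polynomial ℝ, R.natDegree ≤ j ∧
    ∀ n : ℕ, ((j + n).choose j : ℝ) = R.eval (n : ℝ) := by
  refine ⟨Polynomial.C ((j.factorial : ℝ)⁻¹) * (ascPochhammer ℝ j).comp (Polynomial.X + 1), ?_, ?_⟩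
  · refine (Polynomial.natDegree_C_mul_le _ _).trans ?_
    rw [Polynomial.natDegree_comp, ascPochhammer_natDegree]
    rw [show (Polynomial.X + 1 : Polynomial ℝ) = Polynomial.X + Polynomial.C 1 by simp,
      Polynomial.natDegree_X_add_C, mul_one]
  · intro n
    rw [Polynomial.eval_mul, Polynomial.eval_C, Polynomial.eval_comp, Polynomial.eval_add,
      Polynomial.eval_X, Polynomial.eval_one]
    have h1 : (ascPochhammer ℝ j).eval ((n : ℝ) + 1) = ((n + 1).ascFactorial j : ℝ) := by
      rw [← ascPochhammer_nat_eq_ascFactorial]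
      have := ascPochhammer_eval_cast (S := ℝ) j (n + 1)
      push_cast at this ⊢
      exact this.symm
    rw [h1, Nat.ascFactorial_eq_factorial_mul_choose, add_comm n j]
    push_cast
    field_simp

/-- Rescaling by η turns the generating function into (1 - η²X)^m (1-X)^{-(m+1)}. Writing 1 - η²X =
η²(1-X) + (1-η²) and expanding leaves powers (1-X)^{-(j+1)} with j ≤ m, whose coefficients are
binomials polynomial in n. -/
theorem meixner_eq_eval {ξ η : ℝ} (h : ξ * η = 1) (m : ℕ) : ∃ R : Polynomial ℝ,
    R.natDegree ≤ m ∧ ∀ n : ℕ, η ^ n * meixner ξ η m n = R.eval (n : ℝ) := by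
  choose R hR1 hR2 using choose_eq_eval
  set W : PowerSeries ℝ := PowerSeries.mk 1 with hW
  have hWv : W * (1 - PowerSeries.X) = 1 := PowerSeries.mk_one_mul_one_sub_eq_one ℝ
  have hG : PowerSeries.rescale η (meixnerSeries ξ η m) =
      ∑ k ∈ Finset.range (m + 1), PowerSeries.C ((η * η) ^ k * (1 - η * η) ^ (m - k) * m.choose k) *
        W ^ (m - k + 1) := by
    have e1 : PowerSeries.rescale η (geomSeries ξ) = W := by
      rw [geomSeries, PowerSeries.rescale_rescale, h, PowerSeries.rescale_one]
      rfl
    have e2 : PowerSeries.rescale η (1 - PowerSeries.C η * PowerSeries.X) =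
        PowerSeries.C (η * η) * (1 - PowerSeries.X) + PowerSeries.C (1 - η * η) := by
      rw [map_sub, map_mul, map_one, PowerSeries.rescale_X, rescale_C, map_sub, map_mul, map_one]
      ring
    rw [meixnerSeries, map_mul, map_pow, map_pow, e1, e2, add_pow, Finset.sum_mul]
    refine Finset.sum_congr rfl fun k hk => ?_
    have hk' : k ≤ m := Nat.lt_succ_iff.1 (Finset.mem_range.1 hk)
    have e3 : W ^ (m + 1) = W ^ k * W ^ (m - k + 1) := by
      rw [← pow_add]
      congr 1
      omega
    have e4 : W ^ k * (1 - PowerSeries.X) ^ k = 1 := by rw [← mul_pow, hWv, one_pow]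
    rw [e3, mul_pow]
    simp only [map_mul, map_pow, map_natCast]
    linear_combination (PowerSeries.C η * PowerSeries.C η) ^ k * PowerSeries.C (1 - η * η) ^ (m - k) *
      (m.choose k : PowerSeries ℝ) * W ^ (m - k + 1) * e4
  refine ⟨∑ k ∈ Finset.range (m + 1),
    Polynomial.C ((η * η) ^ k * (1 - η * η) ^ (m - k) * m.choose k) * R (m - k), ?_, fun n => ?_⟩
  · refine Polynomial.natDegree_sum_le_of_forall_le _ _ fun k _ => ?_
    exact (Polynomial.natDegree_C_mul_le _ _).trans ((hR1 _).trans (Nat.sub_le _ _))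
  · have h1 := congrArg (PowerSeries.coeff n) hG
    rw [PowerSeries.coeff_rescale, map_sum] at h1
    rw [meixner, h1, Polynomial.eval_finsetSum]
    refine Finset.sum_congr rfl fun k _ => ?_
    rw [PowerSeries.coeff_C_mul, Polynomial.eval_mul, Polynomial.eval_C, ← hR2, hW,
      PowerSeries.mk_one_pow_eq_mk_choose_add, PowerSeries.coeff_mk]

/-- Each sign-change edge gives a zero of the polynomial in the half-open interval (n, n+1]; these
intervals are disjoint and there are at most m zeros. -/
theorem card_signChanges_meixner_le {ξ η : ℝ} (h : ξ * η = 1) (hη : 0 < η) (m : ℕ) (T : Finset ℕ)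
    (hT : ∀ n ∈ T, n ∈ signChanges (meixner ξ η m)) : T.card ≤ m := by
  obtain ⟨R, hR1, hR2⟩ := meixner_eq_eval h m
  have hR0 : R ≠ 0 := by
    rintro rfl
    have := hR2 0
    simp [meixner_zero] at this
  have hroot : ∀ n ∈ T, ∃ x : ℝ, (n : ℝ) < x ∧ x ≤ n + 1 ∧ R.eval x = 0 := by
    intro n hn
    obtain ⟨h1, h2⟩ := hT n hn
    have hp : 0 < η ^ n * η ^ (n + 1) := by positivity
    have h3 : R.eval (n : ℝ) ≠ 0 := by
      rw [← hR2]
      exact mul_ne_zero (by positivity) h1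
    have h4 : R.eval (n : ℝ) * R.eval ((n : ℝ) + 1) ≤ 0 := by
      have h5 := hR2 (n + 1)
      push_cast at h5
      rw [← hR2, ← h5]
      nlinarith
    have hc : ContinuousOn (fun x => R.eval x) (Icc (n : ℝ) (n + 1)) := R.continuous.continuousOn
    have hx : ∃ x ∈ Icc (n : ℝ) (n + 1), R.eval x = 0 := by
      have hle : (n : ℝ) ≤ n + 1 := by linarith
      rcases lt_or_gt_of_ne h3 with h6 | h6
      · obtain ⟨x, hx, hx'⟩ := intermediate_value_Icc hle hc
          (show (0 : ℝ) ∈ Icc _ _ from ⟨h6.le, by nlinarith⟩)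
        exact ⟨x, hx, hx'⟩
      · obtain ⟨x, hx, hx'⟩ := intermediate_value_Icc' hle hc
          (show (0 : ℝ) ∈ Icc _ _ from ⟨by nlinarith, h6.le⟩)
        exact ⟨x, hx, hx'⟩
    obtain ⟨x, hx, hx'⟩ := hx
    refine ⟨x, lt_of_le_of_ne hx.1 ?_, hx.2, hx'⟩
    rintro rfl
    exact h3 hx'
  choose! x hx1 hx2 hx3 using hroot
  have hinj : Set.InjOn x T := by
    intro n hn k hk hnk
    have a1 := hx1 n hn
    have a2 := hx2 n hn
    have b1 := hx1 k hk
    have b2 := hx2 k hk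
    rw [hnk] at a1 a2
    have c1 : (n : ℝ) < k + 1 := by linarith
    have c2 : (k : ℝ) < n + 1 := by linarith
    have c1' : n < k + 1 := by exact_mod_cast c1
    have c2' : k < n + 1 := by exact_mod_cast c2
    omega
  rw [← Finset.card_image_of_injOn hinj]
  refine le_trans ?_ ((Polynomial.card_roots' R).trans hR1)
  refine le_trans (Finset.card_le_card ?_) (Multiset.toFinset_card_le R.roots)
  intro y hy
  obtain ⟨n, hn, rfl⟩ := Finset.mem_image.1 hy
  rw [Multiset.mem_toFinset, Polynomial.mem_roots hR0]
  exact hx3 n hn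

/-- There are indices `e 0 < ⋯ < e k` at which the signs of `f` alternate, beginning with `+`. -/
def Alternates (f : ℕ → ℝ) (k : ℕ) : Prop :=
  ∃ e : ℕ → ℕ, (∀ i < k, e i < e (i + 1)) ∧ ∀ i ≤ k, 0 < (-1) ^ i * f (e i)

theorem exists_lt_succ {f : ℕ → ℝ} {x y : ℕ} (hxy : x ≤ y) (h : f x < f y) :
    ∃ j, x ≤ j ∧ j < y ∧ f j < f (j + 1) := by
  by_contra! hc
  have : ∀ d, x + d ≤ y → f (x + d) ≤ f x := by
    intro d
    induction d with
    | zero => simp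
    | succ d ih => exact fun hd => (hc (x + d) (by omega) (by omega)).trans (ih (by omega))
  have h1 := this (y - x) (by omega)
  rw [show x + (y - x) = y by omega] at h1
  linarith

/-- A discrete Rolle theorem: the backward difference of a sequence that tends to `0`, and is
extended by `0` to the left, has one more alternation of signs. -/
theorem Alternates.difference {f F : ℕ → ℝ} {k : ℕ} (h : Alternates f k)
    (hf : Tendsto f atTop (𝓝 0)) (hF0 : F 0 = f 0) (hF : ∀ n, F (n + 1) = f (n + 1) - f n) :
    Alternates F (k + 1) := by
  obtain ⟨e, he1, he2⟩ := h
  have hfirst : ∃ j, j ≤ e 0 ∧ 0 < F j := by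
    have h1 := he2 0 (Nat.zero_le _)
    rw [pow_zero, one_mul] at h1
    by_cases h2 : 0 < f 0
    · exact ⟨0, Nat.zero_le _, by rwa [hF0]⟩
    · obtain ⟨j, -, hj, hj'⟩ := exists_lt_succ (Nat.zero_le (e 0)) (lt_of_le_of_lt (not_lt.1 h2) h1)
      exact ⟨j + 1, hj, by rw [hF]; linarith⟩
  have hmid : ∀ i, i ≤ k → ∃ j, e i < j ∧ (i < k → j ≤ e (i + 1)) ∧ 0 < (-1) ^ (i + 1) * F j := by
    intro i hi
    have h1 := he2 i hi
    have hy : ∃ y, e i ≤ y ∧ (i < k → y = e (i + 1)) ∧ (-1) ^ (i + 1) * f (e i) < (-1) ^ (i + 1) * f y := by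
      by_cases hik : i < k
      · refine ⟨e (i + 1), (he1 i hik).le, fun _ => rfl, ?_⟩
        have h2 := he2 (i + 1) hik
        rw [pow_succ] at h2 ⊢
        linarith
      · have h3 : Tendsto (fun y => (-1) ^ (i + 1) * f y) atTop (𝓝 ((-1) ^ (i + 1) * 0)) :=
          hf.const_mul _
        rw [mul_zero] at h3
        have h4 : (-1) ^ (i + 1) * f (e i) < 0 := by
          rw [pow_succ]
          linarith
        obtain ⟨y, hy1, hy2⟩ := ((h3.eventually (lt_mem_nhds h4)).and (eventually_ge_atTop (e i))).exists
        exact ⟨y, hy2, fun h => absurd h hik, hy1⟩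
    obtain ⟨y, hy1, hy2, hy3⟩ := hy
    obtain ⟨j, hj1, hj2, hj3⟩ := exists_lt_succ (f := fun n => (-1) ^ (i + 1) * f n) hy1 hy3
    refine ⟨j + 1, by omega, fun hik => ?_, ?_⟩
    · rw [← hy2 hik]
      omega
    · rw [hF]
      linarith
  obtain ⟨j₀, hj1, hj2⟩ := hfirst
  choose! j hj3 hj4 hj5 using hmid
  refine ⟨fun i => Nat.casesOn i j₀ j, fun i hi => ?_, fun i hi => ?_⟩
  · rcases i with _ | i
    · exact lt_of_le_of_lt hj1 (hj3 0 (Nat.zero_le _))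
    · exact lt_of_le_of_lt (hj4 i (by omega) (by omega)) (hj3 (i + 1) (by omega))
  · rcases i with _ | i
    · simpa using hj2
    · exact hj5 i (by omega)

theorem Alternates.exists_card_eq {f : ℕ → ℝ} {k : ℕ} (h : Alternates f k) :
    ∃ T : Finset ℕ, T.card = k ∧ ∀ n ∈ T, n ∈ signChanges f := by
  obtain ⟨e, he1, he2⟩ := h
  have hn : ∀ i, i < k → ∃ n, e i ≤ n ∧ n < e (i + 1) ∧ n ∈ signChanges f := by
    intro i hi
    have h1 := he2 i hi.le
    have h2 := he2 (i + 1) hi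
    rw [pow_succ] at h2
    have hex : ∃ n, e i ≤ n ∧ (-1) ^ i * f (n + 1) ≤ 0 := by
      refine ⟨e (i + 1) - 1, by have := he1 i hi; omega, ?_⟩
      rw [show e (i + 1) - 1 + 1 = e (i + 1) by have := he1 i hi; omega]
      linarith
    classical
    obtain ⟨g1, g2⟩ := Nat.find_spec hex
    have gmin := fun n => Nat.find_min' hex (m := n)
    set n := Nat.find hex with hn
    have hpos : 0 < (-1) ^ i * f n := by
      rcases g1.eq_or_lt with h3 | h3
      · rwa [← h3]
      · by_contra h4
        have := gmin (n - 1) ⟨by omega, by rw [show n - 1 + 1 = n by omega]; exact not_lt.1 h4⟩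
        omega
    refine ⟨n, g1, ?_, ?_, ?_⟩
    · have := gmin (e (i + 1) - 1) ⟨by have := he1 i hi; omega, by
        rw [show e (i + 1) - 1 + 1 = e (i + 1) by have := he1 i hi; omega]
        linarith⟩
      have := he1 i hi
      omega
    · intro h0
      rw [h0] at hpos
      simp at hpos
    · have h5 : ((-1 : ℝ) ^ i) * (-1) ^ i = 1 := by
        rw [← mul_pow]
        norm_num
      have h6 := mul_nonneg hpos.le (neg_nonneg.2 g2)
      have h7 : f n * f (n + 1) = -(((-1) ^ i * f n) * -((-1) ^ i * f (n + 1))) := by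
        linear_combination (-f n * f (n + 1)) * h5
      linarith
  choose! n hn1 hn2 hn3 using hn
  have hmono : ∀ i j, i < j → j < k → n i < n j := by
    intro i j hij
    induction j, hij using Nat.le_induction with
    | base => exact fun hj => lt_of_lt_of_le (hn2 i (by omega)) (hn1 _ hj)
    | succ j hj ih =>
      intro hk
      exact (ih (by omega)).trans (lt_of_lt_of_le (hn2 j (by omega)) (hn1 _ hk))
  refine ⟨(Finset.range k).image n, ?_, ?_⟩
  · rw [Finset.card_image_of_injOn, Finset.card_range]
    intro i hi j hj hij
    have hi' := Finset.mem_range.1 (Finset.mem_coe.1 hi)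
    have hj' := Finset.mem_range.1 (Finset.mem_coe.1 hj)
    rcases lt_trichotomy i j with h | h | h
    · exact absurd hij (hmono i j h hj').ne
    · exact h
    · exact absurd hij (hmono j i h hi').ne'
  · intro y hy
    obtain ⟨i, hi, rfl⟩ := Finset.mem_image.1 hy
    exact hn3 i (Finset.mem_range.1 hi)

/-- Rescaling by ξ gives (1-X)^m (1-ξ²X)^{-(m+1)}. The last factor has positive coefficients tending
to 0, as ξ < 1, and each multiplication by 1 - X is a backward difference, which adds one
alternation. -/
theorem exists_card_eq_signChanges_meixner {ξ η : ℝ} (h : ξ * η = 1) (hξ : 0 < ξ) (hξ1 : ξ < 1)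
    (m : ℕ) : ∃ T : Finset ℕ, T.card = m ∧ ∀ n ∈ T, n ∈ signChanges (meixner ξ η m) := by
  set c := ξ * ξ with hc
  have hc0 : 0 < c := by positivity
  have hc1 : c < 1 := by nlinarith
  set V : PowerSeries ℝ := PowerSeries.rescale c (PowerSeries.mk fun n => (((m + n).choose m : ℕ) : ℝ)) with hV
  have hVc : ∀ n, PowerSeries.coeff n V = c ^ n * ((m + n).choose m : ℕ) := fun n => by
    rw [hV, PowerSeries.coeff_rescale, PowerSeries.coeff_mk]
  have hG : PowerSeries.rescale ξ (meixnerSeries ξ η m) = (1 - PowerSeries.X) ^ m * V := by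
    rw [meixnerSeries, map_mul, map_pow, map_pow, map_sub, map_one, map_mul, rescale_C,
      PowerSeries.rescale_X, geomSeries, PowerSeries.rescale_rescale, ← mul_assoc, ← map_mul,
      mul_comm η ξ, h, map_one, one_mul, ← map_pow, PowerSeries.mk_one_pow_eq_mk_choose_add]
  have hstep : ∀ k, Alternates (fun n => PowerSeries.coeff n ((1 - PowerSeries.X) ^ k * V)) k ∧
      Tendsto (fun n => PowerSeries.coeff n ((1 - PowerSeries.X) ^ k * V)) atTop (𝓝 0) := by
    intro k
    induction k with
    | zero =>
      simp only [pow_zero, one_mul, hVc]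
      refine ⟨⟨fun _ => 0, fun i hi => absurd hi (by omega), fun i hi => ?_⟩, ?_⟩
      · obtain rfl : i = 0 := by omega
        simp
      · have h1 := (summable_choose_mul_geometric_of_norm_lt_one (R := ℝ) m (r := c)
          (by rwa [Real.norm_eq_abs, abs_of_pos hc0])).tendsto_atTop_zero
        refine h1.congr fun n => ?_
        rw [add_comm m n, mul_comm]
    | succ k ih =>
      obtain ⟨ih1, ih2⟩ := ih
      set f : ℕ → ℝ := fun n => PowerSeries.coeff n ((1 - PowerSeries.X) ^ k * V) with hf
      have e : (1 - PowerSeries.X) ^ (k + 1) * V = (1 - PowerSeries.X) ^ k * V -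
          PowerSeries.X * ((1 - PowerSeries.X) ^ k * V) := by ring
      have h0 : PowerSeries.coeff 0 ((1 - PowerSeries.X) ^ (k + 1) * V) = f 0 := by
        rw [e, map_sub, PowerSeries.coeff_zero_X_mul, sub_zero]
      have h1 : ∀ n, PowerSeries.coeff (n + 1) ((1 - PowerSeries.X) ^ (k + 1) * V) =
          f (n + 1) - f n := fun n => by
        rw [e, map_sub, PowerSeries.coeff_succ_X_mul]
      refine ⟨ih1.difference ih2 h0 h1, ?_⟩
      rw [← tendsto_add_atTop_iff_nat 1]
      simp only [h1]
      simpa using ((tendsto_add_atTop_iff_nat 1).2 ih2).sub ih2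
  obtain ⟨T, hT1, hT2⟩ := (hstep m).1.exists_card_eq
  refine ⟨T, hT1, fun n hn => ?_⟩
  have hrel : ∀ n, PowerSeries.coeff n ((1 - PowerSeries.X) ^ m * V) = ξ ^ n * meixner ξ η m n :=
    fun n => by rw [← hG, PowerSeries.coeff_rescale, meixner]
  obtain ⟨h1, h2⟩ := hT2 n hn
  simp only [hrel] at h1 h2
  refine ⟨right_ne_zero_of_mul h1, ?_⟩
  have h3 : 0 < ξ ^ n * ξ ^ (n + 1) := by positivity
  by_contra h4
  have := mul_pos h3 (not_le.1 h4)
  linarith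

/-! ### Comparison with the Meixner form -/

/-- An off-diagonal error of size σ on the two edges at n costs at most 2σ p_n², since 2|p_n
p_{n+1}| ≤ p_n² + p_{n+1}²; the diagonal surplus pays for it. -/
theorem jacobiForm_add_le {a b a' b' p : ℕ → ℝ} {κ σ : ℝ} (hσ : 0 ≤ σ)
    (hb : ∀ n, p n ≠ 0 → b n + κ + 2 * σ ≤ b' n) (ha : ∀ n, p (n + 1) ≠ 0 → |a n - a' n| ≤ σ) (N : ℕ) :
    jacobiForm a b p N + κ * ∑ n ∈ Finset.range (N + 1), p n ^ 2 ≤ jacobiForm a' b' p N := by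
  have hbp : ∀ n, b n * p n ^ 2 + κ * p n ^ 2 + 2 * σ * p n ^ 2 ≤ b' n * p n ^ 2 := by
    intro n
    by_cases h : p n = 0
    · simp [h]
    · have := mul_le_mul_of_nonneg_right (hb n h) (sq_nonneg (p n))
      linarith
  have hap : ∀ n, 2 * ((a' n - a n) * (p n * p (n + 1))) ≤ σ * p n ^ 2 + σ * p (n + 1) ^ 2 := by
    intro n
    by_cases h : p (n + 1) = 0
    · rw [h]
      have := mul_nonneg hσ (sq_nonneg (p n))
      norm_num
      exact this
    · obtain ⟨h1, h2⟩ := abs_le.1 (ha n h)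
      nlinarith [mul_nonneg (sub_nonneg.2 h2) (sq_nonneg (p n + p (n + 1))),
        mul_nonneg (neg_le_iff_add_nonneg.1 h1) (sq_nonneg (p n - p (n + 1))),
        mul_nonneg (sub_nonneg.2 h2) (sq_nonneg (p n - p (n + 1))),
        mul_nonneg (neg_le_iff_add_nonneg.1 h1) (sq_nonneg (p n + p (n + 1)))]
  -- The induction keeps σ p_N² in reserve for the edge from N to N + 1.
  suffices h : jacobiForm a b p N + κ * ∑ n ∈ Finset.range (N + 1), p n ^ 2 + σ * p N ^ 2 ≤
      jacobiForm a' b' p N by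
    have := mul_nonneg hσ (sq_nonneg (p N))
    linarith
  induction N with
  | zero =>
    have h1 := hbp 0
    have h2 := mul_nonneg hσ (sq_nonneg (p 0))
    simp only [jacobiForm, zero_add, Finset.sum_range_one, Finset.range_zero, Finset.sum_empty]
    linarith
  | succ N ih =>
    rw [jacobiForm_succ, jacobiForm_succ, Finset.sum_range_succ _ (N + 1)]
    have h1 := hbp (N + 1)
    have h2 := hap N
    linarith

theorem jacobiForm_mul_left (a b w p : ℕ → ℝ) (N : ℕ) :
    jacobiForm a b (w * p) N =
      jacobiForm (fun n => a n * (w n * w (n + 1))) (fun n => b n * w n ^ 2) p N := by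
  simp only [jacobiForm, Pi.mul_apply]
  congr 1
  · exact Finset.sum_congr rfl fun n _ => by ring
  · congr 1
    exact Finset.sum_congr rfl fun n _ => by ring

/-- Summation by parts for the Jacobi form around a solution of the recurrence. -/
theorem IsJacobiSol.jacobiForm_mul {a b P : ℕ → ℝ} (h : IsJacobiSol a b P) (t : ℕ → ℝ) (N : ℕ) :
    jacobiForm a b (t * P) N =
      ∑ n ∈ Finset.range N, a n * (P n * P (n + 1)) * (t n - t (n + 1)) ^ 2 +
        a N * (P N * P (N + 1)) * t N ^ 2 := by
  induction N with
  | zero =>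
    simp only [jacobiForm, zero_add, Finset.sum_range_one, Finset.range_zero, Finset.sum_empty,
      Pi.mul_apply]
    linear_combination (t 0 ^ 2 * P 0) * h.1
  | succ N ih =>
    rw [jacobiForm_succ, ih, Finset.sum_range_succ]
    simp only [Pi.mul_apply]
    linear_combination (t (N + 1) ^ 2 * P (N + 1)) * h.2 N

/-- The fourth root of `n + 1/2`. -/
noncomputable def quarticWeight (n : ℕ) : ℝ := √√((n : ℝ) + 1 / 2)

theorem quarticWeight_pos (n : ℕ) : 0 < quarticWeight n := by
  unfold quarticWeight
  positivity

theorem quarticWeight_sq (n : ℕ) : quarticWeight n ^ 2 = √((n : ℝ) + 1 / 2) :=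
  Real.sq_sqrt (Real.sqrt_nonneg _)

/-- With x = n + 1 the fourth power of the weighted entry is x²(x² - 1/4): centring the weight at n
+ 1/2 removes the constant-order error. -/
theorem offDiag_mul_quarticWeight (n : ℕ) :
    |offDiag n * (quarticWeight n * quarticWeight (n + 1)) - (n + 1)| ≤ 1 / (4 * (n + 1)) := by
  set w := offDiag n * (quarticWeight n * quarticWeight (n + 1)) with hw
  have hw0 : 0 < w := mul_pos (offDiag_pos n) (mul_pos (quarticWeight_pos n) (quarticWeight_pos _))
  set x : ℝ := (n : ℝ) + 1 with hx
  have hx1 : 1 ≤ x := by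
    have : (0 : ℝ) ≤ n := by positivity
    linarith
  have hw4 : (w ^ 2) ^ 2 = x ^ 2 * (x ^ 2 - 1 / 4) := by
    have e1 : offDiag n ^ 2 = x := Real.sq_sqrt (by positivity)
    have e2 : (quarticWeight n ^ 2) ^ 2 = x - 1 / 2 := by
      rw [quarticWeight_sq, Real.sq_sqrt (by positivity)]
      linarith
    have e3 : (quarticWeight (n + 1) ^ 2) ^ 2 = x + 1 / 2 := by
      rw [quarticWeight_sq, Real.sq_sqrt (by positivity)]
      push_cast
      linarith
    have : (w ^ 2) ^ 2 = (offDiag n ^ 2) ^ 2 * ((quarticWeight n ^ 2) ^ 2 *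
      (quarticWeight (n + 1) ^ 2) ^ 2) := by
      rw [hw]
      ring
    rw [this, e1, e2, e3]
    ring
  have hxx : 1 ≤ x ^ 2 := by nlinarith
  have h1 : w ^ 2 ≤ x ^ 2 := by
    refine (pow_le_pow_iff_left₀ (by positivity) (by positivity) two_ne_zero).1 ?_
    rw [hw4]
    nlinarith
  have h2 : x ^ 2 - 1 / 4 ≤ w ^ 2 := by
    refine (pow_le_pow_iff_left₀ (by linarith) (by positivity) two_ne_zero).1 ?_
    rw [hw4]
    nlinarith
  have h3 : w ≤ x := (pow_le_pow_iff_left₀ hw0.le (by positivity) two_ne_zero).1 h1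
  have hy0 : 0 < 1 / (4 * x) := by positivity
  have hy1 : x * (1 / (4 * x)) = 1 / 4 := by field_simp
  set y := 1 / (4 * x) with hy
  have hy2 : y ≤ 1 / 4 := by nlinarith
  have h4 : x - y ≤ w := by
    refine (pow_le_pow_iff_left₀ (by linarith) hw0.le two_ne_zero).1 ?_
    nlinarith
  rw [abs_le]
  constructor <;> linarith

theorem sqrt_mul_sqrt_add_half (n : ℕ) :
    (n : ℝ) + 1 / 4 - 1 / (4 * (n + 1)) ≤ √(n : ℝ) * √((n : ℝ) + 1 / 2) ∧
      √(n : ℝ) * √((n : ℝ) + 1 / 2) ≤ n + 1 / 4 := by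
  have hn : (0 : ℝ) ≤ n := by positivity
  rw [← Real.sqrt_mul hn]
  have hy0 : 0 < 1 / (4 * ((n : ℝ) + 1)) := by positivity
  have hy1 : ((n : ℝ) + 1) * (1 / (4 * ((n : ℝ) + 1))) = 1 / 4 := by field_simp
  set y := 1 / (4 * ((n : ℝ) + 1)) with hy
  have hy2 : y ≤ 1 / 4 := by nlinarith
  constructor
  · apply Real.le_sqrt_of_sq_le
    nlinarith [mul_nonneg hn hy0.le]
  · apply Real.sqrt_le_iff.2
    constructor
    · linarith
    · nlinarith

theorem one_div_four_mul_le {ε : ℝ} {M n : ℕ} (hM : 1 ≤ 2 * ε * M) (h : M ≤ n + 1) (hε : 0 < ε) :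
    1 / (4 * ((n : ℝ) + 1)) ≤ ε / 2 := by
  rw [div_le_iff₀ (by positivity)]
  have h1 : (M : ℝ) ≤ n + 1 := by exact_mod_cast h
  nlinarith

/-- On sequences supported in n ≥ M both approximation errors are at most multiples of ε/2, and the
margin 2με in β covers them since μ ≥ 1. -/
theorem meixnerForm_le {μ β ε : ℝ} (hμ : 1 ≤ μ) (hε : 0 < ε) (hβ : β ≤ 2 * μ * (1 / 4 - ε)) {M : ℕ}
    (hM : 1 ≤ 2 * ε * M) {p : ℕ → ℝ} (hp : ∀ n < M, p n = 0) (N : ℕ) :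
    jacobiForm (fun n => (n : ℝ) + 1) (fun n => 2 * μ * n + β) p N ≤
      jacobiForm offDiag (diag μ (1 / 2)) (quarticWeight * p) N := by
  rw [jacobiForm_mul_left]
  have hMn : ∀ n, p n ≠ 0 → M ≤ n := fun n hn => by
    by_contra h
    exact hn (hp n (not_le.1 h))
  have h := jacobiForm_add_le (a := fun n => (n : ℝ) + 1) (b := fun n => 2 * μ * n + β)
    (a' := fun n => offDiag n * (quarticWeight n * quarticWeight (n + 1)))
    (b' := fun n => diag μ (1 / 2) n * quarticWeight n ^ 2) (p := p) (κ := 0) (σ := ε / 2)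
    (by positivity) (fun n hn => ?_) (fun n hn => ?_) N
  · linarith
  · rw [quarticWeight_sq, diag, add_sub_cancel_right, mul_assoc (2 * μ)]
    have h1 := (sqrt_mul_sqrt_add_half n).1
    have h2 := one_div_four_mul_le hM ((hMn n hn).trans (Nat.le_succ n)) hε
    have h3 : (n : ℝ) + 1 / 4 - ε / 2 ≤ √(n : ℝ) * √((n : ℝ) + 1 / 2) := by linarith
    have h4 := mul_le_mul_of_nonneg_left h3 (show 0 ≤ 2 * μ by linarith)
    nlinarith
  · rw [abs_sub_comm]
    exact (offDiag_mul_quarticWeight n).trans (one_div_four_mul_le hM (hMn _ hn) hε)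

/-- Here E lies slightly below 1/2, which raises the diagonal. The bounded support n ≤ K keeps that
increase, at most 2μ√(1/2-E)√(K+1/2), within ε/2, and ε/2 · ∑ p² of the margin is left over for
strictness. -/
theorem le_meixnerForm {μ β ε : ℝ} (hμ : 1 ≤ μ) (hε : 0 < ε) (hβ : 2 * μ * (1 / 4 + ε) ≤ β) {M K : ℕ}
    (hM : 1 ≤ 2 * ε * M) {E : ℝ} (hE : E ≤ 1 / 2)
    (hEK : 2 * μ * (√(1 / 2 - E) * √((K : ℝ) + 1 / 2)) ≤ ε / 2)
    {p : ℕ → ℝ} (hp : ∀ n < M, p n = 0) (hpK : ∀ n, K < n → p n = 0) (N : ℕ) :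
    jacobiForm offDiag (diag μ E) (quarticWeight * p) N +
      ε / 2 * ∑ n ∈ Finset.range (N + 1), p n ^ 2 ≤
      jacobiForm (fun n => (n : ℝ) + 1) (fun n => 2 * μ * n + β) p N := by
  rw [jacobiForm_mul_left]
  have hMn : ∀ n, p n ≠ 0 → M ≤ n := fun n hn => by
    by_contra h
    exact hn (hp n (not_le.1 h))
  have hKn : ∀ n, p n ≠ 0 → n ≤ K := fun n hn => by
    by_contra h
    exact hn (hpK n (not_le.1 h))
  refine jacobiForm_add_le (σ := ε / 2) (by positivity) (fun n hn => ?_) (fun n hn => ?_) N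
  · rw [quarticWeight_sq, diag, mul_assoc (2 * μ)]
    have hK : (n : ℝ) ≤ K := by exact_mod_cast hKn n hn
    have hn0 : (0 : ℝ) ≤ n := by positivity
    have h1 := (sqrt_mul_sqrt_add_half n).2
    have h2 : √((n : ℝ) + 1 / 2 - E) ≤ √(n : ℝ) + √(1 / 2 - E) := by
      rw [add_sub_assoc]
      have hE' : 0 ≤ 1 / 2 - E := by linarith
      refine Real.sqrt_le_iff.2 ⟨by positivity, ?_⟩
      rw [add_sq, Real.sq_sqrt hn0, Real.sq_sqrt hE']
      have : 0 ≤ 2 * √(n : ℝ) * √(1 / 2 - E) := by positivity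
      linarith
    have h3 : √((n : ℝ) + 1 / 2) ≤ √((K : ℝ) + 1 / 2) := Real.sqrt_le_sqrt (by linarith)
    have h4 : √((n : ℝ) + 1 / 2 - E) * √((n : ℝ) + 1 / 2) ≤
        (n + 1 / 4) + √(1 / 2 - E) * √((K : ℝ) + 1 / 2) := by
      have h5 := mul_le_mul_of_nonneg_right h2 (Real.sqrt_nonneg ((n : ℝ) + 1 / 2))
      have h6 := mul_le_mul_of_nonneg_left h3 (Real.sqrt_nonneg (1 / 2 - E))
      linarith
    have h5 := mul_le_mul_of_nonneg_left h4 (show 0 ≤ 2 * μ by linarith)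
    nlinarith
  · exact (offDiag_mul_quarticWeight n).trans (one_div_four_mul_le hM (hMn _ hn) hε)

/-! ### Two-sided bounds for the number of eigenvalues -/

theorem card_eigenvalues_le_add {α : ℝ} (hα : 0 < α) (hα2 : 1 ≤ √2 / α) {ξ η ε : ℝ} (h : ξ * η = 1)
    (hη : 0 < η) (hadd : ξ + η = 2 * (√2 / α)) (hε : 0 < ε) {m M : ℕ} (hM : 1 ≤ 2 * ε * M)
    (hm : (m + 1) * ξ - m * η ≤ 2 * (√2 / α) * (1 / 4 - ε))
    (s : Finset ℝ) (hs : ∀ E ∈ s, E < 1 / 2 ∧ (E : ℂ) ∈ pointSpectrum (A α)) :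
    s.card ≤ M + m := by
  set P := meixner ξ η m with hP
  have hPJ := meixner_isJacobiSol h m
  rw [← hP, hadd] at hPJ
  have hfin : (signChanges P).Finite := by
    by_contra hinf
    obtain ⟨T, hT1, hT2⟩ := Set.Infinite.exists_subset_card_eq hinf (m + 1)
    have := card_signChanges_meixner_le h hη m T hT1
    omega
  have hcard : hfin.toFinset.card ≤ m :=
    card_signChanges_meixner_le h hη m _ fun n hn => hfin.mem_toFinset.1 hn
  set w := quarticWeight with hw
  -- The conditions are: vanishing below M, and the Picone condition at each of the at most m sign
  -- changes of the Meixner solution, rewritten for the weighted sequence.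
  have h1 := card_eigenvalues_le hα (ι := Fin M ⊕ hfin.toFinset)
    (Sum.elim (fun i => LinearMap.proj (i : ℕ)) fun n =>
      (P n / w (n + 1)) • LinearMap.proj ((n : ℕ) + 1) - (P (n + 1) / w n) • LinearMap.proj (n : ℕ))
    ?_ s hs
  · rw [Fintype.card_sum, Fintype.card_fin, Fintype.card_coe] at h1
    omega
  · intro D hD
    set p : ℕ → ℝ := fun n => D n / w n with hp
    have hDp : D = w * p := by
      funext n
      have := (quarticWeight_pos n).ne'
      simp only [hp, Pi.mul_apply, hw]
      field_simp
    have hp0 : ∀ n < M, p n = 0 := fun n hn => by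
      have h2 := hD (Sum.inl ⟨n, hn⟩)
      simp only [Sum.elim_inl, LinearMap.proj_apply] at h2
      simp [hp, h2]
    have hpS : ∀ n ∈ signChanges P, p (n + 1) * P n = p n * P (n + 1) := by
      intro n hn
      have h2 := hD (Sum.inr ⟨n, hfin.mem_toFinset.2 hn⟩)
      simp only [Sum.elim_inr, LinearMap.sub_apply, LinearMap.smul_apply, LinearMap.proj_apply,
        smul_eq_mul] at h2
      simp only [hp]
      linear_combination h2
    have h3 := hPJ.jacobiForm_nonneg (fun n => by positivity)
      (by rw [hP, meixner_zero]; exact one_ne_zero) hfin hpS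
    filter_upwards [h3] with N hN
    rw [hDp]
    exact hN.trans (meixnerForm_le hα2 hε hm hM hp0 N)

/-- Multiply the Meixner solution P by step functions t that jump only across its m sign changes:
the form of tP is a sum of a_n P_n P_{n+1}(t_n - t_{n+1})² ≤ 0. If the solution at E had fewer than
m - M sign changes, a nonzero such tP would vanish below M and meet all its Picone conditions,
making the form at E nonnegative; `le_meixnerForm` then gives a contradiction. -/
theorem exists_ncard_signChanges_ge {μ ξ η ε : ℝ} (hμ : 1 < μ) (h : ξ * η = 1) (hξ : 0 < ξ)
    (hξ1 : ξ < 1) (hadd : ξ + η = 2 * μ) (hε : 0 < ε) {m M : ℕ} (hM : 1 ≤ 2 * ε * M)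
    (hm : 2 * μ * (1 / 4 + ε) ≤ (m + 1) * ξ - m * η) :
    ∃ E, 0 ≤ E ∧ E < 1 / 2 ∧ m ≤ M + (signChanges (eigenSol μ E)).ncard := by
  set P := meixner ξ η m with hP
  have hPJ := meixner_isJacobiSol h m
  rw [← hP, hadd] at hPJ
  obtain ⟨T, hT1, hT2⟩ := exists_card_eq_signChanges_meixner h hξ hξ1 m
  rw [← hP] at hT2
  set K := T.sup id with hK
  have hTK : ∀ n ∈ T, n ≤ K := fun n hn => Finset.le_sup (f := id) hn
  set r : ℝ := √((K : ℝ) + 1 / 2) with hr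
  have hr0 : 0 < r := by positivity
  -- E = 1/2 - τ, small enough relative to the last sign change K of T for `le_meixnerForm`, and
  -- with τ ≤ 1/2 so that E ≥ 0.
  set τ : ℝ := min (1 / 2) ((ε / 2 / (2 * μ * r)) ^ 2) with hτ
  have hq0 : 0 < ε / 2 / (2 * μ * r) := by positivity
  have hτ0 : 0 < τ := lt_min (by norm_num) (by positivity)
  have hτ1 : τ ≤ 1 / 2 := min_le_left _ _
  have hτ2 : √τ ≤ ε / 2 / (2 * μ * r) := by
    rw [← Real.sqrt_sq hq0.le]
    exact Real.sqrt_le_sqrt (min_le_right _ _)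
  have hEK : 2 * μ * (√(1 / 2 - (1 / 2 - τ)) * r) ≤ ε / 2 := by
    rw [sub_sub_cancel]
    rw [le_div_iff₀ (by positivity)] at hτ2
    linarith
  refine ⟨1 / 2 - τ, by linarith, by linarith, ?_⟩
  set E := 1 / 2 - τ with hE
  by_contra hlt
  rw [not_le] at hlt
  set Q := eigenSol μ E with hQ
  have hfin : (signChanges Q).Finite := finite_signChanges_eigenSol hμ (by linarith)
  rw [Set.ncard_eq_toFinset_card _ hfin] at hlt
  set w := quarticWeight with hw
  let t : (T → ℝ) →ₗ[ℝ] (ℕ → ℝ) :=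
    Fintype.linearCombination ℝ fun k : T => fun n : ℕ => if n ≤ (k : ℕ) then (1 : ℝ) else 0
  have ht : ∀ c n, t c n = ∑ k : T, c k * (if n ≤ (k : ℕ) then (1 : ℝ) else 0) := fun c n => by
    simp [t, Fintype.linearCombination_apply]
  let Φ : (T → ℝ) →ₗ[ℝ] (Fin M ⊕ hfin.toFinset → ℝ) := LinearMap.pi (Sum.elim
    (fun i => P i • (LinearMap.proj (i : ℕ)).comp t) fun n =>
      (w (n + 1) * P (n + 1) * Q n) • (LinearMap.proj ((n : ℕ) + 1)).comp t -
        (w n * P n * Q (n + 1)) • (LinearMap.proj (n : ℕ)).comp t)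
  have hker : LinearMap.ker Φ ≠ ⊥ := LinearMap.ker_ne_bot_of_finrank_lt (by
    simp only [Module.finrank_fintype_fun_eq_card, Fintype.card_sum, Fintype.card_fin,
      Fintype.card_coe, hT1]
    exact hlt)
  obtain ⟨c, hc, hc0⟩ := (Submodule.ne_bot_iff _).1 hker
  have hΦ : ∀ i, Φ c i = 0 := fun i => congrFun (LinearMap.mem_ker.1 hc) i
  set p : ℕ → ℝ := t c * P with hp
  have hpM : ∀ n < M, p n = 0 := fun n hn => by
    have h2 := hΦ (Sum.inl ⟨n, hn⟩)
    simp only [Φ, LinearMap.pi_apply, Sum.elim_inl, LinearMap.smul_apply, LinearMap.comp_apply,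
      LinearMap.proj_apply, smul_eq_mul] at h2
    rw [hp, Pi.mul_apply, mul_comm]
    exact h2
  have hpS : ∀ n ∈ signChanges Q, (w * p) (n + 1) * Q n = (w * p) n * Q (n + 1) := fun n hn => by
    have h2 := hΦ (Sum.inr ⟨n, hfin.mem_toFinset.2 hn⟩)
    simp only [Φ, LinearMap.pi_apply, Sum.elim_inr, LinearMap.sub_apply, LinearMap.smul_apply,
      LinearMap.comp_apply, LinearMap.proj_apply, smul_eq_mul] at h2
    simp only [hp, Pi.mul_apply]
    linear_combination h2
  have htK : ∀ n, K < n → t c n = 0 := fun n hn => by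
    rw [ht]
    refine Finset.sum_eq_zero fun k _ => ?_
    rw [if_neg (by have := hTK k k.2; omega), mul_zero]
  have hpK : ∀ n, K < n → p n = 0 := fun n hn => by rw [hp, Pi.mul_apply, htK n hn, zero_mul]
  have htstep : ∀ n, n ∉ T → t c n = t c (n + 1) := fun n hn => by
    rw [ht, ht]
    refine Finset.sum_congr rfl fun k _ => ?_
    have : n ≤ (k : ℕ) ↔ n + 1 ≤ (k : ℕ) := by
      have : n ≠ (k : ℕ) := fun h => hn (h ▸ k.2)
      omega
    simp only [this]
  -- At the largest k with c k ≠ 0 only the step ending at k is seen, and P k ≠ 0 because k is a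
  -- sign change.
  have hpne : ∃ n ≤ K, p n ≠ 0 := by
    have hcne : ∃ k : T, c k ≠ 0 := by
      by_contra! hall
      exact hc0 (funext hall)
    obtain ⟨k, hk, hkmax⟩ := Set.exists_max_image {k : T | c k ≠ 0} (fun k => (k : ℕ))
      (Set.toFinite _) hcne
    refine ⟨k, hTK k k.2, ?_⟩
    have h2 : t c k = c k := by
      rw [ht, Finset.sum_eq_single k]
      · simp
      · intro j _ hjk
        by_cases hj : c j = 0
        · simp [hj]
        · have h3 := hkmax j hj
          have h4 : (j : ℕ) ≠ k := fun h => hjk (Subtype.ext h)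
          rw [if_neg (by omega), mul_zero]
      · simp
    rw [hp, Pi.mul_apply, h2]
    exact mul_ne_zero hk (hT2 k k.2).1
  have h3 := (eigenSol_isJacobiSol μ E).jacobiForm_nonneg offDiag_pos
    (by rw [eigenSol_zero]; exact one_ne_zero) hfin hpS
  obtain ⟨N, hN1, hN2⟩ := (h3.and (eventually_gt_atTop K)).exists
  have h4 := le_meixnerForm hμ.le hε hm hM (by linarith : E ≤ 1 / 2) hEK hpM hpK N
  have h5 : jacobiForm (fun n => (n : ℝ) + 1) (fun n => 2 * μ * n + ((m + 1) * ξ - m * η)) p N ≤ 0 := by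
    rw [hp, hPJ.jacobiForm_mul, htK N hN2]
    have : ∑ n ∈ Finset.range N, ((n : ℝ) + 1) * (P n * P (n + 1)) * (t c n - t c (n + 1)) ^ 2 ≤ 0 := by
      refine Finset.sum_nonpos fun n _ => ?_
      by_cases hn : n ∈ T
      · have h6 := (hT2 n hn).2
        have h7 : 0 ≤ ((n : ℝ) + 1) * (t c n - t c (n + 1)) ^ 2 := by positivity
        nlinarith
      · rw [htstep n hn]
        simp
    simpa using this
  have h6 : 0 < ∑ n ∈ Finset.range (N + 1), p n ^ 2 := by
    obtain ⟨n, hn1, hn2⟩ := hpne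
    refine Finset.sum_pos' (fun n _ => sq_nonneg _) ⟨n, Finset.mem_range.2 (by omega), by positivity⟩
  have h7 : 0 < ε / 2 * ∑ n ∈ Finset.range (N + 1), p n ^ 2 := by positivity
  linarith

/-- For each j below the count there is an eigenvalue with exactly j sign changes; different j give
different eigenvalues. -/
theorem exists_eigenvalues {α : ℝ} (hα : 0 < α) (hα2 : 1 < √2 / α) {E : ℝ} (hE0 : 0 ≤ E)
    (hE : E < 1 / 2) : ∃ s : Finset ℝ, s.card = (signChanges (eigenSol (√2 / α) E)).ncard ∧
      ∀ E ∈ s, E < 1 / 2 ∧ (E : ℂ) ∈ pointSpectrum (A α) := by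
  set k := (signChanges (eigenSol (√2 / α) E)).ncard with hk
  have hex : ∀ j, j < k → ∃ E' : ℝ, E' < 1 / 2 ∧ (E' : ℂ) ∈ pointSpectrum (A α) ∧
      (signChanges (eigenSol (√2 / α) E')).ncard = j := by
    intro j hj
    obtain ⟨E', h1, h2, h3, h4⟩ := exists_summable_eigenSol hα2 hE0 hE hj
    have h5 : E' < 1 / 2 := by linarith
    exact ⟨E', h5, (mem_pointSpectrum_iff hα h5).2 h4, h3⟩
  choose! e he1 he2 he3 using hex
  refine ⟨(Finset.range k).image e, ?_, ?_⟩
  · rw [Finset.card_image_of_injOn, Finset.card_range]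
    intro i hi j hj hij
    rw [← he3 i (Finset.mem_range.1 (Finset.mem_coe.1 hi)),
      ← he3 j (Finset.mem_range.1 (Finset.mem_coe.1 hj)), hij]
  · intro x hx
    obtain ⟨i, hi, rfl⟩ := Finset.mem_image.1 hx
    have := Finset.mem_range.1 hi
    exact ⟨he1 i this, he2 i this⟩

/-! ### Positive definiteness -/

theorem one_lt_sqrt_two_div {α : ℝ} (hα : 0 < α) (hα2 : α < √2) : 1 < √2 / α := by
  rwa [one_lt_div hα]

/-- For this E the square of 2μκ_n is 4μ²n + 2 ≥ (√n + √(n+1))², so each diagonal entry pays for its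
two neighbouring edges. The left side is the share of the last entry not yet spent. -/
theorem form_nonneg {μ E : ℝ} (hμ : 1 < μ) (hE : 1 / 2 - E = 1 / (2 * μ ^ 2)) (C : ℕ → ℂ) (N : ℕ) :
    μ⁻¹ * (√((N : ℝ) + 1) * ‖C N‖ ^ 2) ≤
      (∑ n ∈ Finset.range (N + 1), 2 * √((n : ℝ) + 1 / 2 - E) * ‖C n‖ ^ 2) +
      μ⁻¹ * ∑ n ∈ Finset.range N, 2 * √((n : ℝ) + 1) * ((starRingEnd ℂ) (C (n + 1)) * C n).re := by
  have hμ0 : 0 < μ := by linarith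
  have hdiag : ∀ n : ℕ, μ⁻¹ * (√(n : ℝ) + √((n : ℝ) + 1)) ≤ 2 * √((n : ℝ) + 1 / 2 - E) := by
    intro n
    have hn : (0 : ℝ) ≤ n := by positivity
    rw [add_sub_assoc, hE, inv_mul_le_iff₀ hμ0]
    refine (pow_le_pow_iff_left₀ (by positivity) (by positivity) two_ne_zero).1 ?_
    have e1 : (√(n : ℝ)) ^ 2 = n := Real.sq_sqrt hn
    have e2 : (√((n : ℝ) + 1)) ^ 2 = n + 1 := Real.sq_sqrt (by positivity)
    have e3 : (μ * (2 * √((n : ℝ) + 1 / (2 * μ ^ 2)))) ^ 2 = 4 * μ ^ 2 * n + 2 := by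
      rw [mul_pow, mul_pow, Real.sq_sqrt (by positivity)]
      field_simp
      ring
    rw [e3]
    nlinarith [sq_nonneg (√(n : ℝ) - √((n : ℝ) + 1)), mul_nonneg hn (show 0 ≤ μ ^ 2 - 1 by nlinarith)]
  induction N with
  | zero =>
    have h1 := mul_le_mul_of_nonneg_right (hdiag 0) (sq_nonneg ‖C 0‖)
    simp only [Nat.cast_zero, Real.sqrt_zero, zero_add] at h1
    simp only [zero_add, Finset.sum_range_one, Finset.range_zero, Finset.sum_empty, mul_zero,
      add_zero, Nat.cast_zero]
    linarith
  | succ N ih =>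
    rw [Finset.sum_range_succ _ (N + 1), Finset.sum_range_succ (fun n : ℕ => 2 * √((n : ℝ) + 1) *
      ((starRingEnd ℂ) (C (n + 1)) * C n).re) N]
    have h1 := mul_le_mul_of_nonneg_right (hdiag (N + 1)) (sq_nonneg ‖C (N + 1)‖)
    have h2 : -(‖C (N + 1)‖ * ‖C N‖) ≤ ((starRingEnd ℂ) (C (N + 1)) * C N).re := by
      have h3 := (abs_le.1 (Complex.abs_re_le_norm ((starRingEnd ℂ) (C (N + 1)) * C N))).1
      rwa [norm_mul, Complex.norm_conj] at h3
    have h4 : 0 ≤ μ⁻¹ * √((N : ℝ) + 1) := by positivity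
    have h5 := mul_le_mul_of_nonneg_left h2 h4
    have h6 := mul_nonneg h4 (sq_nonneg (‖C (N + 1)‖ - ‖C N‖))
    push_cast at h1 ⊢
    linarith

theorem isPositiveDefinite {α : ℝ} (hα : 0 < α) (hα2 : α < √2) : IsPositiveDefinite (A α) := by
  have hμ := one_lt_sqrt_two_div hα hα2
  have hinv : α / √2 = (√2 / α)⁻¹ := (inv_div _ _).symm
  set μ := √2 / α with hμdef
  have hμ0 : 0 < μ := by linarith
  refine ⟨1 / 2 - 1 / (2 * μ ^ 2), ?_, fun U => ?_⟩
  · rw [sub_pos]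
    exact one_div_lt_one_div_of_lt (by norm_num) (by nlinarith)
  · have hact : ActsAs α (U : H) (A α U) := (mem_graph_iff α _ _).1 ((A α).mem_graph U)
    obtain ⟨C, hC⟩ := hact.exists_isTrace
    have hE : 1 / 2 - 1 / (2 * μ ^ 2) ≤ 1 / 2 := by
      have : 0 < 1 / (2 * μ ^ 2) := by positivity
      linarith
    refine ⟨hact.im_inner_eq_zero, hact.le_re_inner hC hE (Eventually.of_forall fun N => ?_)⟩
    rw [hinv]
    refine le_trans ?_ (form_nonneg hμ (sub_sub_cancel _ _) C N)
    positivity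

/-! ### The number of eigenvalues -/

/-- The eigenvalues below `1/2`. -/
def lowEigenvalues (α : ℝ) : Set ℝ := {E | E < 1 / 2 ∧ (E : ℂ) ∈ pointSpectrum (A α)}

theorem exists_lowEigenvalue {α : ℝ} (hα : 0 < α) (hα2 : α < √2) : (lowEigenvalues α).Nonempty := by
  have hμ := one_lt_sqrt_two_div hα hα2
  set μ := √2 / α with hμdef
  have hμ0 : 0 < μ := by linarith
  -- At E = 1/2 - τ² one has P_1 = 2μτ > 0, and √2 P_2 = 2μκ_1P_1 - 1 is negative because 4μ²τκ_1 ≤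
  -- 1/2. Hence P changes sign.
  set τ : ℝ := 1 / (16 * μ ^ 2) with hτ
  have hμ2 : 1 < μ ^ 2 := by nlinarith
  have hτ0 : 0 < τ := by positivity
  have hτ1 : τ < 1 / 16 := by
    rw [hτ]
    exact one_div_lt_one_div_of_lt (by norm_num) (by linarith)
  set E : ℝ := 1 / 2 - τ ^ 2 with hE
  obtain ⟨r0, r1⟩ := eigenSol_isJacobiSol μ E
  have r2 : 2 * μ * √((1 : ℝ) + 1 / 2 - E) * eigenSol μ E 1 = √((1 : ℝ) + 1) * eigenSol μ E 2 + 1 := by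
    have := r1 0
    simp only [diag, offDiag, eigenSol_zero, Nat.cast_zero, zero_add, Nat.cast_one, Real.sqrt_one,
      mul_one] at this
    exact this
  simp only [diag, offDiag, eigenSol_zero, Nat.cast_zero, zero_add, Real.sqrt_one, one_mul,
    mul_one] at r0
  rw [show (1 / 2 - E : ℝ) = τ ^ 2 by rw [hE]; ring, Real.sqrt_sq hτ0.le] at r0
  rw [← r0] at r2
  have h1 : √((1 : ℝ) + 1 / 2 - E) ≤ 2 := by
    apply Real.sqrt_le_iff.2
    constructor
    · norm_num
    · rw [hE]
      nlinarith
  have h2 : μ ^ 2 * τ = 1 / 16 := by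
    rw [hτ]
    field_simp
  have hd1 : 0 < eigenSol μ E 1 := by
    rw [← r0]
    positivity
  have hd2 : eigenSol μ E 2 < 0 := by
    have h3 : 2 * μ * √((1 : ℝ) + 1 / 2 - E) * (2 * μ * τ) ≤ 1 / 2 := by
      have h4 := mul_le_mul_of_nonneg_left h1 (show 0 ≤ 4 * (μ ^ 2 * τ) by positivity)
      have e : 2 * μ * √((1 : ℝ) + 1 / 2 - E) * (2 * μ * τ) = 4 * (μ ^ 2 * τ) * √((1 : ℝ) + 1 / 2 - E) := by
        ring
      rw [e]
      rw [h2] at h4 ⊢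
      linarith
    have h5 : (0 : ℝ) < √(1 + 1) := by positivity
    by_contra h6
    have := mul_nonneg h5.le (not_lt.1 h6)
    rw [r2] at h3
    exact absurd (le_trans (le_add_of_nonneg_left this) h3) (by norm_num)
  have hfin : (signChanges (eigenSol μ E)).Finite :=
    finite_signChanges_eigenSol hμ (by rw [hE]; nlinarith)
  have hpos : 0 < (signChanges (eigenSol μ E)).ncard :=
    (Set.ncard_pos hfin).2 ⟨1, hd1.ne', (mul_neg_of_pos_of_neg hd1 hd2).le⟩
  obtain ⟨s, hs1, hs2⟩ := exists_eigenvalues hα hμ (E := E) (by rw [hE]; nlinarith)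
    (by rw [hE]; nlinarith)
  rw [← hs1, Finset.card_pos] at hpos
  obtain ⟨x, hx⟩ := hpos
  exact ⟨x, hs2 x hx⟩

/-- The rate `√(μ² - 1) / μ`, with `μ = √2 / α`. -/
noncomputable def rate (α : ℝ) : ℝ := √((√2 / α) ^ 2 - 1) / (√2 / α)

theorem rate_pos {α : ℝ} (hα : 0 < α) (hα2 : α < √2) : 0 < rate α := by
  have hμ := one_lt_sqrt_two_div hα hα2
  have : 0 < (√2 / α) ^ 2 - 1 := by nlinarith
  unfold rate
  positivity

/-- ξ and η are the roots μ ∓ √(μ²-1) of X² - 2μX + 1. -/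
theorem exists_meixner_parameters {α : ℝ} (hα : 0 < α) (hα2 : α < √2) : ∃ ξ η : ℝ, 0 < ξ ∧ ξ < 1 ∧
    0 < η ∧ ξ * η = 1 ∧ ξ + η = 2 * (√2 / α) ∧
    ∀ m : ℝ, (m + 1) * ξ - m * η = √2 / α * (1 - (2 * m + 1) * rate α) := by
  have hμ := one_lt_sqrt_two_div hα hα2
  unfold rate
  set μ := √2 / α with hμdef
  have hμ0 : 0 < μ := by linarith
  have hs2 : (√(μ ^ 2 - 1)) ^ 2 = μ ^ 2 - 1 := Real.sq_sqrt (by nlinarith)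
  have hs0 : 0 ≤ √(μ ^ 2 - 1) := Real.sqrt_nonneg _
  set s := √(μ ^ 2 - 1) with hs
  have h1 : (μ - s) * (μ + s) = 1 := by nlinarith
  have h2 : 0 < μ + s := by linarith
  have h3 : 0 < μ - s := by
    by_contra h
    nlinarith
  refine ⟨μ - s, μ + s, h3, ?_, h2, h1, by ring, fun m => ?_⟩
  · by_contra h
    nlinarith
  · field_simp
    ring

theorem card_lowEigenvalues_le {α : ℝ} (hα : 0 < α) (hα2 : α < √2) {ε : ℝ} (hε : 0 < ε) {m M : ℕ}
    (hM : 1 ≤ 2 * ε * M) (hm : 1 / 2 + 2 * ε ≤ (2 * m + 1) * rate α) (s : Finset ℝ)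
    (hs : ∀ E ∈ s, E ∈ lowEigenvalues α) : s.card ≤ M + m := by
  have hμ := one_lt_sqrt_two_div hα hα2
  obtain ⟨ξ, η, -, -, h3, h4, h5, h6⟩ := exists_meixner_parameters hα hα2
  refine card_eigenvalues_le_add hα hμ.le h4 h3 h5 hε hM ?_ s hs
  rw [h6]
  have := mul_le_mul_of_nonneg_left hm (show 0 ≤ √2 / α by linarith)
  linarith

theorem finite_lowEigenvalues {α : ℝ} (hα : 0 < α) (hα2 : α < √2) : (lowEigenvalues α).Finite := by
  obtain ⟨m, hm⟩ := exists_nat_ge (1 / rate α)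
  rw [div_le_iff₀ (rate_pos hα hα2)] at hm
  by_contra hinf
  obtain ⟨s, hs1, hs2⟩ := Set.Infinite.exists_subset_card_eq hinf (4 + m + 1)
  -- ε = 1/8 makes M = 4 admissible, and m · rate ≥ 1 exceeds the required 1/2 + 2ε = 3/4.
  have := card_lowEigenvalues_le hα hα2 (ε := 1 / 8) (by norm_num) (m := m) (M := 4) (by norm_num)
    (by have := rate_pos hα hα2; linarith) s hs1
  omega

theorem ncard_lowEigenvalues_le {α : ℝ} (hα : 0 < α) (hα2 : α < √2) {ε : ℝ} (hε : 0 < ε) {m M : ℕ}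
    (hM : 1 ≤ 2 * ε * M) (hm : 1 / 2 + 2 * ε ≤ (2 * m + 1) * rate α) :
    (lowEigenvalues α).ncard ≤ M + m := by
  have hfin := finite_lowEigenvalues hα hα2
  rw [Set.ncard_eq_toFinset_card _ hfin]
  exact card_lowEigenvalues_le hα hα2 hε hM hm _ fun E hE => hfin.mem_toFinset.1 hE

theorem le_ncard_lowEigenvalues {α : ℝ} (hα : 0 < α) (hα2 : α < √2) {ε : ℝ} (hε : 0 < ε) {m M : ℕ}
    (hM : 1 ≤ 2 * ε * M) (hm : (2 * m + 1) * rate α ≤ 1 / 2 - 2 * ε) :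
    m ≤ M + (lowEigenvalues α).ncard := by
  have hμ := one_lt_sqrt_two_div hα hα2
  obtain ⟨ξ, η, h1, h2, h3, h4, h5, h6⟩ := exists_meixner_parameters hα hα2
  obtain ⟨E, hE0, hE, hle⟩ := exists_ncard_signChanges_ge hμ h4 h1 h2 h5 hε (m := m) hM (by
    rw [h6]
    have := mul_le_mul_of_nonneg_left hm (show 0 ≤ √2 / α by linarith)
    linarith)
  obtain ⟨s, hs1, hs2⟩ := exists_eigenvalues hα hμ hE0 hE
  have hfin := finite_lowEigenvalues hα hα2
  have h7 := Set.ncard_le_ncard (s := (s : Set ℝ)) (t := lowEigenvalues α) (fun x hx => hs2 x hx) hfin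
  rw [Set.ncard_coe_finset] at h7
  omega

theorem abs_ncard_mul_rate_sub_le {α : ℝ} (hα : 0 < α) (hα2 : α < √2) {ε : ℝ} (hε : 0 < ε) {M : ℕ}
    (hM : 1 ≤ 2 * ε * M) :
    |(lowEigenvalues α).ncard * rate α - 1 / 4| ≤ ε + (M + 2) * rate α := by
  have hθ := rate_pos hα hα2
  have hN0 : (0 : ℝ) ≤ (lowEigenvalues α).ncard * rate α := by positivity
  have hM0 : (0 : ℝ) ≤ M * rate α := by positivity
  rw [abs_le]
  constructor
  -- The lower bound uses the largest m with (2m+1) · rate ≤ 1/2 - 2ε; if there is none, rate is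
  -- already so large that the estimate is trivial.
  · rcases lt_or_ge ((1 / 4 - ε) / rate α - 1 / 2) 0 with hx | hx
    · rw [sub_neg, div_lt_iff₀ hθ] at hx
      linarith
    · have h1 := Nat.floor_le hx
      have h2 := Nat.lt_floor_add_one ((1 / 4 - ε) / rate α - 1 / 2)
      set m := ⌊(1 / 4 - ε) / rate α - 1 / 2⌋₊ with hm
      rw [le_sub_iff_add_le, le_div_iff₀ hθ] at h1
      rw [sub_lt_iff_lt_add, div_lt_iff₀ hθ] at h2
      have h3 := le_ncard_lowEigenvalues hα hα2 hε (m := m) hM (by linarith)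
      have h4 : (m : ℝ) ≤ M + (lowEigenvalues α).ncard := by exact_mod_cast h3
      have h5 := mul_le_mul_of_nonneg_right h4 hθ.le
      linarith
  · have h1 := Nat.le_ceil ((1 / 4 + ε) / rate α)
    have h2 := Nat.ceil_lt_add_one (show 0 ≤ (1 / 4 + ε) / rate α by positivity)
    set m := ⌈(1 / 4 + ε) / rate α⌉₊ with hm
    rw [div_le_iff₀ hθ] at h1
    rw [← sub_lt_iff_lt_add, lt_div_iff₀ hθ] at h2
    have h3 := ncard_lowEigenvalues_le hα hα2 hε (m := m) hM (by linarith)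
    have h4 : ((lowEigenvalues α).ncard : ℝ) ≤ M + m := by exact_mod_cast h3
    have h5 := mul_le_mul_of_nonneg_right h4 hθ.le
    linarith

theorem eventually_pos_lt : ∀ᶠ α : ℝ in 𝓝[<] √2, 0 < α ∧ α < √2 :=
  (eventually_nhdsWithin_of_eventually_nhds (lt_mem_nhds (by positivity))).and
    self_mem_nhdsWithin

theorem tendsto_sqrt_two_div : Tendsto (fun α : ℝ => √2 / α) (𝓝[<] √2) (𝓝 1) := by
  have h : ContinuousAt (fun α : ℝ => √2 / α) √2 :=
    continuousAt_const.div continuousAt_id (by positivity)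
  have h2 := h.tendsto.mono_left (nhdsWithin_le_nhds (s := Iio √2))
  rwa [div_self (by positivity)] at h2

theorem tendsto_rate : Tendsto rate (𝓝[<] √2) (𝓝 0) := by
  have h := (((tendsto_sqrt_two_div.pow 2).sub_const 1).sqrt).div tendsto_sqrt_two_div one_ne_zero
  simp only [one_pow, sub_self, Real.sqrt_zero, zero_div] at h
  exact h

theorem tendsto_ncard_mul_rate :
    Tendsto (fun α => (lowEigenvalues α).ncard * rate α) (𝓝[<] √2) (𝓝 (1 / 4)) := by
  rw [Metric.tendsto_nhds]
  intro δ hδ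
  obtain ⟨M, hM⟩ := exists_nat_ge (1 / δ)
  rw [div_le_iff₀ hδ] at hM
  have h1 : Tendsto (fun α => ((M : ℝ) + 2) * rate α) (𝓝[<] √2) (𝓝 0) := by
    simpa using tendsto_rate.const_mul ((M : ℝ) + 2)
  filter_upwards [eventually_pos_lt, h1.eventually (gt_mem_nhds (half_pos hδ))] with α hα h2
  rw [Real.dist_eq]
  have := abs_ncard_mul_rate_sub_le hα.1 hα.2 (half_pos hδ) (M := M) (by linarith)
  linarith

/-- Every eigenvalue is simple, so counting with multiplicity is counting points. -/
theorem eigenvalueCount_eq {α : ℝ} (hα : 0 < α) :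
    eigenvalueCount (1 / 2) (A α) = (lowEigenvalues α).ncard := by
  have h0 : ∀ E : ℝ, (E : ℂ) ∉ pointSpectrum (A α) →
      Module.finrank ℂ (eigenspace (A α) (E : ℂ)) = 0 := by
    intro E hE
    have : eigenspace (A α) (E : ℂ) = ⊥ := by
      rw [Submodule.eq_bot_iff]
      intro U hU
      by_contra hne
      exact hE ⟨U, hU, hne⟩
    rw [this, finrank_bot]
  rw [eigenvalueCount,
    finsum_set_coe_eq_finsum_mem (f := fun E : ℝ => Module.finrank ℂ (eigenspace (A α) (E : ℂ))),
    ← finsum_mem_inter_support, ← finsum_one]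
  have hset : Iio (1 / 2) ∩ Function.support
      (fun E : ℝ => Module.finrank ℂ (eigenspace (A α) (E : ℂ))) = lowEigenvalues α := by
    ext E
    simp only [lowEigenvalues, mem_inter_iff, mem_Iio, Function.mem_support, mem_ofPred_eq]
    refine and_congr_right fun _ => ⟨fun h => ?_, fun h => ?_⟩
    · by_contra h2
      exact h (h0 E h2)
    · rw [finrank_eigenspace hα h]
      exact one_ne_zero
  rw [hset]
  exact finsum_mem_congr rfl fun E hE => finrank_eigenspace hα hE.2

theorem eigenvalueCount_isEquivalent :
    (fun α : ℝ => (eigenvalueCount (1 / 2) (A α) : ℝ)) ~[𝓝[<] √2]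
      (fun α : ℝ => 1 / (4 * √(2 * (√2 / α - 1)))) := by
  have hne : ∀ᶠ α : ℝ in 𝓝[<] √2, 1 / (4 * √(2 * (√2 / α - 1))) ≠ 0 := by
    filter_upwards [eventually_pos_lt] with α hα
    have : 0 < √2 / α - 1 := sub_pos.2 (one_lt_sqrt_two_div hα.1 hα.2)
    positivity
  rw [isEquivalent_iff_tendsto_one hne]
  -- The factor converts rate into the stated quantity: √(μ²-1) · √(2/(μ+1)) = √(2(μ-1)).
  have h1 : Tendsto (fun α : ℝ => √2 / α * √(2 / (√2 / α + 1))) (𝓝[<] √2) (𝓝 1) := by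
    have h2 : Tendsto (fun α : ℝ => √2 / α * √(2 / (√2 / α + 1))) (𝓝[<] √2)
        (𝓝 (1 * √(2 / (1 + 1)))) :=
      tendsto_sqrt_two_div.mul ((tendsto_const_nhds.div (tendsto_sqrt_two_div.add_const 1)
        (by norm_num)).sqrt)
    have h3 : (1 : ℝ) * √(2 / (1 + 1)) = 1 := by norm_num
    rwa [h3] at h2
  have h4 := (tendsto_ncard_mul_rate.const_mul 4).mul h1
  rw [show (4 * (1 / 4) * 1 : ℝ) = 1 by norm_num] at h4
  refine h4.congr' ?_
  filter_upwards [eventually_pos_lt] with α hα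
  have hμ := one_lt_sqrt_two_div hα.1 hα.2
  rw [Pi.div_apply, eigenvalueCount_eq hα.1, rate]
  set μ := √2 / α with hμdef
  have hμ0 : 0 < μ := by linarith
  have h5 : √(μ ^ 2 - 1) * √(2 / (μ + 1)) = √(2 * (μ - 1)) := by
    rw [← Real.sqrt_mul (by nlinarith)]
    congr 1
    field_simp
    ring
  rw [← h5, one_div (4 * _), div_inv_eq_mul]
  have hμ1 : μ ≠ 0 := hμ0.ne'
  generalize √(μ ^ 2 - 1) = x
  generalize √(2 / (μ + 1)) = y
  field_simp

end Smilansky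

theorem theorem5p2 :
    (∀ α : ℝ, 0 ≤ α → ∀ E : ℝ, 1 / 2 ≤ E → (E : ℂ) ∉ Smilansky.pointSpectrum (Smilansky.A α)) ∧
    (∀ α : ℝ, √2 ≤ α → Smilansky.pointSpectrum (Smilansky.A α) = ∅) ∧
    (∀ α : ℝ, 0 < α → α < √2 →
      Smilansky.IsPositiveDefinite (Smilansky.A α) ∧
      (Smilansky.pointSpectrum (Smilansky.A α)).Nonempty ∧
      (Smilansky.pointSpectrum (Smilansky.A α)).Finite ∧
      (∀ z ∈ Smilansky.pointSpectrum (Smilansky.A α),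
        (∃ E : ℝ, E < 1 / 2 ∧ z = (E : ℂ)) ∧
        FiniteDimensional ℂ (Smilansky.eigenspace (Smilansky.A α) z))) ∧
    (fun α : ℝ => (Smilansky.eigenvalueCount (1 / 2) (Smilansky.A α) : ℝ)) ~[𝓝[<] √2]
      (fun α : ℝ => 1 / (4 * √(2 * (√2 / α - 1)))) := by
  refine ⟨fun α hα E hE => Smilansky.no_eigenvalue_ge_half hα hE,
    fun α hα => Smilansky.pointSpectrum_eq_empty hα, fun α hα hα2 => ?_,
    Smilansky.eigenvalueCount_isEquivalent⟩
  have hreal : ∀ z ∈ Smilansky.pointSpectrum (Smilansky.A α),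
      ∃ E : ℝ, E < 1 / 2 ∧ z = (E : ℂ) := fun z hz => by
    refine ⟨z.re, ?_, Smilansky.eigenvalue_real hz⟩
    by_contra h
    rw [Smilansky.eigenvalue_real hz] at hz
    exact Smilansky.no_eigenvalue_ge_half hα.le (not_lt.1 h) hz
  refine ⟨Smilansky.isPositiveDefinite hα hα2, ?_, ?_, fun z hz => ⟨hreal z hz, ?_⟩⟩
  · obtain ⟨E, hE⟩ := Smilansky.exists_lowEigenvalue hα hα2
    exact ⟨_, hE.2⟩
  · refine ((Smilansky.finite_lowEigenvalues hα hα2).image (fun E : ℝ => (E : ℂ))).subset ?_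
    intro z hz
    obtain ⟨E, hE, rfl⟩ := hreal z hz
    exact ⟨E, ⟨hE, hz⟩, rfl⟩
  · obtain ⟨E, hE, rfl⟩ := hreal z hz
    refine Module.finite_of_finrank_pos ?_
    rw [Smilansky.finrank_eigenspace hα hz]
    exact one_pos
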